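/- **Setting.** Let $M$ be finite and let $A_i$ ($i\ge -1$), $B_i$ ($i\ge 0$) be nonnegative real $M\times M$ matrices with $\sum_i A_i$ and $\sum_i B_i$ stochastic, such that the M/G/1-type Markov chain with block transition matrix $$P=\begin{bmatrix}B_0&B_1&B_2&\cdots\\A_{-1}&A_0&A_1&\cdots\\0&A_{-1}&A_0&\cdots\\ \vdots&\ddots&\ddots&\ddots\end{bmatrix}$$ is irreducible and ergodic. Let $\varphi(z)=\sum_{i\ge-1}z^{i+1}A_i$ be analytic in $|z|<r$ for some $r>1$, and let $z=1$ be a simple zero of $\det(zI-\varphi(z))$ and its only zero of modulus $1$. **Shift.** Let $u\in\mathbb R^M$ have positive entries with $u^\top\mathbf 1=1$, $Q=\mathbf 1u^\top$, and put $\widetilde A_{-1}=A_{-1}(I-Q)$, $\widetilde A_i=A_i-\bigl(\sum_{j=-1}^iA_j-I\bigr)Q$ for $i\ge0$. **Cyclic reduction.** For a matrix power series $S(z)=\sum_{k\ge0}z^kS_k$ write $S_{even}(z)=\sum_k z^kS_{2k}$, $S_{odd}(z)=\sum_kz^kS_{2k+1}$ and $\|S\|_*=\bigl\|\sum_k|S_k|\bigr\|_\infty$;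 the Wiener algebra consists of the $S$ with $\|S\|_*<\infty$. Let $\mathcal T(\varphi,\hat\varphi)=(\varphi',\hat\varphi')$ with $$\varphi'=z\varphi_{odd}+\varphi_{even}(I-\varphi_{odd})^{-1}\varphi_{even}$$ and with $\hat\varphi'$ given by either one of the two forms $$\text{(a)}\ \hat\varphi'=\hat\varphi_{odd}+\varphi_{even}(I-\varphi_{odd})^{-1}\hat\varphi_{even},\qquad \text{(b)}\ \hat\varphi'=\hat\varphi_{even}+\hat\varphi_{odd}(I-\varphi_{odd})^{-1}\varphi_{even}$$ (the statement holds for each form; (b) is the first block row of the Schur complement computed by cyclic reduction). Let $\varphi^{(0)}=\sum_{i\ge-1}z^{i+1}\widetilde A_i$, $\hat\varphi^{(0)}=\sum_{i\ge0}z^i\widetilde A_i$ and $(\varphi^{(n+1)},\hat\varphi^{(n+1)})=\mathcal T(\varphi^{(n)},\hat\varphi^{(n)})$. Assume that cyclic reduction is applicable, i.e. $I-\varphi^{(n)}_{odd}$ has an inverse in the Wiener algebra for every $n\ge0$. Put $V^{(n)}=\varphi^{(n)}_{even}(I-\varphi^{(n)}_{odd})^{-1}$, $W^{(n)}=(I-\varphi^{(n)}_{odd})^{-1}\varphi^{(n)}_{even}$,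 and $\hat W^{(n)}=(I-\varphi^{(n)}_{odd})^{-1}\hat\varphi^{(n)}_{even}$ for form (a), $\hat W^{(n)}=\hat\varphi^{(n)}_{odd}(I-\varphi^{(n)}_{odd})^{-1}$ for form (b). **Errors.** An implementation is any sequence of maps $\mathcal T_{F,n}$ on pairs of matrix power series with complex coefficients (it models the quantum realization of the steps, including truncation). Let $(\vartheta^{(0)},\hat\vartheta^{(0)})=(\varphi^{(0)},\hat\varphi^{(0)})$, $(\vartheta^{(n+1)},\hat\vartheta^{(n+1)})=\mathcal T_{F,n}(\vartheta^{(n)},\hat\vartheta^{(n)})$. The local errors are $(\mathcal E_L^{(n)},\hat{\mathcal E}_L^{(n)})=(\mathcal T_{F,n}-\mathcal T)(\vartheta^{(n)},\hat\vartheta^{(n)})$, the global errors $(E^{(n)},\hat E^{(n)})=(\vartheta^{(n)},\hat\vartheta^{(n)})-(\varphi^{(n)},\hat\varphi^{(n)})$. **Theorem 3.** There are $\theta>0$ and $0<\sigma<1$ such that $\|V^{(n)}\|_*$, $\|W^{(n)}\|_*$, $\|\hat W^{(n)}\|_*\le\theta\sigma^{2^n}$ for all $n\ge0$. For all such $\theta,\sigma$,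 with $\gamma_n=(1+\theta\sigma^{2^n})^2$, and for every $n\ge0$: there are $C,\upsilon_0>0$ such that for every $0<\upsilon\le\upsilon_0$ and every implementation with $\|\mathcal E_L^{(k)}\|_*\le\upsilon$ and $\|\hat{\mathcal E}_L^{(k)}\|_*\le\upsilon$ for $0\le k\le n$, $$\|E^{(n+1)}\|_*,\ \|\hat E^{(n+1)}\|_*\ \le\ \upsilon\,(1+\gamma_n+\gamma_{n-1}\gamma_n+\cdots+\gamma_1\gamma_2\cdots\gamma_n)+C\upsilon^2 ,$$ and for every $\upsilon>0$ $$\upsilon\,(1+\gamma_n+\gamma_{n-1}\gamma_n+\cdots+\gamma_1\gamma_2\cdots\gamma_n)\ \le\ \upsilon\Bigl(1+n\exp\Bigl(2\theta\frac{\sigma^2}{1-\sigma^2}\Bigr)\Bigr),$$ so that the first-order bound is linear in $n$. -/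

import Mathlib

open scoped ENNReal

noncomputable section

namespace MG1

/-! ### The M/G/1-type Markov process

The blocks `A₋₁, A₀, A₁, …` are stored with the index moved up by one: `A k` is the
block `A_{k-1}`, so that `A k` is the coefficient of `z ^ k` in `φ(z) = ∑ z^{i+1} A_i`. -/

/-- Transition matrix on the states (level, phase): the first block row is `B₀ B₁ B₂ …`, and
the block from level `l + 1` to level `m` is `A_{m-(l+1)}` (zero if `m < l`). -/
def transition {M : ℕ} (A B : ℕ → Matrix (Fin M) (Fin M) ℝ) :
    ℕ × Fin M → ℕ × Fin M → ℝ
  | (0, i), (m, j) => B m i j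
  | (l + 1, i), (m, j) => if l ≤ m then A (m - l) i j else 0

/-- `y` can be reached from `x` in exactly `n` steps of positive probability. -/
def Reaches {S : Type*} (P : S → S → ℝ) : ℕ → S → S → Prop
  | 0, x, y => x = y
  | n + 1, x, y => ∃ w, Reaches P n x w ∧ 0 < P w y

/-- Irreducible, aperiodic, and positive recurrent (there is an invariant probability vector). -/
structure IsErgodicChain {S : Type*} (P : S → S → ℝ) : Prop where
  irreducible : ∀ x y, ∃ n, Reaches P n x y
  aperiodic : ∀ x (d : ℕ), (∀ n, Reaches P n x x → d ∣ n) → d = 1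
  invariant : ∃ p : S → ℝ, (∀ x, 0 ≤ p x) ∧ HasSum p 1 ∧
    ∀ y, HasSum (fun x => p x * P x y) (p y)

/-- The blocks are nonnegative, `∑ A_i` and `∑ B_i` are stochastic, and the chain is ergodic. -/
structure IsErgodicMG1 {M : ℕ} (A B : ℕ → Matrix (Fin M) (Fin M) ℝ) : Prop where
  A_nonneg : ∀ k i j, 0 ≤ A k i j
  B_nonneg : ∀ k i j, 0 ≤ B k i j
  A_stochastic : ∀ i, HasSum (fun k => ∑ j, A k i j) 1
  B_stochastic : ∀ i, HasSum (fun k => ∑ j, B k i j) 1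
  ergodic : IsErgodicChain (transition A B)

/-- `φ(z) = ∑ z^{i+1} A_i` at a complex number `z`, entry by entry. -/
def phiAt {M : ℕ} (A : ℕ → Matrix (Fin M) (Fin M) ℝ) (z : ℂ) : Matrix (Fin M) (Fin M) ℂ :=
  Matrix.of fun i j => ∑' k, z ^ k * (A k i j : ℂ)

/-- `a(z) = det (z I - φ(z))`. -/
def charDet {M : ℕ} (A : ℕ → Matrix (Fin M) (Fin M) ℝ) (z : ℂ) : ℂ :=
  (z • (1 : Matrix (Fin M) (Fin M) ℂ) - phiAt A z).det

/-- `φ` is analytic in a disk `|z| < r` with `r > 1`, and `z = 1` is a simple zero of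
`det (z I - φ(z))` and its only zero of modulus one. -/
structure HasSimpleUnitRoot {M : ℕ} (A : ℕ → Matrix (Fin M) (Fin M) ℝ) : Prop where
  analytic : ∃ r : ℝ, 1 < r ∧ ∀ i j, Summable fun k => A k i j * r ^ k
  unique_root : ∀ z : ℂ, ‖z‖ = 1 → charDet A z = 0 → z = 1
  simple_root : deriv (charDet A) 1 ≠ 0

/-! ### The shift -/

/-- `Q = 1 uᵀ`. -/
def shiftQ {M : ℕ} (u : Fin M → ℝ) : Matrix (Fin M) (Fin M) ℝ :=
  Matrix.of fun _ j => u j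

/-- `Ã₋₁ = A₋₁ (I - Q)` and `Ã_i = A_i - (∑_{j=-1}^{i} A_j - I) Q` for `i ≥ 0`; again the
index is moved up by one. -/
def shifted {M : ℕ} (A : ℕ → Matrix (Fin M) (Fin M) ℝ) (u : Fin M → ℝ) :
    ℕ → Matrix (Fin M) (Fin M) ℝ
  | 0 => A 0 * (1 - shiftQ u)
  | i + 1 => A (i + 1) - (∑ j ∈ Finset.range (i + 2), A j - 1) * shiftQ u

/-! ### Matrix power series -/

/-- Matrix power series in `z` (complex entries, formal). -/
abbrev MSeries (M : ℕ) : Type := PowerSeries (Matrix (Fin M) (Fin M) ℂ)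

/-- `‖S‖_* = ‖ ∑_k |S_k| ‖_∞`, the largest row sum of `∑_k |S_k|`; it is finite exactly when
`S` belongs to the Wiener algebra. -/
def starNorm {M : ℕ} (S : MSeries M) : ℝ≥0∞ :=
  ⨆ i, ∑ j, ∑' k, ‖PowerSeries.coeff k S i j‖ₑ

/-- `S_even(z) = ∑ z^k S_{2k}`. -/
def evenPart {M : ℕ} (S : MSeries M) : MSeries M :=
  PowerSeries.mk fun k => PowerSeries.coeff (2 * k) S

/-- `S_odd(z) = ∑ z^k S_{2k+1}`. -/
def oddPart {M : ℕ} (S : MSeries M) : MSeries M :=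
  PowerSeries.mk fun k => PowerSeries.coeff (2 * k + 1) S

/-- `K(z) = (I - φ_odd(z))⁻¹` (as a formal power series, zero if there is no inverse). -/
def kernelInv {M : ℕ} (p : MSeries M) : MSeries M :=
  Ring.inverse (1 - oddPart p)

/-! ### Cyclic reduction -/

/-- The two forms in which the recursion for the first block row `φ̂` is written:
`schur` is the first block row of the Schur complement `I - U₂₂ - U₂₁ (I - U₁₁)⁻¹ U₁₂`, and
`mirrored` has the two parities and the order of the factors exchanged. -/
inductive HatForm where
  | schur
  | mirrored

/-- One exact step of cyclic reduction, `(φ, φ̂) ↦ 𝒯(φ, φ̂)`. -/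
def crStep {M : ℕ} (form : HatForm) (p : MSeries M × MSeries M) : MSeries M × MSeries M :=
  (PowerSeries.X * oddPart p.1 + evenPart p.1 * kernelInv p.1 * evenPart p.1,
    match form with
    | .schur => evenPart p.2 + oddPart p.2 * kernelInv p.1 * evenPart p.1
    | .mirrored => oddPart p.2 + evenPart p.1 * kernelInv p.1 * evenPart p.2)

/-- The pair `(∑_{i ≥ -1} z^{i+1} C_i, ∑_{i ≥ 0} z^i C_i)` of real blocks `C_i = C (i + 1)`. -/
def initialPair {M : ℕ} (C : ℕ → Matrix (Fin M) (Fin M) ℝ) : MSeries M × MSeries M :=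
  (PowerSeries.mk fun k => (C k).map Complex.ofReal,
    PowerSeries.mk fun k => (C (k + 1)).map Complex.ofReal)

/-- The exact iterates `(φ^{(n)}, φ̂^{(n)})` of cyclic reduction applied to the shifted blocks. -/
def exactSeq {M : ℕ} (form : HatForm) (A : ℕ → Matrix (Fin M) (Fin M) ℝ) (u : Fin M → ℝ) :
    ℕ → MSeries M × MSeries M
  | 0 => initialPair (shifted A u)
  | n + 1 => crStep form (exactSeq form A u n)

/-- The computed iterates `(ϑ^{(n)}, ϑ̂^{(n)})`: same start, the step being carried out by the
implementation `TF` (which may depend on the iteration). -/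
def computedSeq {M : ℕ} (A : ℕ → Matrix (Fin M) (Fin M) ℝ) (u : Fin M → ℝ)
    (TF : ℕ → MSeries M × MSeries M → MSeries M × MSeries M) : ℕ → MSeries M × MSeries M
  | 0 => initialPair (shifted A u)
  | n + 1 => TF n (computedSeq A u TF n)

/-- Local error at iteration `n`: `𝒯_F(ϑ^{(n)}, ϑ̂^{(n)}) - 𝒯(ϑ^{(n)}, ϑ̂^{(n)})`. -/
def localError {M : ℕ} (form : HatForm) (A : ℕ → Matrix (Fin M) (Fin M) ℝ) (u : Fin M → ℝ)
    (TF : ℕ → MSeries M × MSeries M → MSeries M × MSeries M) (n : ℕ) : MSeries M × MSeries M :=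
  TF n (computedSeq A u TF n) - crStep form (computedSeq A u TF n)

/-- Global error `(E^{(n)}, Ê^{(n)}) = (ϑ^{(n)}, ϑ̂^{(n)}) - (φ^{(n)}, φ̂^{(n)})`. -/
def globalError {M : ℕ} (form : HatForm) (A : ℕ → Matrix (Fin M) (Fin M) ℝ) (u : Fin M → ℝ)
    (TF : ℕ → MSeries M × MSeries M → MSeries M × MSeries M) (n : ℕ) : MSeries M × MSeries M :=
  computedSeq A u TF n - exactSeq form A u n

/-- Cyclic reduction applies to the shifted blocks without breakdown: at every iteration
`I - φ_odd^{(n)}` has an inverse in the Wiener algebra. -/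
def NoBreakdown {M : ℕ} (form : HatForm) (A : ℕ → Matrix (Fin M) (Fin M) ℝ)
    (u : Fin M → ℝ) : Prop :=
  ∀ n, IsUnit (1 - oddPart (exactSeq form A u n).1) ∧
    starNorm (kernelInv (exactSeq form A u n).1) ≠ ⊤

/-! ### The amplification factors -/

/-- `V = φ_even (I - φ_odd)⁻¹`. -/
def seriesV {M : ℕ} (p : MSeries M × MSeries M) : MSeries M :=
  evenPart p.1 * kernelInv p.1

/-- `W = (I - φ_odd)⁻¹ φ_even`. -/
def seriesW {M : ℕ} (p : MSeries M × MSeries M) : MSeries M :=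
  kernelInv p.1 * evenPart p.1

/-- The corresponding factor formed with `φ̂`: `Ŵ = (I - φ_odd)⁻¹ φ̂_even` in the mirrored form,
`V̂ = φ̂_odd (I - φ_odd)⁻¹` in the Schur complement form. -/
def seriesHat {M : ℕ} (form : HatForm) (p : MSeries M × MSeries M) : MSeries M :=
  match form with
  | .schur => oddPart p.2 * kernelInv p.1
  | .mirrored => kernelInv p.1 * evenPart p.2

/-- `θ > 0` and `0 < σ < 1` are such that `θ σ^{2^n}` bounds the factors for every `n`. -/
structure IsRate {M : ℕ} (form : HatForm) (A : ℕ → Matrix (Fin M) (Fin M) ℝ) (u : Fin M → ℝ)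
    (θ σ : ℝ) : Prop where
  theta_pos : 0 < θ
  sigma_pos : 0 < σ
  sigma_lt_one : σ < 1
  bound_V : ∀ n, starNorm (seriesV (exactSeq form A u n)) ≤ ENNReal.ofReal (θ * σ ^ 2 ^ n)
  bound_W : ∀ n, starNorm (seriesW (exactSeq form A u n)) ≤ ENNReal.ofReal (θ * σ ^ 2 ^ n)
  bound_hat : ∀ n, starNorm (seriesHat form (exactSeq form A u n)) ≤
    ENNReal.ofReal (θ * σ ^ 2 ^ n)

/-- `γ_n = (1 + θ σ^{2^n})²`. -/
def gam (θ σ : ℝ) (n : ℕ) : ℝ := (1 + θ * σ ^ 2 ^ n) ^ 2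

/-- `1 + γ_n + γ_{n-1} γ_n + ⋯ + γ_1 γ_2 ⋯ γ_n`. -/
def gamSum (θ σ : ℝ) (n : ℕ) : ℝ :=
  ∑ k ∈ Finset.range (n + 1), ∏ i ∈ Finset.Icc (k + 1) n, gam θ σ i

end MG1

end

open MG1

/-!
The statement has two halves: the double exponential decay of the factors `V`, `W`, `V̂` (or `Ŵ`),
and the propagation of errors given such a decay.

**Propagation of errors.** To first order a perturbation `E` of `φ` is mapped by a step of cyclic
reduction to `D𝒯[E] = z E_odd + V E_odd W + E_even W + V E_even`. Since
`∑ₖ |E_even,k| + ∑ₖ |E_odd,k| = ∑ₖ |E_k|`, entrywise `|D𝒯[E]| ≤ (I + |V|) |E| (I + |W|)`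
(`starNorm_linPart_le`; likewise for `φ̂`), so the amplification is by `(1 + θ σ^(2ⁿ))² = γₙ`. The
remainder is quadratic in `E` (`starNorm_crStep_sub_le`), with constants that depend on the exact
iterates only. Hence `e_{n+1} ≤ υ + γₙ eₙ + c eₙ²`, which is unrolled in `exists_error_bound`.

**Decay of the factors.** The shift moves the root `z = 1` of `det (z - φ(z))` to the origin, so
the symbol `z - φ̃(z)` of the shifted chain is invertible on the unit circle
(`isUnit_symbol_shifted`) and therefore on an annulus around it. The Laurent coefficients `H(k)` of
`(I - z⁻¹ φ̃(z))⁻¹` then decay exponentially in `|k|` (`greenCoeff_decay`). A step of cyclic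
reduction replaces `φ` by the series whose inverse symbol is the even part of the given one
(`act_cyclicReduction`), so that `(I - z⁻¹ φ⁽ⁿ⁾(z))⁻¹` has the coefficients `H(2ⁿ k)`, which away
from `k = 0` are of size `q^(2ⁿ |k|)` with `q < 1`. If `H(0)` is invertible, it follows that
`φ⁽ⁿ⁾(z)` is doubly exponentially close to `z (I - H(0)⁻¹)`, even in disks of radius `p^(-2ⁿ)`
(`rnorm_sub_le_of_act`), and the factors `V` and `W` are doubly exponentially small.

**Invertibility of `H(0)`** is where ergodicity enters (`isUnit_central`). If `H(0) x = 0`, undoing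
the shift yields a bounded function on `ℤ × {phases}` that is harmonic for the random walk with
steps `A_j` except for the source `x` on level zero, vanishes at `-∞`, and is constant on level
zero, with the value of its `u`-mean `c` on level `-1`. By positive recurrence it is constant on
the levels `≥ 0` (`eq_const_of_harmonic`); by the maximum principle it is at most `c` (if `c ≥ 0`)
on the levels `< 0` (`le_const_of_harmonic`). As `u > 0`, it equals `c` on level `-1` too, so that
there is no source: `x = 0`.

**The factor formed with `φ̂`.** The series `φ̂⁽ⁿ⁾` need not tend to zero, but in disks whose radius
is squared at every step its norm at most doubles (`rnorm_hat_step`), and one parity of its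
coefficients gains the inverse radius (`rnorm_seriesHat_crStep_le`). This gives a bound
`2ⁿ s^(2ⁿ)`, whose factor `2ⁿ` is absorbed by a larger base.
-/

namespace MG1

/-! ### Entrywise absolute values of matrix power series -/

theorem tsum_sum_antidiagonal_mul (f g : ℕ → ℝ≥0∞) :
    ∑' n, ∑ kl ∈ Finset.HasAntidiagonal.antidiagonal n, f kl.1 * g kl.2 =
      (∑' n, f n) * ∑' n, g n := by
  have h1 : ∀ n, ∑ kl ∈ Finset.HasAntidiagonal.antidiagonal n, f kl.1 * g kl.2 =
      ∑' kl : Finset.HasAntidiagonal.antidiagonal n, f kl.1.1 * g kl.1.2 := fun n => by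
    rw [tsum_fintype]
    exact (Finset.sum_coe_sort (Finset.HasAntidiagonal.antidiagonal n)
      fun kl => f kl.1 * g kl.2).symm
  simp_rw [h1]
  rw [← ENNReal.tsum_sigma' (fun x : Σ n, Finset.HasAntidiagonal.antidiagonal n =>
      f x.2.1.1 * g x.2.1.2),
    ← Finset.HasAntidiagonal.sigmaAntidiagonalEquivProd.symm.tsum_eq, ENNReal.tsum_prod']
  simp [ENNReal.tsum_mul_left, ENNReal.tsum_mul_right]

theorem tsum_even_add_tsum_odd (f : ℕ → ℝ≥0∞) :
    ∑' k, f (2 * k) + ∑' k, f (2 * k + 1) = ∑' k, f k :=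
  tsum_even_add_odd ENNReal.summable ENNReal.summable

variable {M : ℕ}

/-- The matrix `∑ₖ |Sₖ|` of entrywise absolute sums of the coefficients, with values in
`[0, ∞]`; its largest row sum is `starNorm S`. -/
noncomputable def absMat (S : MSeries M) : Matrix (Fin M) (Fin M) ℝ≥0∞ :=
  Matrix.of fun i j => ∑' k, ‖PowerSeries.coeff k S i j‖ₑ

/-- The largest row sum of a matrix with entries in `[0, ∞]`. -/
noncomputable def rowNorm (A : Matrix (Fin M) (Fin M) ℝ≥0∞) : ℝ≥0∞ := ⨆ i, ∑ j, A i j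

theorem starNorm_eq_rowNorm (S : MSeries M) : starNorm S = rowNorm (absMat S) := rfl

theorem rowNorm_mono {A B : Matrix (Fin M) (Fin M) ℝ≥0∞} (h : ∀ i j, A i j ≤ B i j) :
    rowNorm A ≤ rowNorm B :=
  iSup_mono fun i => Finset.sum_le_sum fun j _ => h i j

theorem rowNorm_add_le (A B : Matrix (Fin M) (Fin M) ℝ≥0∞) :
    rowNorm (A + B) ≤ rowNorm A + rowNorm B := by
  refine iSup_le fun i => ?_
  simp only [Matrix.add_apply, Finset.sum_add_distrib]
  exact add_le_add (le_iSup (fun i => ∑ j, A i j) i) (le_iSup (fun i => ∑ j, B i j) i)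

theorem rowNorm_mul_le (A B : Matrix (Fin M) (Fin M) ℝ≥0∞) :
    rowNorm (A * B) ≤ rowNorm A * rowNorm B := by
  refine iSup_le fun i => ?_
  simp only [Matrix.mul_apply]
  rw [Finset.sum_comm]
  simp only [← Finset.mul_sum]
  calc ∑ l, A i l * ∑ j, B l j ≤ ∑ l, A i l * rowNorm B :=
        Finset.sum_le_sum fun l _ => mul_le_mul_right (le_iSup (fun i => ∑ j, B i j) l) _
    _ = (∑ l, A i l) * rowNorm B := by rw [Finset.sum_mul]
    _ ≤ _ := mul_le_mul_left (le_iSup (fun i => ∑ j, A i j) i) _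

theorem rowNorm_one_le : rowNorm (1 : Matrix (Fin M) (Fin M) ℝ≥0∞) ≤ 1 := by
  refine iSup_le fun i => ?_
  simp [Matrix.one_apply]

theorem absMat_add_le (S T : MSeries M) (i j : Fin M) :
    absMat (S + T) i j ≤ (absMat S + absMat T) i j := by
  simp only [absMat, Matrix.of_apply, Matrix.add_apply, map_add]
  rw [← ENNReal.tsum_add]
  exact ENNReal.tsum_le_tsum fun k => enorm_add_le _ _

theorem absMat_mul_le (S T : MSeries M) (i j : Fin M) :
    absMat (S * T) i j ≤ (absMat S * absMat T) i j := by
  simp only [absMat, Matrix.of_apply, Matrix.mul_apply]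
  simp_rw [← tsum_sum_antidiagonal_mul]
  rw [← Summable.tsum_finsetSum fun _ _ => ENNReal.summable]
  refine ENNReal.tsum_le_tsum fun k => ?_
  rw [PowerSeries.coeff_mul, Matrix.sum_apply, Finset.sum_comm]
  refine (enorm_sum_le _ _).trans (Finset.sum_le_sum fun kl _ => ?_)
  rw [Matrix.mul_apply]
  refine (enorm_sum_le _ _).trans (Finset.sum_le_sum fun l _ => ?_)
  rw [enorm_mul]

theorem absMat_X_mul (S : MSeries M) : absMat (PowerSeries.X * S) = absMat S := by
  ext i j
  simp only [absMat, Matrix.of_apply]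
  rw [tsum_eq_zero_add' ENNReal.summable]
  simp [PowerSeries.coeff_succ_X_mul]

theorem absMat_even_add_odd (S : MSeries M) :
    absMat (evenPart S) + absMat (oddPart S) = absMat S := by
  ext i j
  simp only [absMat, Matrix.of_apply, Matrix.add_apply, evenPart, oddPart, PowerSeries.coeff_mk]
  exact tsum_even_add_tsum_odd fun k => ‖PowerSeries.coeff k S i j‖ₑ

theorem evenPart_add (S T : MSeries M) : evenPart (S + T) = evenPart S + evenPart T := by
  ext; simp [evenPart]

theorem oddPart_add (S T : MSeries M) : oddPart (S + T) = oddPart S + oddPart T := by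
  ext; simp [oddPart]

theorem starNorm_add_le (S T : MSeries M) : starNorm (S + T) ≤ starNorm S + starNorm T :=
  (rowNorm_mono (absMat_add_le S T)).trans (rowNorm_add_le _ _)

theorem starNorm_mul_le (S T : MSeries M) : starNorm (S * T) ≤ starNorm S * starNorm T :=
  (rowNorm_mono (absMat_mul_le S T)).trans (rowNorm_mul_le _ _)

theorem starNorm_evenPart_le (S : MSeries M) : starNorm (evenPart S) ≤ starNorm S := by
  rw [starNorm_eq_rowNorm S, ← absMat_even_add_odd S]
  exact rowNorm_mono fun i j => le_self_add

theorem starNorm_oddPart_le (S : MSeries M) : starNorm (oddPart S) ≤ starNorm S := by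
  rw [starNorm_eq_rowNorm S, ← absMat_even_add_odd S]
  exact rowNorm_mono fun i j => le_add_self

/-! ### The first-order error amplification -/

section FirstOrder

variable (V W G E D : MSeries M)

/-- The derivative of the `φ`-component of a cyclic reduction step in the direction `E`, where `V`
and `W` stand for `φ_even (I - φ_odd)⁻¹` and `(I - φ_odd)⁻¹ φ_even`. -/
noncomputable def linPart : MSeries M :=
  PowerSeries.X * oddPart E + V * oddPart E * W + evenPart E * W + V * evenPart E

/-- The derivative of the `φ̂`-component of a cyclic reduction step (Schur complement form) in
the direction `(E, D)`, where `G` stands for `φ̂_odd (I - φ_odd)⁻¹`. -/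
noncomputable def linSchur : MSeries M :=
  evenPart D + oddPart D * W + G * evenPart E + G * oddPart E * W

/-- The derivative of the `φ̂`-component of a cyclic reduction step (mirrored form) in the
direction `(E, D)`, where `G` stands for `(I - φ_odd)⁻¹ φ̂_even`. -/
noncomputable def linMirrored : MSeries M :=
  oddPart D + V * evenPart D + evenPart E * G + V * oddPart E * G

theorem absMat_add_le_of_le {S T : MSeries M} {A B : Matrix (Fin M) (Fin M) ℝ≥0∞}
    (hS : ∀ i j, absMat S i j ≤ A i j) (hT : ∀ i j, absMat T i j ≤ B i j) (i j : Fin M) :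
    absMat (S + T) i j ≤ (A + B) i j :=
  (absMat_add_le S T i j).trans (add_le_add (hS i j) (hT i j))

theorem absMat_mul_le_of_le {S T : MSeries M} {A B : Matrix (Fin M) (Fin M) ℝ≥0∞}
    (hS : ∀ i j, absMat S i j ≤ A i j) (hT : ∀ i j, absMat T i j ≤ B i j) (i j : Fin M) :
    absMat (S * T) i j ≤ (A * B) i j := by
  refine (absMat_mul_le S T i j).trans ?_
  simp only [Matrix.mul_apply]
  exact Finset.sum_le_sum fun l _ => mul_le_mul' (hS i l) (hT l j)

variable {V W G E D} {w e : ℝ≥0∞}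

theorem rowNorm_one_add_le {S : MSeries M} (h : starNorm S ≤ w) :
    rowNorm (1 + absMat S) ≤ 1 + w :=
  (rowNorm_add_le _ _).trans (add_le_add rowNorm_one_le h)

/-- Entrywise `|D𝒯[E]| ≤ (I + |V|) |E| (I + |W|)`, whence the amplification by `(1 + w)²`. -/
theorem starNorm_linPart_le (hV : starNorm V ≤ w) (hW : starNorm W ≤ w) (hE : starNorm E ≤ e) :
    starNorm (linPart V W E) ≤ (1 + w) ^ 2 * e := by
  have hr : ∀ (S : MSeries M) (i j), absMat S i j ≤ absMat S i j := fun _ _ _ => le_rfl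
  have key : ∀ i j, absMat (linPart V W E) i j ≤
      ((1 + absMat V) * absMat E * (1 + absMat W)) i j := by
    intro i j
    refine (absMat_add_le_of_le (absMat_add_le_of_le (absMat_add_le_of_le
      (fun i j => (congrFun₂ (absMat_X_mul _) i j).le)
      (absMat_mul_le_of_le (absMat_mul_le_of_le (hr _) (hr _)) (hr _)))
      (absMat_mul_le_of_le (hr _) (hr _))) (absMat_mul_le_of_le (hr _) (hr _)) i j).trans ?_
    rw [← absMat_even_add_odd E]
    simp only [add_mul, mul_add, one_mul, mul_one]
    generalize absMat V = v, absMat W = w', absMat (evenPart E) = a, absMat (oddPart E) = b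
    simp only [Matrix.add_apply]
    refine le_of_le_of_eq (le_self_add (b := a i j + (v * a * w') i j +
      (v * b) i j + (b * w') i j)) ?_
    ring
  refine (rowNorm_mono key).trans ?_
  calc _ ≤ (1 + w) * e * (1 + w) :=
        (rowNorm_mul_le _ _).trans (mul_le_mul' ((rowNorm_mul_le _ _).trans
          (mul_le_mul' (rowNorm_one_add_le hV) hE)) (rowNorm_one_add_le hW))
    _ = _ := by ring

theorem starNorm_linSchur_le (hG : starNorm G ≤ w) (hW : starNorm W ≤ w)
    (hE : starNorm E ≤ e) (hD : starNorm D ≤ e) :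
    starNorm (linSchur W G E D) ≤ (1 + w) ^ 2 * e := by
  have hr : ∀ (S : MSeries M) (i j), absMat S i j ≤ absMat S i j := fun _ _ _ => le_rfl
  have key : ∀ i j, absMat (linSchur W G E D) i j ≤
      ((absMat D + absMat G * absMat E) * (1 + absMat W)) i j := by
    intro i j
    refine (absMat_add_le_of_le (absMat_add_le_of_le (absMat_add_le_of_le
      (hr _) (absMat_mul_le_of_le (hr _) (hr _))) (absMat_mul_le_of_le (hr _) (hr _)))
      (absMat_mul_le_of_le (absMat_mul_le_of_le (hr _) (hr _)) (hr _)) i j).trans ?_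
    rw [← absMat_even_add_odd E, ← absMat_even_add_odd D]
    simp only [add_mul, mul_add, mul_one]
    generalize absMat G = v, absMat W = w', absMat (evenPart E) = a, absMat (oddPart E) = b,
      absMat (evenPart D) = c, absMat (oddPart D) = d
    simp only [Matrix.add_apply]
    refine le_of_le_of_eq (le_self_add (b := d i j + (c * w') i j + (v * b) i j +
      (v * a * w') i j)) ?_
    ring
  refine (rowNorm_mono key).trans ?_
  calc _ ≤ (e + w * e) * (1 + w) :=
        (rowNorm_mul_le _ _).trans (mul_le_mul' ((rowNorm_add_le _ _).trans (add_le_add hD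
          ((rowNorm_mul_le _ _).trans (mul_le_mul' hG hE)))) (rowNorm_one_add_le hW))
    _ = _ := by ring

theorem starNorm_linMirrored_le (hG : starNorm G ≤ w) (hV : starNorm V ≤ w)
    (hE : starNorm E ≤ e) (hD : starNorm D ≤ e) :
    starNorm (linMirrored V G E D) ≤ (1 + w) ^ 2 * e := by
  have hr : ∀ (S : MSeries M) (i j), absMat S i j ≤ absMat S i j := fun _ _ _ => le_rfl
  have key : ∀ i j, absMat (linMirrored V G E D) i j ≤
      ((1 + absMat V) * (absMat D + absMat E * absMat G)) i j := by
    intro i j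
    refine (absMat_add_le_of_le (absMat_add_le_of_le (absMat_add_le_of_le
      (hr _) (absMat_mul_le_of_le (hr _) (hr _))) (absMat_mul_le_of_le (hr _) (hr _)))
      (absMat_mul_le_of_le (absMat_mul_le_of_le (hr _) (hr _)) (hr _)) i j).trans ?_
    rw [← absMat_even_add_odd E, ← absMat_even_add_odd D]
    simp only [add_mul, mul_add, one_mul]
    generalize absMat G = g, absMat V = v, absMat (evenPart E) = a, absMat (oddPart E) = b,
      absMat (evenPart D) = c, absMat (oddPart D) = d
    simp only [Matrix.add_apply, mul_assoc]
    refine le_of_le_of_eq (le_self_add (b := c i j + (v * d) i j + (b * g) i j +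
      (v * (a * g)) i j)) ?_
    ring
  refine (rowNorm_mono key).trans ?_
  calc _ ≤ (1 + w) * (e + e * w) :=
        (rowNorm_mul_le _ _).trans (mul_le_mul' (rowNorm_one_add_le hV)
          ((rowNorm_add_le _ _).trans (add_le_add hD
          ((rowNorm_mul_le _ _).trans (mul_le_mul' hE hG)))))
    _ = _ := by ring

end FirstOrder

/-! ### Weighted norms of power series over a normed ring -/

section Weighted

variable {𝔸 : Type*} [NormedRing 𝔸]

/-- The weighted `ℓ¹` norm `∑ₖ ‖Sₖ‖ ω(k)` of the coefficient sequence, with values in `[0, ∞]`. -/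
noncomputable def wnorm (ω : ℕ → ℝ≥0∞) (S : PowerSeries 𝔸) : ℝ≥0∞ :=
  ∑' k, ‖PowerSeries.coeff k S‖ₑ * ω k

theorem wnorm_mono {ω ω' : ℕ → ℝ≥0∞} (h : ∀ k, ω k ≤ ω' k) (S : PowerSeries 𝔸) :
    wnorm ω S ≤ wnorm ω' S :=
  ENNReal.tsum_le_tsum fun k => mul_le_mul_right (h k) _

theorem wnorm_add_le (ω : ℕ → ℝ≥0∞) (S T : PowerSeries 𝔸) :
    wnorm ω (S + T) ≤ wnorm ω S + wnorm ω T := by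
  rw [wnorm, wnorm, wnorm, ← ENNReal.tsum_add]
  refine ENNReal.tsum_le_tsum fun k => ?_
  rw [← add_mul, map_add]
  exact mul_le_mul_left (enorm_add_le _ _) _

theorem enorm_mul_le_mul (a b : 𝔸) : ‖a * b‖ₑ ≤ ‖a‖ₑ * ‖b‖ₑ := by
  simp only [enorm_eq_nnnorm]
  exact_mod_cast nnnorm_mul_le a b

theorem wnorm_mul_le {ω α β : ℕ → ℝ≥0∞} (h : ∀ j k, ω (j + k) ≤ α j * β k)
    (S T : PowerSeries 𝔸) : wnorm ω (S * T) ≤ wnorm α S * wnorm β T := by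
  rw [wnorm, wnorm, wnorm, ← tsum_sum_antidiagonal_mul]
  refine ENNReal.tsum_le_tsum fun k => ?_
  rw [PowerSeries.coeff_mul]
  refine (mul_le_mul_left (enorm_sum_le _ _) _).trans ?_
  rw [Finset.sum_mul]
  refine Finset.sum_le_sum fun kl hkl => ?_
  rw [← Finset.HasAntidiagonal.mem_antidiagonal.mp hkl]
  calc _ ≤ (‖PowerSeries.coeff kl.1 S‖ₑ * ‖PowerSeries.coeff kl.2 T‖ₑ) * (α kl.1 * β kl.2) :=
        mul_le_mul' (enorm_mul_le_mul _ _) (h _ _)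
    _ = _ := by ring

/-- The norm `∑ₖ ‖Sₖ‖ rᵏ` of the power series `S` in the disk of radius `r`. -/
noncomputable def rnorm (r : ℝ≥0∞) (S : PowerSeries 𝔸) : ℝ≥0∞ := wnorm (fun k => r ^ k) S

theorem rnorm_mul_le (r : ℝ≥0∞) (S T : PowerSeries 𝔸) :
    rnorm r (S * T) ≤ rnorm r S * rnorm r T :=
  wnorm_mul_le (fun j k => (pow_add r j k).le) S T

theorem rnorm_add_le (r : ℝ≥0∞) (S T : PowerSeries 𝔸) :
    rnorm r (S + T) ≤ rnorm r S + rnorm r T := wnorm_add_le _ S T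

theorem rnorm_mono {r s : ℝ≥0∞} (h : r ≤ s) (S : PowerSeries 𝔸) : rnorm r S ≤ rnorm s S :=
  wnorm_mono (fun k => pow_le_pow_left' h k) S

theorem rnorm_neg (r : ℝ≥0∞) (S : PowerSeries 𝔸) : rnorm r (-S) = rnorm r S := by
  simp [rnorm, wnorm]

theorem rnorm_sub_le (r : ℝ≥0∞) (S T : PowerSeries 𝔸) :
    rnorm r (S - T) ≤ rnorm r S + rnorm r T := by
  rw [sub_eq_add_neg, ← rnorm_neg r T]
  exact rnorm_add_le r S (-T)

theorem rnorm_one_eq (S : PowerSeries 𝔸) : rnorm 1 S = ∑' k, ‖PowerSeries.coeff k S‖ₑ := by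
  simp [rnorm, wnorm]

theorem rnorm_C (r : ℝ≥0∞) (a : 𝔸) : rnorm r (PowerSeries.C a) = ‖a‖ₑ := by
  refine (tsum_eq_single 0 fun k hk => ?_).trans ?_
  · rw [PowerSeries.coeff_C, if_neg hk, enorm_zero, zero_mul]
  · simp

theorem enorm_coeff_zero_le (r : ℝ≥0∞) (S : PowerSeries 𝔸) :
    ‖PowerSeries.constantCoeff S‖ₑ ≤ rnorm r S := by
  refine le_trans ?_ (ENNReal.le_tsum 0)
  simp

/-- The weight `r ^ k` cut off at `k = m`. -/
noncomputable def cutWeight (r : ℝ≥0∞) (m k : ℕ) : ℝ≥0∞ := if k < m then r ^ k else 0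

theorem cutWeight_add_le_left (r : ℝ≥0∞) (m j k : ℕ) :
    cutWeight r m (j + k) ≤ cutWeight r m j * r ^ k := by
  unfold cutWeight
  split_ifs with h1 h2
  · rw [pow_add]
  · omega
  · exact zero_le
  · exact zero_le

theorem cutWeight_add_le_right (r : ℝ≥0∞) (m j k : ℕ) :
    cutWeight r m (j + k) ≤ r ^ j * cutWeight r m k := by
  rw [add_comm, mul_comm]
  exact cutWeight_add_le_left r m k j

theorem cutWeight_le (r : ℝ≥0∞) (m k : ℕ) : cutWeight r m k ≤ r ^ k := by
  unfold cutWeight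
  split_ifs
  · exact le_rfl
  · exact zero_le

theorem wnorm_cutWeight_ne_top {r : ℝ≥0∞} (hr : r ≠ ⊤) (m : ℕ) (S : PowerSeries 𝔸) :
    wnorm (cutWeight r m) S ≠ ⊤ := by
  have : wnorm (cutWeight r m) S =
      ∑ k ∈ Finset.range m, ‖PowerSeries.coeff k S‖ₑ * cutWeight r m k := by
    refine tsum_eq_sum fun k hk => ?_
    rw [cutWeight, if_neg (by simpa using hk), mul_zero]
  rw [this]
  refine ENNReal.sum_ne_top.mpr fun k _ => ENNReal.mul_ne_top enorm_ne_top ?_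
  exact ne_top_of_le_ne_top (ENNReal.pow_ne_top hr) (cutWeight_le r m k)

theorem rnorm_le_of_cutWeight {r c : ℝ≥0∞} {S : PowerSeries 𝔸}
    (h : ∀ m, wnorm (cutWeight r m) S ≤ c) : rnorm r S ≤ c := by
  refine ENNReal.tsum_le_of_sum_range_le fun m => ?_
  refine le_trans (le_of_eq_of_le (Finset.sum_congr rfl fun k hk => ?_)
    (ENNReal.sum_le_tsum (Finset.range m))) (h m)
  rw [cutWeight, if_pos (by simpa using hk)]

theorem ofReal_one_half : ENNReal.ofReal (1 / 2) = 1 / 2 := by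
  rw [ENNReal.ofReal_div_of_pos (by norm_num)]
  simp

theorem le_two_mul_of_le_add_mul {x a d : ℝ≥0∞} (hx : x ≠ ⊤) (hd : d ≤ 1 / 2)
    (h : x ≤ a + d * x) : x ≤ 2 * a := by
  rcases eq_or_ne a ⊤ with rfl | ha
  · simp
  have h2 : x ≤ a + 1 / 2 * x := h.trans (by gcongr)
  lift x to NNReal using hx
  lift a to NNReal using ha
  have h3 : ((1 / 2 : ℝ≥0∞)) = ((1 / 2 : NNReal) : ℝ≥0∞) := by simp
  rw [h3] at h2
  have h4 : x ≤ a + 1 / 2 * x := by exact_mod_cast h2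
  have : x ≤ 2 * a := by
    rw [← NNReal.coe_le_coe] at h4 ⊢
    push_cast at h4 ⊢
    linarith
  exact_mod_cast this

/-- The bound of a Neumann series: cutting the weight off makes the norm of `N` finite, so that
it can be absorbed on the left. -/
theorem rnorm_le_of_eq_add_mul {r : ℝ≥0∞} (hr : r ≠ ⊤) {A D N : PowerSeries 𝔸}
    (hD : rnorm r D ≤ 1 / 2) (h : N = A + D * N) : rnorm r N ≤ 2 * rnorm r A := by
  refine rnorm_le_of_cutWeight fun m =>
    le_two_mul_of_le_add_mul (wnorm_cutWeight_ne_top hr m N) hD ?_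
  calc wnorm (cutWeight r m) N = wnorm (cutWeight r m) (A + D * N) := by rw [← h]
    _ ≤ _ := wnorm_add_le _ _ _
    _ ≤ _ := add_le_add (wnorm_mono (cutWeight_le r m) A)
        (wnorm_mul_le (cutWeight_add_le_right r m) D N)

theorem rnorm_le_of_eq_add_mul' {r : ℝ≥0∞} (hr : r ≠ ⊤) {A D N : PowerSeries 𝔸}
    (hD : rnorm r D ≤ 1 / 2) (h : N = A + N * D) : rnorm r N ≤ 2 * rnorm r A := by
  refine rnorm_le_of_cutWeight fun m =>
    le_two_mul_of_le_add_mul (wnorm_cutWeight_ne_top hr m N) hD ?_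
  calc wnorm (cutWeight r m) N = wnorm (cutWeight r m) (A + N * D) := by rw [← h]
    _ ≤ _ := wnorm_add_le _ _ _
    _ ≤ wnorm (cutWeight r m) A + wnorm (cutWeight r m) N * rnorm r D :=
        add_le_add le_rfl (wnorm_mul_le (cutWeight_add_le_left r m) N D)
    _ ≤ _ := by rw [mul_comm]; exact add_le_add (wnorm_mono (cutWeight_le r m) A) le_rfl

theorem isUnit_one_sub_of_rnorm_le [CompleteSpace 𝔸] {r : ℝ≥0∞} {D : PowerSeries 𝔸}
    (hD : rnorm r D ≤ 1 / 2) : IsUnit (1 - D) := by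
  rw [PowerSeries.isUnit_iff_constantCoeff, map_sub, map_one]
  refine isUnit_one_sub_of_norm_lt_one ?_
  have h : ‖PowerSeries.constantCoeff D‖ₑ < 1 :=
    ((enorm_coeff_zero_le r D).trans hD).trans_lt (by simp)
  simpa [← ofReal_norm] using h

end Weighted

/-! ### Comparison with the norm of the Wiener algebra -/

section Compare

open scoped Matrix.Norms.Operator

variable {M : ℕ}

theorem sum_enorm_row_le (A : Matrix (Fin M) (Fin M) ℂ) (i : Fin M) :
    ∑ j, ‖A i j‖ₑ ≤ ‖A‖ₑ := by
  have h : (∑ j, ‖A i j‖₊) ≤ ‖A‖₊ := by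
    rw [Matrix.linfty_opNNNorm_def]
    exact Finset.le_sup (f := fun i => ∑ j, ‖A i j‖₊) (Finset.mem_univ i)
  have h2 : ((∑ j, ‖A i j‖₊ : NNReal) : ℝ≥0∞) ≤ (‖A‖₊ : ℝ≥0∞) := by exact_mod_cast h
  simpa [enorm_eq_nnnorm] using h2

theorem nnnorm_matrix_le (A : Matrix (Fin M) (Fin M) ℂ) : ‖A‖₊ ≤ ∑ i, ∑ j, ‖A i j‖₊ := by
  rw [Matrix.linfty_opNNNorm_def]
  exact Finset.sup_le fun i _ =>
    Finset.single_le_sum (f := fun i => ∑ j, ‖A i j‖₊) (fun _ _ => zero_le) (Finset.mem_univ i)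

theorem enorm_matrix_le (A : Matrix (Fin M) (Fin M) ℂ) : ‖A‖ₑ ≤ ∑ i, ∑ j, ‖A i j‖ₑ := by
  have h2 : (‖A‖₊ : ℝ≥0∞) ≤ ((∑ i, ∑ j, ‖A i j‖₊ : NNReal) : ℝ≥0∞) := by
    exact_mod_cast nnnorm_matrix_le A
  simpa [enorm_eq_nnnorm] using h2

theorem norm_matrix_le (A : Matrix (Fin M) (Fin M) ℂ) : ‖A‖ ≤ ∑ i, ∑ j, ‖A i j‖ := by
  have h := NNReal.coe_le_coe.mpr (nnnorm_matrix_le A)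
  simpa using h

theorem starNorm_le_rnorm_one (S : MSeries M) : starNorm S ≤ rnorm 1 S := by
  refine iSup_le fun i => ?_
  rw [← Summable.tsum_finsetSum fun _ _ => ENNReal.summable, rnorm_one_eq]
  exact ENNReal.tsum_le_tsum fun k => sum_enorm_row_le _ i

/-- With the operator norm on matrices, `rnorm 1` differs from `starNorm` in that the maximum over
the rows is taken inside the sum over `k`; this costs at most the factor `M`. -/
theorem rnorm_one_le_starNorm (S : MSeries M) : rnorm 1 S ≤ M * starNorm S := by
  calc rnorm 1 S ≤ ∑' k, ∑ i, ∑ j, ‖PowerSeries.coeff k S i j‖ₑ := by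
        rw [rnorm_one_eq]
        exact ENNReal.tsum_le_tsum fun k => enorm_matrix_le _
    _ = ∑ i, ∑ j, ∑' k, ‖PowerSeries.coeff k S i j‖ₑ := by
        rw [Summable.tsum_finsetSum fun _ _ => ENNReal.summable]
        exact Finset.sum_congr rfl fun i _ =>
          Summable.tsum_finsetSum fun _ _ => ENNReal.summable
    _ ≤ ∑ _i : Fin M, starNorm S :=
        Finset.sum_le_sum fun i _ =>
          le_iSup (fun i => ∑ j, ∑' k, ‖PowerSeries.coeff k S i j‖ₑ) i
    _ = _ := by simp

theorem starNorm_ne_top_iff (S : MSeries M) : starNorm S ≠ ⊤ ↔ rnorm 1 S ≠ ⊤ :=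
  ⟨fun h => ne_top_of_le_ne_top (ENNReal.mul_ne_top (by simp) h) (rnorm_one_le_starNorm S),
    fun h => ne_top_of_le_ne_top h (starNorm_le_rnorm_one S)⟩

end Compare

/-! ### The second-order remainder of a cyclic reduction step -/

section Perturbation

variable {M : ℕ}

theorem kernelInv_mul {p : MSeries M} (h : IsUnit (1 - oddPart p)) :
    kernelInv p * (1 - oddPart p) = 1 := Ring.inverse_mul_cancel _ h

theorem mul_kernelInv {p : MSeries M} (h : IsUnit (1 - oddPart p)) :
    (1 - oddPart p) * kernelInv p = 1 := Ring.mul_inverse_cancel _ h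

open scoped Matrix.Norms.Operator in
/-- A small perturbation keeps `I - φ_odd` invertible in the Wiener algebra. The hypothesis with
the factor `M` gives smallness in `rnorm 1`, the norm for which Neumann series are available. -/
theorem kernelInv_add {p E : MSeries M} {b e : ℝ≥0∞} (hp : IsUnit (1 - oddPart p))
    (hK : starNorm (kernelInv p) ≤ b) (hb : b ≠ ⊤) (hE : starNorm E ≤ e)
    (hbe : b * e ≤ 1 / 2) (hMbe : M * (b * e) ≤ 1 / 2) :
    kernelInv (p + E) = kernelInv p + kernelInv p * oddPart E * kernelInv (p + E) ∧
      starNorm (kernelInv (p + E)) ≤ 2 * b := by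
  have hKo : starNorm (kernelInv p * oddPart E) ≤ b * e :=
    (starNorm_mul_le _ _).trans (mul_le_mul' hK ((starNorm_oddPart_le E).trans hE))
  have hKo' : rnorm 1 (kernelInv p * oddPart E) ≤ 1 / 2 :=
    (rnorm_one_le_starNorm _).trans ((mul_le_mul_right hKo _).trans hMbe)
  have hfac : 1 - oddPart (p + E) = (1 - oddPart p) * (1 - kernelInv p * oddPart E) := by
    rw [mul_sub, mul_one, ← mul_assoc, mul_kernelInv hp, one_mul, oddPart_add, sub_sub]
  have hu : IsUnit (1 - oddPart (p + E)) := by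
    rw [hfac]
    exact hp.mul (isUnit_one_sub_of_rnorm_le hKo')
  have hid : kernelInv (p + E) = kernelInv p + kernelInv p * oddPart E * kernelInv (p + E) := by
    have h := congrArg (kernelInv p * ·) (mul_kernelInv hu)
    simp only [hfac, mul_one] at h
    rw [← mul_assoc, ← mul_assoc, kernelInv_mul hp, one_mul, sub_mul, one_mul,
      sub_eq_iff_eq_add] at h
    exact h
  refine ⟨hid, ?_⟩
  have hfin : starNorm (kernelInv (p + E)) ≠ ⊤ := by
    rw [starNorm_ne_top_iff]
    refine ne_top_of_le_ne_top ?_ (rnorm_le_of_eq_add_mul ENNReal.one_ne_top hKo' hid)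
    exact ENNReal.mul_ne_top (by simp)
      ((starNorm_ne_top_iff _).mp (ne_top_of_le_ne_top hb hK))
  refine (le_two_mul_of_le_add_mul hfin hbe ?_).trans (mul_le_mul_right hK 2)
  calc _ = starNorm (kernelInv p + kernelInv p * oddPart E * kernelInv (p + E)) := by rw [← hid]
    _ ≤ _ := (starNorm_add_le _ _).trans (add_le_add le_rfl
        ((starNorm_mul_le _ _).trans (mul_le_mul_left hKo _)))

/-- The second-order part of `(x + x') K' (y + y')`, where `K' = K + K o K'`. -/
noncomputable def prodRemainder (x x' y y' K o K' : MSeries M) : MSeries M :=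
  x * K * o * K * o * K' * y + x' * K * o * K' * y + x * K * o * K' * y' + x' * K' * y'

theorem mul_mul_eq_add_prodRemainder {K o K' : MSeries M} (h : K' = K + K * o * K')
    (x x' y y' : MSeries M) :
    (x + x') * K' * (y + y') = x * K * y + x' * K * y + x * K * y' + x * K * o * K * y +
      prodRemainder x x' y y' K o K' := by
  have h1 : x * K' * y = x * K * y + x * K * o * K * y + x * K * o * K * o * K' * y := by
    conv_lhs => rw [h]
    conv_lhs => rw [h]
    noncomm_ring
  have h2 : x' * K' * y = x' * K * y + x' * K * o * K' * y := by
    conv_lhs => rw [h]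
    noncomm_ring
  have h3 : x * K' * y' = x * K * y' + x * K * o * K' * y' := by
    conv_lhs => rw [h]
    noncomm_ring
  rw [prodRemainder, add_mul, add_mul, mul_add, mul_add, h1, h2, h3]
  abel

theorem starNorm_mul_le_of_le {S T : MSeries M} {a b : ℝ≥0∞} (hS : starNorm S ≤ a)
    (hT : starNorm T ≤ b) : starNorm (S * T) ≤ a * b :=
  (starNorm_mul_le S T).trans (mul_le_mul' hS hT)

theorem starNorm_add_le_of_le {S T : MSeries M} {a b : ℝ≥0∞} (hS : starNorm S ≤ a)
    (hT : starNorm T ≤ b) : starNorm (S + T) ≤ a + b :=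
  (starNorm_add_le S T).trans (add_le_add hS hT)

theorem starNorm_prodRemainder_le {x x' y y' K o K' : MSeries M} {b e : ℝ≥0∞}
    (hb : 1 ≤ b) (hx : starNorm x ≤ b) (hy : starNorm y ≤ b) (hK : starNorm K ≤ b)
    (hx' : starNorm x' ≤ e) (hy' : starNorm y' ≤ e) (ho : starNorm o ≤ e)
    (hK' : starNorm K' ≤ 2 * b) :
    starNorm (prodRemainder x x' y y' K o K') ≤ 8 * b ^ 5 * e ^ 2 := by
  have h1 := starNorm_mul_le_of_le (starNorm_mul_le_of_le (starNorm_mul_le_of_le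
    (starNorm_mul_le_of_le (starNorm_mul_le_of_le (starNorm_mul_le_of_le hx hK) ho) hK) ho) hK') hy
  have h2 := starNorm_mul_le_of_le (starNorm_mul_le_of_le
    (starNorm_mul_le_of_le (starNorm_mul_le_of_le hx' hK) ho) hK') hy
  have h3 := starNorm_mul_le_of_le (starNorm_mul_le_of_le
    (starNorm_mul_le_of_le (starNorm_mul_le_of_le hx hK) ho) hK') hy'
  have h4 := starNorm_mul_le_of_le (starNorm_mul_le_of_le hx' hK') hy'
  have h := starNorm_add_le_of_le (starNorm_add_le_of_le (starNorm_add_le_of_le h1 h2) h3) h4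
  refine h.trans ?_
  have e3 : b ^ 3 ≤ b ^ 5 := pow_le_pow_right₀ hb (by norm_num)
  have e1 : b ≤ b ^ 5 := by simpa using pow_le_pow_right₀ hb (show 1 ≤ 5 by norm_num)
  calc _ = 2 * b ^ 5 * e ^ 2 + 2 * b ^ 3 * e ^ 2 + 2 * b ^ 3 * e ^ 2 + 2 * b * e ^ 2 := by ring
    _ ≤ 2 * b ^ 5 * e ^ 2 + 2 * b ^ 5 * e ^ 2 + 2 * b ^ 5 * e ^ 2 + 2 * b ^ 5 * e ^ 2 := by gcongr
    _ = _ := by ring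

/-- One exact step applied to perturbed data: linear amplification by `(1 + w)²`, and a
quadratic remainder. -/
theorem starNorm_crStep_sub_le (form : HatForm) {p q : MSeries M × MSeries M} {b e w : ℝ≥0∞}
    (hunit : IsUnit (1 - oddPart p.1)) (hb1 : 1 ≤ b) (hb : b ≠ ⊤)
    (hK : starNorm (kernelInv p.1) ≤ b) (hp1 : starNorm p.1 ≤ b) (hp2 : starNorm p.2 ≤ b)
    (hV : starNorm (seriesV p) ≤ w) (hW : starNorm (seriesW p) ≤ w)
    (hG : starNorm (seriesHat form p) ≤ w)
    (hq1 : starNorm (q - p).1 ≤ e) (hq2 : starNorm (q - p).2 ≤ e)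
    (hbe : b * e ≤ 1 / 2) (hMbe : M * (b * e) ≤ 1 / 2) :
    starNorm (crStep form q - crStep form p).1 ≤ (1 + w) ^ 2 * e + 8 * b ^ 5 * e ^ 2 ∧
      starNorm (crStep form q - crStep form p).2 ≤ (1 + w) ^ 2 * e + 8 * b ^ 5 * e ^ 2 := by
  obtain ⟨E, hE⟩ : ∃ E, E = (q - p).1 := ⟨_, rfl⟩
  obtain ⟨D, hD⟩ : ∃ D, D = (q - p).2 := ⟨_, rfl⟩
  have hqE : q.1 = p.1 + E := by rw [hE, Prod.fst_sub]; abel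
  have hqD : q.2 = p.2 + D := by rw [hD, Prod.snd_sub]; abel
  rw [← hE] at hq1
  rw [← hD] at hq2
  obtain ⟨hid, hK'⟩ := kernelInv_add hunit hK hb hq1 hbe hMbe
  have ev : ∀ {S : MSeries M} {c}, starNorm S ≤ c → starNorm (evenPart S) ≤ c :=
    fun h => (starNorm_evenPart_le _).trans h
  have od : ∀ {S : MSeries M} {c}, starNorm S ≤ c → starNorm (oddPart S) ≤ c :=
    fun h => (starNorm_oddPart_le _).trans h
  constructor
  · have h : (crStep form q - crStep form p).1 =
        linPart (seriesV p) (seriesW p) E + prodRemainder (evenPart p.1) (evenPart E)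
          (evenPart p.1) (evenPart E) (kernelInv p.1) (oddPart E) (kernelInv (p.1 + E)) := by
      rw [Prod.fst_sub]
      simp only [crStep, hqE, evenPart_add, oddPart_add, linPart, seriesV, seriesW]
      rw [mul_mul_eq_add_prodRemainder hid]
      simp only [mul_add, mul_assoc]
      abel
    rw [h]
    exact starNorm_add_le_of_le (starNorm_linPart_le hV hW hq1)
      (starNorm_prodRemainder_le hb1 (ev hp1) (ev hp1) hK (ev hq1) (ev hq1) (od hq1) hK')
  · cases form with
    | schur =>
      have h : (crStep .schur q - crStep .schur p).2 =
          linSchur (seriesW p) (seriesHat .schur p) E D + prodRemainder (oddPart p.2) (oddPart D)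
            (evenPart p.1) (evenPart E) (kernelInv p.1) (oddPart E) (kernelInv (p.1 + E)) := by
        rw [Prod.snd_sub]
        simp only [crStep, hqE, hqD, evenPart_add, oddPart_add, linSchur, seriesHat, seriesW]
        rw [mul_mul_eq_add_prodRemainder hid]
        simp only [mul_assoc]
        abel
      rw [h]
      exact starNorm_add_le_of_le (starNorm_linSchur_le hG hW hq1 hq2)
        (starNorm_prodRemainder_le hb1 (od hp2) (ev hp1) hK (od hq2) (ev hq1) (od hq1) hK')
    | mirrored =>
      have h : (crStep .mirrored q - crStep .mirrored p).2 =
          linMirrored (seriesV p) (seriesHat .mirrored p) E D +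
            prodRemainder (evenPart p.1) (evenPart E) (evenPart p.2) (evenPart D)
              (kernelInv p.1) (oddPart E) (kernelInv (p.1 + E)) := by
        rw [Prod.snd_sub]
        simp only [crStep, hqE, hqD, evenPart_add, oddPart_add, linMirrored, seriesHat, seriesV]
        rw [mul_mul_eq_add_prodRemainder hid]
        simp only [mul_assoc]
        abel
      rw [h]
      exact starNorm_add_le_of_le (starNorm_linMirrored_le hG hV hq1 hq2)
        (starNorm_prodRemainder_le hb1 (ev hp1) (ev hp2) hK (ev hq1) (ev hq2) (od hq1) hK')

end Perturbation

/-! ### Accumulation of the errors -/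

section Accumulation

theorem gamSum_zero (θ σ : ℝ) : gamSum θ σ 0 = 1 := by simp [gamSum]

theorem gamSum_succ (θ σ : ℝ) (n : ℕ) :
    gamSum θ σ (n + 1) = 1 + gam θ σ (n + 1) * gamSum θ σ n := by
  rw [gamSum, Finset.sum_range_succ, gamSum, Finset.mul_sum, add_comm]
  congr 1
  · simp
  · refine Finset.sum_congr rfl fun k hk => ?_
    have hk' : k + 1 ≤ n + 1 := by
      have := Finset.mem_range.mp hk
      omega
    rw [Finset.prod_Icc_succ_top hk', mul_comm]

theorem gam_nonneg (θ σ : ℝ) (n : ℕ) : 0 ≤ gam θ σ n := sq_nonneg _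

theorem gamSum_nonneg (θ σ : ℝ) (n : ℕ) : 0 ≤ gamSum θ σ n :=
  Finset.sum_nonneg fun _ _ => Finset.prod_nonneg fun _ _ => gam_nonneg θ σ _

theorem sum_pow_two_pow_le {σ : ℝ} (h0 : 0 < σ) (h1 : σ < 1) (s : Finset ℕ)
    (hs : ∀ i ∈ s, 1 ≤ i) : ∑ i ∈ s, σ ^ 2 ^ i ≤ σ ^ 2 / (1 - σ ^ 2) := by
  have hq0 : 0 ≤ σ ^ 2 := sq_nonneg σ
  have hq1 : σ ^ 2 < 1 := by nlinarith
  have hsum : HasSum (fun j : ℕ => σ ^ 2 * (σ ^ 2) ^ j) (σ ^ 2 * (1 - σ ^ 2)⁻¹) :=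
    (hasSum_geometric_of_lt_one hq0 hq1).mul_left _
  rw [div_eq_mul_inv, ← hsum.tsum_eq]
  calc ∑ i ∈ s, σ ^ 2 ^ i ≤ ∑ i ∈ s, σ ^ 2 * (σ ^ 2) ^ (i - 1) := by
        refine Finset.sum_le_sum fun i hi => ?_
        obtain ⟨k, rfl⟩ : ∃ k, i = k + 1 := ⟨i - 1, by have := hs i hi; omega⟩
        rw [← pow_mul, ← pow_add, Nat.add_sub_cancel]
        refine pow_le_pow_of_le_one h0.le h1.le ?_
        have := Nat.lt_two_pow_self (n := k)
        rw [pow_succ]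
        omega
    _ = ∑ i ∈ s.image (· - 1), σ ^ 2 * (σ ^ 2) ^ i := by
        rw [Finset.sum_image]
        intro a ha b hb hab
        have h1 := hs a ha
        have h2 := hs b hb
        simp only at hab
        omega
    _ ≤ _ := hsum.summable.sum_le_tsum _ fun i _ => by positivity

theorem gamSum_le {θ σ : ℝ} (hθ : 0 < θ) (h0 : 0 < σ) (h1 : σ < 1) (n : ℕ) :
    gamSum θ σ n ≤ 1 + n * Real.exp (2 * θ * (σ ^ 2 / (1 - σ ^ 2))) := by
  have hprod : ∀ k, ∏ i ∈ Finset.Icc (k + 1) n, gam θ σ i ≤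
      Real.exp (2 * θ * (σ ^ 2 / (1 - σ ^ 2))) := by
    intro k
    calc ∏ i ∈ Finset.Icc (k + 1) n, gam θ σ i
        ≤ ∏ i ∈ Finset.Icc (k + 1) n, Real.exp (2 * θ * σ ^ 2 ^ i) := by
          refine Finset.prod_le_prod (fun i _ => gam_nonneg θ σ i) fun i _ => ?_
          rw [gam, show 2 * θ * σ ^ 2 ^ i = (2 : ℕ) * (θ * σ ^ 2 ^ i) by push_cast; ring,
            Real.exp_nat_mul]
          have : 0 < θ * σ ^ 2 ^ i := by positivity
          exact pow_le_pow_left₀ (by linarith)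
            (by linarith [Real.add_one_le_exp (θ * σ ^ 2 ^ i)]) 2
      _ = Real.exp (2 * θ * ∑ i ∈ Finset.Icc (k + 1) n, σ ^ 2 ^ i) := by
          rw [Finset.mul_sum, Real.exp_sum]
      _ ≤ _ := by
          refine Real.exp_le_exp.mpr (mul_le_mul_of_nonneg_left ?_ (by positivity))
          refine sum_pow_two_pow_le h0 h1 _ fun i hi => ?_
          have := (Finset.mem_Icc.mp hi).1
          omega
  rw [gamSum, Finset.sum_range_succ, add_comm]
  refine add_le_add (by simp) ?_
  calc _ ≤ ∑ _k ∈ Finset.range n, Real.exp (2 * θ * (σ ^ 2 / (1 - σ ^ 2))) :=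
        Finset.sum_le_sum fun k _ => hprod k
    _ = _ := by simp

variable {M : ℕ} {form : HatForm} {A : ℕ → Matrix (Fin M) (Fin M) ℝ} {u : Fin M → ℝ}

/-- One exact step in real terms: for data within `δ` of the exact iterate, the deviation `e`
becomes at most `γₙ e + c e²`. -/
theorem exists_step_bound {θ σ : ℝ} (hrate : IsRate form A u θ σ) {n : ℕ}
    (hunit : IsUnit (1 - oddPart (exactSeq form A u n).1))
    (hK : starNorm (kernelInv (exactSeq form A u n).1) ≠ ⊤)
    (h1 : starNorm (exactSeq form A u n).1 ≠ ⊤) (h2 : starNorm (exactSeq form A u n).2 ≠ ⊤) :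
    ∃ c δ : ℝ, 0 ≤ c ∧ 0 < δ ∧ ∀ e : ℝ, 0 ≤ e → e ≤ δ → ∀ q : MSeries M × MSeries M,
      starNorm (q - exactSeq form A u n).1 ≤ ENNReal.ofReal e →
      starNorm (q - exactSeq form A u n).2 ≤ ENNReal.ofReal e →
      starNorm (crStep form q - exactSeq form A u (n + 1)).1 ≤
          ENNReal.ofReal (gam θ σ n * e + c * e ^ 2) ∧
        starNorm (crStep form q - exactSeq form A u (n + 1)).2 ≤
          ENNReal.ofReal (gam θ σ n * e + c * e ^ 2) := by
  set p := exactSeq form A u n with hp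
  obtain ⟨b, hb⟩ : ∃ b : ℝ, b = 1 + (starNorm (kernelInv p.1)).toReal +
    (starNorm p.1).toReal + (starNorm p.2).toReal := ⟨_, rfl⟩
  have n1 := ENNReal.toReal_nonneg (a := starNorm (kernelInv p.1))
  have n2 := ENNReal.toReal_nonneg (a := starNorm p.1)
  have n3 := ENNReal.toReal_nonneg (a := starNorm p.2)
  have hb1 : 1 ≤ b := by linarith
  have hM : (0 : ℝ) ≤ M := Nat.cast_nonneg M
  have hpos : 0 < 2 * (M + 1) * b := by positivity
  -- this radius makes both `b e` and `M b e` at most `1 / 2`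
  refine ⟨8 * b ^ 5, 1 / (2 * (M + 1) * b), by positivity, by positivity, ?_⟩
  intro e he heδ q hq1 hq2
  have heδ' : e * (2 * (M + 1) * b) ≤ 1 := by rwa [le_div_iff₀ hpos] at heδ
  have hbe : b * e ≤ 1 / 2 := by nlinarith [mul_nonneg hM (mul_nonneg he (by linarith : 0 ≤ b))]
  have hMbe : M * (b * e) ≤ 1 / 2 := by nlinarith [mul_nonneg he (by linarith : 0 ≤ b)]
  have hw : 0 ≤ θ * σ ^ 2 ^ n := mul_nonneg hrate.theta_pos.le (pow_nonneg hrate.sigma_pos.le _)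
  have key := starNorm_crStep_sub_le form (p := p) (q := q) (b := ENNReal.ofReal b)
    (e := ENNReal.ofReal e) (w := ENNReal.ofReal (θ * σ ^ 2 ^ n)) hunit
    (by simpa using hb1) ENNReal.ofReal_ne_top
    (ENNReal.le_ofReal_iff_toReal_le hK (by linarith) |>.mpr (by linarith))
    (ENNReal.le_ofReal_iff_toReal_le h1 (by linarith) |>.mpr (by linarith))
    (ENNReal.le_ofReal_iff_toReal_le h2 (by linarith) |>.mpr (by linarith))
    (hrate.bound_V n) (hrate.bound_W n) (hrate.bound_hat n) hq1 hq2
    (by rw [← ENNReal.ofReal_mul (by linarith), ← ofReal_one_half]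
        exact ENNReal.ofReal_le_ofReal hbe)
    (by rw [← ENNReal.ofReal_mul (by linarith), ← ofReal_one_half, ← ENNReal.ofReal_natCast,
          ← ENNReal.ofReal_mul hM]; exact ENNReal.ofReal_le_ofReal hMbe)
  have hval : (1 + ENNReal.ofReal (θ * σ ^ 2 ^ n)) ^ 2 * ENNReal.ofReal e +
      8 * ENNReal.ofReal b ^ 5 * ENNReal.ofReal e ^ 2 =
      ENNReal.ofReal (gam θ σ n * e + 8 * b ^ 5 * e ^ 2) := by
    rw [gam]
    generalize θ * σ ^ 2 ^ n = t at hw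
    have hb0 : 0 ≤ b := by linarith
    rw [ENNReal.ofReal_add (by positivity) (by positivity), ENNReal.ofReal_mul (by positivity),
      ENNReal.ofReal_pow (by positivity), ENNReal.ofReal_add zero_le_one hw,
      ENNReal.ofReal_mul (by positivity), ENNReal.ofReal_mul (by positivity),
      ENNReal.ofReal_pow hb0, ENNReal.ofReal_pow he]
    simp
  rw [hval] at key
  exact key

/-- First-order error bound: `e_{n+1} ≤ υ + γ_n e_n + c_n e_n²`, unrolled. -/
theorem exists_error_bound {θ σ : ℝ} (hrate : IsRate form A u θ σ) (hCR : NoBreakdown form A u)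
    (hfin : ∀ n, starNorm (exactSeq form A u n).1 ≠ ⊤ ∧ starNorm (exactSeq form A u n).2 ≠ ⊤)
    (n : ℕ) :
    ∃ C υ₀ : ℝ, 0 < C ∧ 0 < υ₀ ∧ ∀ υ : ℝ, 0 < υ → υ ≤ υ₀ →
      ∀ TF : ℕ → MSeries M × MSeries M → MSeries M × MSeries M,
        (∀ k ≤ n, starNorm (localError form A u TF k).1 ≤ ENNReal.ofReal υ ∧
          starNorm (localError form A u TF k).2 ≤ ENNReal.ofReal υ) →
        starNorm (globalError form A u TF (n + 1)).1 ≤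
            ENNReal.ofReal (υ * gamSum θ σ n + C * υ ^ 2) ∧
          starNorm (globalError form A u TF (n + 1)).2 ≤
            ENNReal.ofReal (υ * gamSum θ σ n + C * υ ^ 2) := by
  induction n with
  | zero =>
    refine ⟨1, 1, one_pos, one_pos, fun υ hυ _ TF hTF => ?_⟩
    -- both sequences start at the same pair
    have h : globalError form A u TF 1 = localError form A u TF 0 := rfl
    have hle : υ ≤ υ * gamSum θ σ 0 + 1 * υ ^ 2 := by
      rw [gamSum_zero]
      nlinarith [sq_nonneg υ]
    rw [zero_add, h]
    exact ⟨((hTF 0 le_rfl).1).trans (ENNReal.ofReal_le_ofReal hle),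
      ((hTF 0 le_rfl).2).trans (ENNReal.ofReal_le_ofReal hle)⟩
  | succ n ih =>
    obtain ⟨C, υ₀, hC, hυ₀, H⟩ := ih
    obtain ⟨c, δ, hc, hδ, hstep⟩ := exists_step_bound hrate (hCR (n + 1)).1 (hCR (n + 1)).2
      (hfin (n + 1)).1 (hfin (n + 1)).2
    have hg := gamSum_nonneg θ σ n
    have hγ := gam_nonneg θ σ (n + 1)
    set g := gamSum θ σ n
    set γ := gam θ σ (n + 1)
    refine ⟨γ * C + c * (g + C) ^ 2 + 1, min (min υ₀ 1) (δ / (g + C)), by positivity,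
      by positivity, fun υ hυ hle TF hTF => ?_⟩
    have hυ0 : υ ≤ υ₀ := hle.trans ((min_le_left _ _).trans (min_le_left _ _))
    have hυ1 : υ ≤ 1 := hle.trans ((min_le_left _ _).trans (min_le_right _ _))
    have hυδ : υ * (g + C) ≤ δ := by
      have := hle.trans (min_le_right _ _)
      rwa [le_div_iff₀ (by positivity)] at this
    obtain ⟨e, he⟩ : ∃ e, e = υ * g + C * υ ^ 2 := ⟨_, rfl⟩
    have he0 : 0 ≤ e := by rw [he]; positivity
    have heυ : e ≤ υ * (g + C) := by
      rw [he]
      nlinarith [mul_le_mul_of_nonneg_left hυ1 (mul_nonneg hC.le hυ.le)]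
    obtain ⟨p1, p2⟩ := H υ hυ hυ0 TF fun k hk => hTF k (hk.trans n.le_succ)
    rw [← he] at p1 p2
    obtain ⟨s1, s2⟩ := hstep e he0 (heυ.trans hυδ) (computedSeq A u TF (n + 1)) p1 p2
    have hsplit : globalError form A u TF (n + 1 + 1) = localError form A u TF (n + 1) +
        (crStep form (computedSeq A u TF (n + 1)) - exactSeq form A u (n + 1 + 1)) := by
      rw [globalError, localError, computedSeq]
      abel
    obtain ⟨l1, l2⟩ := hTF (n + 1) le_rfl
    have hfinal : υ + (γ * e + c * e ^ 2) ≤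
        υ * gamSum θ σ (n + 1) + (γ * C + c * (g + C) ^ 2 + 1) * υ ^ 2 := by
      rw [gamSum_succ]
      have hsq : e ^ 2 ≤ (υ * (g + C)) ^ 2 := pow_le_pow_left₀ he0 heυ 2
      have h3 := mul_le_mul_of_nonneg_left hsq hc
      change υ + (γ * e + c * e ^ 2) ≤
        υ * (1 + γ * g) + (γ * C + c * (g + C) ^ 2 + 1) * υ ^ 2
      have h4 : γ * e = γ * (υ * g) + γ * C * υ ^ 2 := by rw [he]; ring
      nlinarith [sq_nonneg υ]
    have hnn : 0 ≤ γ * e + c * e ^ 2 := by positivity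
    rw [hsplit, Prod.fst_add, Prod.snd_add]
    constructor
    · refine (starNorm_add_le_of_le l1 s1).trans ?_
      rw [← ENNReal.ofReal_add hυ.le hnn]
      exact ENNReal.ofReal_le_ofReal hfinal
    · refine (starNorm_add_le_of_le l2 s2).trans ?_
      rw [← ENNReal.ofReal_add hυ.le hnn]
      exact ENNReal.ofReal_le_ofReal hfinal

end Accumulation

/-! ### Power series acting on two-sided sequences by convolution -/

section Action

variable {𝔸 : Type*} [NormedRing 𝔸]

theorem tsum_prod_eq_tsum_sum_antidiagonal [CompleteSpace 𝔸] {F : ℕ × ℕ → 𝔸}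
    (hF : Summable F) :
    ∑' x, F x = ∑' n, ∑ x ∈ Finset.HasAntidiagonal.antidiagonal n, F x := by
  have h := Finset.HasAntidiagonal.sigmaAntidiagonalEquivProd.summable_iff.mpr hF
  rw [← Finset.HasAntidiagonal.sigmaAntidiagonalEquivProd.tsum_eq]
  refine (Summable.tsum_sigma h).trans (tsum_congr fun n => ?_)
  rw [tsum_fintype]
  exact Finset.sum_coe_sort (Finset.HasAntidiagonal.antidiagonal n) F

/-- The convolution of the (one-sided) coefficient sequence of `S` with a two-sided sequence:
multiplication of the Laurent series `∑ h(k) zᵏ` by `S(z)`. -/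
noncomputable def act (S : PowerSeries 𝔸) (h : ℤ → 𝔸) (k : ℤ) : 𝔸 :=
  ∑' j : ℕ, PowerSeries.coeff j S * h (k - j)

theorem summable_norm_coeff {S : PowerSeries 𝔸} (hS : rnorm 1 S ≠ ⊤) :
    Summable fun j => ‖PowerSeries.coeff j S‖ := by
  rw [rnorm_one_eq] at hS
  have : Summable fun j => ‖PowerSeries.coeff j S‖₊ := by
    rw [← ENNReal.tsum_coe_ne_top_iff_summable]
    exact hS
  exact NNReal.summable_coe.mpr this

variable {S T : PowerSeries 𝔸} {h : ℤ → 𝔸} {B : ℝ}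

theorem summable_norm_act (hS : rnorm 1 S ≠ ⊤) (hh : ∀ k, ‖h k‖ ≤ B) (k : ℤ) :
    Summable fun j : ℕ => ‖PowerSeries.coeff j S * h (k - j)‖ := by
  refine Summable.of_nonneg_of_le (fun _ => norm_nonneg _) (fun j => ?_)
    ((summable_norm_coeff hS).mul_right B)
  exact (norm_mul_le _ _).trans (mul_le_mul_of_nonneg_left (hh _) (norm_nonneg _))

theorem act_C (a : 𝔸) (h : ℤ → 𝔸) (k : ℤ) : act (PowerSeries.C a) h k = a * h k := by
  refine (tsum_eq_single 0 fun j hj => ?_).trans ?_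
  · rw [PowerSeries.coeff_C, if_neg hj, zero_mul]
  · simp

theorem act_one (h : ℤ → 𝔸) (k : ℤ) : act 1 h k = h k := by
  have := act_C 1 h k
  rwa [map_one, one_mul] at this

theorem act_shift (S : PowerSeries 𝔸) (h : ℤ → 𝔸) (m k : ℤ) :
    act S (fun k => h (k + m)) k = act S h (k + m) := by
  simp only [act]
  exact tsum_congr fun j => by rw [sub_add_eq_add_sub]

theorem rnorm_one_X_mul (S : PowerSeries 𝔸) : rnorm 1 (PowerSeries.X * S) = rnorm 1 S := by
  simp only [rnorm_one_eq]
  rw [tsum_eq_zero_add' ENNReal.summable]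
  simp [PowerSeries.coeff_succ_X_mul]

variable [CompleteSpace 𝔸]

theorem summable_act (hS : rnorm 1 S ≠ ⊤) (hh : ∀ k, ‖h k‖ ≤ B) (k : ℤ) :
    Summable fun j : ℕ => PowerSeries.coeff j S * h (k - j) :=
  (summable_norm_act hS hh k).of_norm

theorem act_add_left (hS : rnorm 1 S ≠ ⊤) (hT : rnorm 1 T ≠ ⊤) (hh : ∀ k, ‖h k‖ ≤ B) (k : ℤ) :
    act (S + T) h k = act S h k + act T h k := by
  rw [act, act, act, ← (summable_act hS hh k).tsum_add (summable_act hT hh k)]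
  simp [add_mul]

theorem act_sub_left (hS : rnorm 1 S ≠ ⊤) (hT : rnorm 1 T ≠ ⊤) (hh : ∀ k, ‖h k‖ ≤ B) (k : ℤ) :
    act (S - T) h k = act S h k - act T h k := by
  rw [act, act, act, ← (summable_act hS hh k).tsum_sub (summable_act hT hh k)]
  simp [sub_mul]

theorem act_sub_right {h' : ℤ → 𝔸} {B' : ℝ} (hS : rnorm 1 S ≠ ⊤) (hh : ∀ k, ‖h k‖ ≤ B)
    (hh' : ∀ k, ‖h' k‖ ≤ B') (k : ℤ) :
    act S (fun k => h k - h' k) k = act S h k - act S h' k := by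
  rw [act, act, act, ← (summable_act hS hh k).tsum_sub (summable_act hS hh' k)]
  simp [mul_sub]

theorem act_X_mul (hS : rnorm 1 S ≠ ⊤) (hh : ∀ k, ‖h k‖ ≤ B) (k : ℤ) :
    act (PowerSeries.X * S) h k = act S h (k - 1) := by
  rw [act, (summable_act (by rwa [rnorm_one_X_mul]) hh k).tsum_eq_zero_add]
  simp only [PowerSeries.coeff_zero_X_mul, zero_mul, zero_add, PowerSeries.coeff_succ_X_mul, act]
  exact tsum_congr fun j => by push_cast; rw [sub_sub, add_comm (1 : ℤ)]

theorem act_mul (hS : rnorm 1 S ≠ ⊤) (hT : rnorm 1 T ≠ ⊤) (hh : ∀ k, ‖h k‖ ≤ B) (k : ℤ) :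
    act (S * T) h k = act S (act T h) k := by
  let F : ℕ × ℕ → 𝔸 := fun x =>
    PowerSeries.coeff x.1 S * (PowerSeries.coeff x.2 T * h (k - x.1 - x.2))
  have hF : Summable F := by
    refine Summable.of_norm_bounded (g := fun x : ℕ × ℕ =>
      ‖PowerSeries.coeff x.1 S‖ * (‖PowerSeries.coeff x.2 T‖ * B))
      ((summable_norm_coeff hS).mul_of_nonneg ((summable_norm_coeff hT).mul_right B)
        (fun _ => norm_nonneg _) fun j => ?_) fun x => ?_
    · exact mul_nonneg (norm_nonneg _) ((norm_nonneg _).trans (hh 0))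
    · refine (norm_mul_le _ _).trans (mul_le_mul_of_nonneg_left ?_ (norm_nonneg _))
      exact (norm_mul_le _ _).trans (mul_le_mul_of_nonneg_left (hh _) (norm_nonneg _))
  have h1 : ∑' x, F x = act S (act T h) k := by
    rw [hF.tsum_prod, act]
    refine tsum_congr fun j => ?_
    rw [act, ← (summable_act hT hh (k - j)).tsum_mul_left]
  rw [← h1, tsum_prod_eq_tsum_sum_antidiagonal hF, act]
  refine tsum_congr fun n => ?_
  rw [PowerSeries.coeff_mul, Finset.sum_mul]
  refine Finset.sum_congr rfl fun x hx => ?_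
  have hn : k - (n : ℤ) = k - x.1 - x.2 := by
    rw [← Finset.HasAntidiagonal.mem_antidiagonal.mp hx]
    push_cast
    ring
  rw [hn, mul_assoc]

/-- If `φ = a(z²) + z b(z²)`, the convolution `φ * h` on a residue class modulo two. -/
theorem act_split {φ a b : PowerSeries 𝔸} (hφ : rnorm 1 φ ≠ ⊤) (hh : ∀ k, ‖h k‖ ≤ B)
    (ha : ∀ k, PowerSeries.coeff k a = PowerSeries.coeff (2 * k) φ)
    (hb : ∀ k, PowerSeries.coeff k b = PowerSeries.coeff (2 * k + 1) φ) (k c : ℤ) :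
    act φ h (2 * k + c) = act a (fun m => h (2 * m + c)) k +
      act b (fun m => h (2 * m + c - 1)) k := by
  have hs := summable_act hφ hh (2 * k + c)
  have h0 : Summable fun i : ℕ =>
      PowerSeries.coeff (2 * i) φ * h (2 * k + c - ((2 * i : ℕ) : ℤ)) :=
    hs.comp_injective (i := fun i => 2 * i) fun x y hxy => by simpa using hxy
  have h1 : Summable fun i : ℕ =>
      PowerSeries.coeff (2 * i + 1) φ * h (2 * k + c - ((2 * i + 1 : ℕ) : ℤ)) :=
    hs.comp_injective (i := fun i => 2 * i + 1) fun x y hxy => by simpa using hxy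
  have e0 : ∀ i : ℕ, 2 * (k - i) + c = 2 * k + c - ((2 * i : ℕ) : ℤ) := fun i => by
    push_cast; ring
  have e1 : ∀ i : ℕ, 2 * k + c - ((2 * i : ℕ) : ℤ) - 1 = 2 * k + c - ((2 * i + 1 : ℕ) : ℤ) :=
    fun i => by push_cast; ring
  simp only [act, ha, hb, e0, e1]
  exact (tsum_even_add_odd (f := fun j : ℕ => PowerSeries.coeff j φ * h (2 * k + c - (j : ℤ)))
    h0 h1).symm

/-- Cyclic reduction decimates the inverse symbol. The hypothesis says that `∑ H(k) zᵏ` is a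
right inverse of `I - z⁻¹ φ(z)`; the conclusion that its even part is one of `I - z⁻¹ φ'(z)`. -/
theorem act_cyclicReduction {φ a b K : PowerSeries 𝔸} {H : ℤ → 𝔸} (hφ : rnorm 1 φ ≠ ⊤)
    (ha1 : rnorm 1 a ≠ ⊤) (hb1 : rnorm 1 b ≠ ⊤) (hK1 : rnorm 1 K ≠ ⊤)
    (ha : ∀ k, PowerSeries.coeff k a = PowerSeries.coeff (2 * k) φ)
    (hb : ∀ k, PowerSeries.coeff k b = PowerSeries.coeff (2 * k + 1) φ)
    (hK : K * (1 - b) = 1) (hH : ∀ k, ‖H k‖ ≤ B)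
    (hact : ∀ k, act φ H k = H (k - 1) - if k = 1 then 1 else 0) (k : ℤ) :
    act (PowerSeries.X * b + a * K * a) (fun k => H (2 * k)) k =
      H (2 * (k - 1)) - if k = 1 then 1 else 0 := by
  have hH0 : ∀ k, ‖H (2 * k)‖ ≤ B := fun k => hH _
  have hH1 : ∀ k, ‖H (2 * k + 1)‖ ≤ B := fun k => hH _
  have hone : rnorm 1 (1 : PowerSeries 𝔸) ≠ ⊤ := by
    have := rnorm_C 1 (1 : 𝔸)
    rw [map_one] at this
    rw [this]
    exact enorm_ne_top
  have e1 : ∀ k, act a (fun m => H (2 * m + 1)) k + act b (fun m => H (2 * m)) k =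
      H (2 * k) - if k = 0 then 1 else 0 := by
    intro k
    have h1 := act_split hφ hH ha hb k 1
    rw [hact] at h1
    simp only [add_sub_cancel_right] at h1
    rw [← h1]
    simp
  have e2 : ∀ k, act (1 - b) (fun m => H (2 * m + 1)) k = act a (fun m => H (2 * m)) (k + 1) := by
    intro k
    have h1 := act_split hφ hH ha hb (k + 1) 0
    have h4 : ¬ (2 * (k + 1) : ℤ) = 1 := by omega
    rw [hact] at h1
    simp only [add_zero, h4, if_false, sub_zero] at h1
    have h5 : act b (fun m => H (2 * m - 1)) (k + 1) = act b (fun m => H (2 * m + 1)) k := by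
      rw [← act_shift]
      congr 1
      ext m
      congr 1
      ring
    rw [act_sub_left hone hb1 hH1, act_one, ← h5, sub_eq_iff_eq_add, ← h1]
    congr 1
    ring
  have haK : rnorm 1 (K * a) ≠ ⊤ :=
    ne_top_of_le_ne_top (ENNReal.mul_ne_top hK1 ha1) (rnorm_mul_le 1 K a)
  have haKa : rnorm 1 (a * (K * a)) ≠ ⊤ :=
    ne_top_of_le_ne_top (ENNReal.mul_ne_top ha1 haK) (rnorm_mul_le 1 a (K * a))
  have h1b : rnorm 1 (1 - b) ≠ ⊤ :=
    ne_top_of_le_ne_top (ENNReal.add_ne_top.mpr ⟨hone, hb1⟩) (rnorm_sub_le 1 1 b)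
  have e3 : ∀ k, H (2 * k + 1) = act (K * a) (fun m => H (2 * m)) (k + 1) := by
    intro k
    have h1 : act (K * (1 - b)) (fun m => H (2 * m + 1)) k = H (2 * k + 1) := by
      rw [hK, act_one]
    rw [← h1, act_mul hK1 h1b hH1, act_mul hK1 ha1 hH0, ← act_shift]
    congr 1
    ext m
    exact e2 m
  have e4 : act a (fun m => H (2 * m + 1)) (k - 1) = act (a * (K * a)) (fun m => H (2 * m)) k := by
    rw [act_mul ha1 haK hH0]
    have h1 := act_shift a (act (K * a) (fun m => H (2 * m))) 1 (k - 1)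
    rw [sub_add_cancel] at h1
    rw [← h1]
    congr 1
    ext m
    exact e3 m
  rw [mul_assoc, act_add_left (by rwa [rnorm_one_X_mul]) haKa hH0, act_X_mul hb1 hH0, ← e4,
    add_comm, e1]
  congr 2
  simp [sub_eq_zero]

end Action

/-! ### The Laurent coefficients of the inverse symbol -/

section Laurent

open Metric

variable {𝔸 : Type*} [NormedRing 𝔸] [NormedAlgebra ℂ 𝔸]

/-- The value `S(z)` of a power series with coefficients in a complex Banach algebra. -/
noncomputable def evalAt (S : PowerSeries 𝔸) (z : ℂ) : 𝔸 :=
  ∑' k : ℕ, z ^ k • PowerSeries.coeff k S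

variable [CompleteSpace 𝔸] {S : PowerSeries 𝔸} {R : ℝ}

theorem hasSum_evalAt (hS : Summable fun k => ‖PowerSeries.coeff k S‖ * R ^ k) {z : ℂ}
    (hz : ‖z‖ ≤ R) : HasSum (fun k : ℕ => z ^ k • PowerSeries.coeff k S) (evalAt S z) := by
  refine Summable.hasSum (Summable.of_norm_bounded hS fun k => ?_)
  rw [norm_smul, norm_pow, mul_comm]
  exact mul_le_mul_of_nonneg_left (pow_le_pow_left₀ (norm_nonneg z) hz k) (norm_nonneg _)

theorem differentiableOn_evalAt (hS : Summable fun k => ‖PowerSeries.coeff k S‖ * R ^ k) :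
    DifferentiableOn ℂ (evalAt S) (ball 0 R) := by
  refine Complex.differentiableOn_tsum_of_summable_norm hS (fun k => ?_) isOpen_ball
    fun k z hz => ?_
  · exact ((differentiable_id.pow k).smul_const _).differentiableOn
  · rw [norm_smul, norm_pow, mul_comm]
    exact mul_le_mul_of_nonneg_left
      (pow_le_pow_left₀ (norm_nonneg z) (by simpa using (mem_ball_zero_iff.mp hz).le) k)
      (norm_nonneg _)

/-- The symbol `z - S(z)` of a Markov chain of M/G/1 type. -/
noncomputable def symbol (S : PowerSeries 𝔸) (z : ℂ) : 𝔸 := z • (1 : 𝔸) - evalAt S z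

theorem differentiableOn_symbol (hS : Summable fun k => ‖PowerSeries.coeff k S‖ * R ^ k) :
    DifferentiableOn ℂ (symbol S) (ball 0 R) :=
  (differentiable_id.smul_const (1 : 𝔸)).differentiableOn.sub (differentiableOn_evalAt hS)

/-- A symbol invertible on the unit circle is invertible on an annulus around it. -/
theorem exists_annulus (hR : 1 < R) (hS : Summable fun k => ‖PowerSeries.coeff k S‖ * R ^ k)
    (hinv : ∀ z : ℂ, ‖z‖ = 1 → IsUnit (symbol S z)) :
    ∃ ρ : ℝ, 1 < ρ ∧ ∀ z : ℂ, ρ⁻¹ ≤ ‖z‖ → ‖z‖ ≤ ρ → ‖z‖ < R ∧ IsUnit (symbol S z) := by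
  have hopen : IsOpen (ball (0 : ℂ) R ∩ symbol S ⁻¹' {x | IsUnit x}) :=
    (differentiableOn_symbol hS).continuousOn.isOpen_inter_preimage isOpen_ball Units.isOpen
  have hsub : sphere (0 : ℂ) 1 ⊆ ball (0 : ℂ) R ∩ symbol S ⁻¹' {x | IsUnit x} := by
    intro z hz
    have hz1 : ‖z‖ = 1 := by simpa using hz
    exact ⟨by simp [hz1, hR], hinv z hz1⟩
  obtain ⟨δ, hδ, hthick⟩ := (isCompact_sphere (0 : ℂ) 1).exists_cthickening_subset_open hopen hsub
  refine ⟨1 + δ, by linarith, fun z h1 h2 => ?_⟩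
  have hz0 : 0 < ‖z‖ := lt_of_lt_of_le (by positivity) h1
  have hmem : z ∈ cthickening δ (sphere (0 : ℂ) 1) := by
    refine mem_cthickening_of_dist_le z ((‖z‖ : ℂ)⁻¹ * z) δ _ ?_ ?_
    · simp [hz0.ne']
    · have : z - (‖z‖ : ℂ)⁻¹ * z = ((1 - ‖z‖⁻¹ : ℝ) : ℂ) * z := by push_cast; ring
      rw [dist_eq_norm, this, norm_mul, Complex.norm_real, Real.norm_eq_abs, ← abs_of_pos hz0,
        ← abs_mul, abs_of_pos hz0, sub_mul, one_mul, inv_mul_cancel₀ hz0.ne', abs_le]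
      constructor
      · have h3 : 1 ≤ ‖z‖ * (1 + δ) := by
          rwa [inv_le_iff_one_le_mul₀ (by linarith)] at h1
        nlinarith
      · linarith
  obtain ⟨h3, h4⟩ := hthick hmem
  exact ⟨by simpa using h3, h4⟩

/-- The `k`-th Laurent coefficient on the unit circle of `(I - z⁻¹ S(z))⁻¹ = z (z - S(z))⁻¹`. -/
noncomputable def greenCoeff (S : PowerSeries 𝔸) (k : ℤ) : 𝔸 :=
  (2 * Real.pi * Complex.I : ℂ)⁻¹ • ∮ z in C(0, 1), z ^ (-k) • Ring.inverse (symbol S z)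

/-- The exponential decay comes from moving the circle of integration to the outer or the inner
boundary of an annulus on which the symbol is invertible. -/
theorem greenCoeff_decay (hR : 1 < R) (hS : Summable fun k => ‖PowerSeries.coeff k S‖ * R ^ k)
    (hinv : ∀ z : ℂ, ‖z‖ = 1 → IsUnit (symbol S z)) :
    ∃ ρ C : ℝ, 1 < ρ ∧ ∀ k : ℤ, ‖greenCoeff S k‖ ≤ C * (ρ⁻¹) ^ k.natAbs := by
  obtain ⟨ρ, hρ, hann⟩ := exists_annulus hR hS hinv
  have hρ0 : 0 < ρ := by linarith
  have hρi : ρ⁻¹ < 1 := inv_lt_one_of_one_lt₀ hρ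
  have hρi0 : 0 < ρ⁻¹ := inv_pos.mpr hρ0
  have hdiff : ∀ z : ℂ, ρ⁻¹ ≤ ‖z‖ → ‖z‖ ≤ ρ →
      DifferentiableAt ℂ (fun z => Ring.inverse (symbol S z)) z := by
    intro z h1 h2
    obtain ⟨h3, h4⟩ := hann z h1 h2
    refine DifferentiableAt.inverse ?_ h4
    exact (differentiableOn_symbol hS).differentiableAt (isOpen_ball.mem_nhds (by simpa using h3))
  let N : Set ℂ := closedBall 0 ρ \ ball 0 ρ⁻¹
  have hN : ∀ z, z ∈ N ↔ ‖z‖ ≤ ρ ∧ ρ⁻¹ ≤ ‖z‖ := fun z => by simp [N]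
  have hcomp : IsCompact N := (isCompact_closedBall 0 ρ).diff isOpen_ball
  obtain ⟨C₀, hC₀⟩ := hcomp.exists_bound_of_continuousOn
    (f := fun z => Ring.inverse (symbol S z))
    fun z hz => (hdiff z ((hN z).mp hz).2 ((hN z).mp hz).1).continuousAt.continuousWithinAt
  have hC₀0 : 0 ≤ C₀ := (norm_nonneg _).trans (hC₀ 1 ((hN 1).mpr ⟨by simpa using hρ.le,
    by simpa using hρi.le⟩))
  have hdiff' : ∀ (k : ℤ) (z : ℂ), ρ⁻¹ ≤ ‖z‖ → ‖z‖ ≤ ρ →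
      DifferentiableAt ℂ (fun z => z ^ (-k) • Ring.inverse (symbol S z)) z := by
    intro k z h1 h2
    have hz : z ≠ 0 := norm_pos_iff.mp (lt_of_lt_of_le hρi0 h1)
    exact (differentiableAt_zpow.mpr (Or.inl hz)).smul (hdiff z h1 h2)
  -- the integral over any circle in the annulus, with the trivial bound
  have hbound : ∀ (k : ℤ) (s : ℝ), ρ⁻¹ ≤ s → s ≤ ρ →
      ‖(2 * Real.pi * Complex.I : ℂ)⁻¹ •
        ∮ z in C(0, s), z ^ (-k) • Ring.inverse (symbol S z)‖ ≤ s * (s ^ (-k) * C₀) := by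
    intro k s h1 h2
    have hs : 0 < s := lt_of_lt_of_le hρi0 h1
    refine circleIntegral.norm_two_pi_i_inv_smul_integral_le_of_norm_le_const hs.le fun z hz => ?_
    have hz' : ‖z‖ = s := by simpa using hz
    rw [norm_smul, norm_zpow, hz']
    exact mul_le_mul_of_nonneg_left (hC₀ z ((hN z).mpr ⟨hz'.le.trans h2, h1.trans hz'.ge⟩))
      (zpow_nonneg hs.le _)
  have hmove : ∀ (k : ℤ) (s t : ℝ), ρ⁻¹ ≤ s → s ≤ t → t ≤ ρ →
      (∮ z in C(0, t), z ^ (-k) • Ring.inverse (symbol S z)) =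
        ∮ z in C(0, s), z ^ (-k) • Ring.inverse (symbol S z) := by
    intro k s t h1 h2 h3
    refine Complex.circleIntegral_eq_of_differentiable_on_annulus_off_countable
      (lt_of_lt_of_le hρi0 h1) h2 Set.countable_empty (fun z hz => ?_) fun z hz => ?_
    · have h4 : ‖z‖ ≤ t ∧ s ≤ ‖z‖ := by simpa using hz
      exact (hdiff' k z (h1.trans h4.2) (h4.1.trans h3)).continuousAt.continuousWithinAt
    · have h4 : ‖z‖ < t ∧ s < ‖z‖ := by simpa using hz
      exact hdiff' k z (h1.trans h4.2.le) (h4.1.le.trans h3)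
  refine ⟨ρ, ρ * C₀, hρ, fun k => ?_⟩
  rcases le_total 0 k with hk | hk
  · obtain ⟨n, rfl⟩ := Int.eq_ofNat_of_zero_le hk
    rw [greenCoeff, ← hmove n 1 ρ hρi.le hρ.le le_rfl]
    refine (hbound n ρ (hρi.le.trans hρ.le) le_rfl).trans (le_of_eq ?_)
    simp only [zpow_neg, zpow_natCast, Int.natAbs_natCast, inv_pow]
    ring
  · obtain ⟨n, hn⟩ := Int.eq_ofNat_of_zero_le (neg_nonneg.mpr hk)
    have hk' : k = -(n : ℤ) := by simpa using (congrArg Neg.neg hn)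
    subst hk'
    rw [greenCoeff, hmove _ ρ⁻¹ 1 le_rfl hρi.le hρ.le]
    refine (hbound _ ρ⁻¹ le_rfl (hρi.le.trans hρ.le)).trans ?_
    simp only [neg_neg, zpow_natCast, Int.natAbs_neg, Int.natAbs_natCast]
    have : ρ⁻¹ ≤ ρ := hρi.le.trans hρ.le
    calc ρ⁻¹ * (ρ⁻¹ ^ n * C₀) ≤ ρ * (ρ⁻¹ ^ n * C₀) :=
          mul_le_mul_of_nonneg_right this (by positivity)
      _ = _ := by ring

/-- The coefficients `H = greenCoeff S` satisfy `S(z) ∑ H(k) zᵏ = z ∑ H(k) zᵏ - z`. -/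
theorem act_greenCoeff (hR : 1 < R) (hS : Summable fun k => ‖PowerSeries.coeff k S‖ * R ^ k)
    (hinv : ∀ z : ℂ, ‖z‖ = 1 → IsUnit (symbol S z)) (k : ℤ) :
    act S (greenCoeff S) k = greenCoeff S (k - 1) - if k = 1 then 1 else 0 := by
  have hcont : ContinuousOn (fun z => Ring.inverse (symbol S z)) (sphere (0 : ℂ) 1) := by
    intro z hz
    have hz1 : ‖z‖ = 1 := by simpa using hz
    refine DifferentiableAt.continuousAt (𝕜 := ℂ) ?_ |>.continuousWithinAt
    refine DifferentiableAt.inverse ?_ (hinv z hz1)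
    exact (differentiableOn_symbol hS).differentiableAt (isOpen_ball.mem_nhds (by simp [hz1, hR]))
  have hzpow : ∀ m : ℤ, ContinuousOn (fun z : ℂ => z ^ m) (sphere (0 : ℂ) 1) := fun m z hz =>
    (continuousAt_zpow₀ z m (Or.inl (by
      have hz1 : ‖z‖ = 1 := by simpa using hz
      exact norm_pos_iff.mp (by rw [hz1]; exact one_pos)))).continuousWithinAt
  have hci : ∀ m : ℤ, CircleIntegrable (fun z => z ^ m • Ring.inverse (symbol S z)) 0 1 :=
    fun m => ((hzpow m).smul hcont).circleIntegrable zero_le_one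
  obtain ⟨C₀, hC₀⟩ := (isCompact_sphere (0 : ℂ) 1).exists_bound_of_continuousOn hcont
  have hS1 : Summable fun j => ‖PowerSeries.coeff j S‖ := by
    refine Summable.of_nonneg_of_le (fun _ => norm_nonneg _) (fun j => ?_) hS
    exact le_mul_of_one_le_right (norm_nonneg _) (one_le_pow₀ hR.le)
  -- termwise integration of `S(z) z⁻ᵏ (z - S(z))⁻¹`
  have hsum : HasSum (fun j : ℕ => ∮ z in C(0, 1),
      PowerSeries.coeff j S * (z ^ (-(k - j)) • Ring.inverse (symbol S z)))
      (∮ z in C(0, 1), evalAt S z * (z ^ (-k) • Ring.inverse (symbol S z))) := by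
    unfold circleIntegral
    refine intervalIntegral.hasSum_integral_of_dominated_convergence
      (fun j _ => ‖PowerSeries.coeff j S‖ * C₀) (fun j => ?_) (fun j => ?_) ?_ ?_ ?_
    · refine Continuous.aestronglyMeasurable ?_
      have h1 : Continuous fun θ : ℝ => circleMap 0 1 θ ^ (-(k - j)) •
          Ring.inverse (symbol S (circleMap 0 1 θ)) :=
        ((hzpow _).smul hcont).comp_continuous (continuous_circleMap 0 1)
          fun θ => circleMap_mem_sphere 0 zero_le_one θ
      simp only [deriv_circleMap]
      exact ((continuous_circleMap 0 1).mul continuous_const).smul (continuous_const.mul h1)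
    · refine Filter.Eventually.of_forall fun θ _ => ?_
      have hz : circleMap 0 1 θ ∈ sphere (0 : ℂ) 1 := circleMap_mem_sphere 0 zero_le_one θ
      have hz1 : ‖circleMap 0 1 θ‖ = 1 := by simp
      rw [norm_smul]
      simp only [deriv_circleMap, norm_mul, hz1, Complex.norm_I, one_mul, mul_one]
      refine (norm_mul_le _ _).trans (mul_le_mul_of_nonneg_left ?_ (norm_nonneg _))
      rw [norm_smul, norm_zpow, hz1, one_zpow, one_mul]
      exact hC₀ _ hz
    · exact Filter.Eventually.of_forall fun θ _ => hS1.mul_right C₀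
    · exact intervalIntegrable_const
    · refine Filter.Eventually.of_forall fun θ _ => ?_
      have hz1 : ‖circleMap 0 1 θ‖ = 1 := by simp
      have hz0 : circleMap 0 1 θ ≠ 0 := norm_pos_iff.mp (by rw [hz1]; exact one_pos)
      refine HasSum.const_smul _ ?_
      have h1 := (hasSum_evalAt hS (hz1.trans_le hR.le)).mul_right
        (circleMap 0 1 θ ^ (-k) • Ring.inverse (symbol S (circleMap 0 1 θ)))
      refine h1.congr_fun fun j => ?_
      rw [smul_mul_assoc, ← mul_smul_comm, smul_smul, ← zpow_natCast, ← zpow_add₀ hz0]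
      have h2 : -(k - (j : ℤ)) = j + -k := by ring
      simp only [h2]
  have hterm : ∀ j : ℕ, PowerSeries.coeff j S * greenCoeff S (k - j) =
      (2 * Real.pi * Complex.I : ℂ)⁻¹ • ∮ z in C(0, 1),
        PowerSeries.coeff j S * (z ^ (-(k - j)) • Ring.inverse (symbol S z)) := by
    intro j
    rw [greenCoeff, mul_smul_comm]
    congr 1
    have h1 := (ContinuousLinearMap.mul ℂ 𝔸 (PowerSeries.coeff j S)).intervalIntegral_comp_comm
      (hci (-(k - j))).out
    unfold circleIntegral
    simpa [mul_smul_comm] using h1.symm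
  have hfun : ∀ z ∈ sphere (0 : ℂ) 1, evalAt S z * (z ^ (-k) • Ring.inverse (symbol S z)) =
      z ^ (-(k - 1)) • Ring.inverse (symbol S z) - z ^ (-k) • (1 : 𝔸) := by
    intro z hz
    have hz1 : ‖z‖ = 1 := by simpa using hz
    have hz0 : z ≠ 0 := norm_pos_iff.mp (by rw [hz1]; exact one_pos)
    have h1 : evalAt S z = z • (1 : 𝔸) - symbol S z := by rw [symbol]; abel
    rw [h1, mul_smul_comm, sub_mul, Ring.mul_inverse_cancel _ (hinv z hz1), smul_mul_assoc,
      one_mul, smul_sub, smul_smul, ← zpow_add_one₀ hz0]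
    congr 3
    ring
  have hone : (2 * Real.pi * Complex.I : ℂ)⁻¹ • (∮ z in C(0, 1), z ^ (-k) • (1 : 𝔸)) =
      if k = 1 then 1 else 0 := by
    rw [circleIntegral.integral_smul_const]
    split_ifs with hk
    · subst hk
      have := circleIntegral.integral_sub_center_inv (0 : ℂ) (one_ne_zero (α := ℝ))
      simp only [sub_zero] at this
      simp only [zpow_neg, zpow_one, this]
      rw [smul_smul, inv_mul_cancel₀ Complex.two_pi_I_ne_zero, one_smul]
    · have := circleIntegral.integral_sub_zpow_of_ne (n := -k) (by omega) (0 : ℂ) 0 1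
      simp only [sub_zero] at this
      rw [this, zero_smul, smul_zero]
  have hci' : CircleIntegrable (fun z => z ^ (-k) • (1 : 𝔸)) 0 1 :=
    ContinuousOn.circleIntegrable zero_le_one ((hzpow _).smul continuousOn_const)
  rw [act, tsum_congr hterm, (hsum.const_smul _).tsum_eq,
    circleIntegral.integral_congr zero_le_one hfun, circleIntegral.integral_sub (hci _)
      hci', smul_sub, hone]
  rfl

end Laurent

/-! ### The symbol of the shifted chain -/

section Shift

open scoped Matrix.Norms.Operator

variable {M : ℕ} {A : ℕ → Matrix (Fin M) (Fin M) ℝ} {u : Fin M → ℝ}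

/-- The complex matrix power series with real coefficients `C k`. -/
noncomputable def seriesOf (C : ℕ → Matrix (Fin M) (Fin M) ℝ) : MSeries M :=
  PowerSeries.mk fun k => (C k).map Complex.ofReal

/-- The matrix `Q` with complex entries. -/
noncomputable def complexQ (u : Fin M → ℝ) : Matrix (Fin M) (Fin M) ℂ :=
  (shiftQ u).map Complex.ofReal

theorem shiftQ_mul_shiftQ (hu : ∑ i, u i = 1) : shiftQ u * shiftQ u = shiftQ u := by
  ext i j
  simp [shiftQ, Matrix.mul_apply, ← Finset.sum_mul, hu]

theorem shifted_zero_mul (hu : ∑ i, u i = 1) : shifted A u 0 * shiftQ u = 0 := by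
  rw [shifted, mul_assoc, sub_mul, one_mul, shiftQ_mul_shiftQ hu, sub_self, mul_zero]

theorem shifted_succ_mul (hu : ∑ i, u i = 1) (k : ℕ) :
    shifted A u (k + 1) * shiftQ u =
      shifted A u k - A k + if k = 0 then shiftQ u else 0 := by
  rw [shifted, sub_mul, mul_assoc, shiftQ_mul_shiftQ hu, ← sub_mul, Finset.sum_range_succ]
  cases k with
  | zero =>
    rw [if_pos rfl, shifted, zero_add, Finset.sum_range_one]
    noncomm_ring
  | succ k =>
    rw [if_neg (Nat.succ_ne_zero k), shifted]
    noncomm_ring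

theorem map_ofReal_mul (S T : Matrix (Fin M) (Fin M) ℝ) :
    (S * T).map Complex.ofReal = S.map Complex.ofReal * T.map Complex.ofReal :=
  Matrix.map_mul (f := Complex.ofRealHom)

/-- The shift as an identity of power series; it says `(z - φ̃(z)) (z - Q) = z (z - φ(z))`. -/
theorem seriesOf_shifted_mul (hu : ∑ i, u i = 1) :
    seriesOf (shifted A u) * PowerSeries.C (complexQ u) =
      PowerSeries.X * (seriesOf (shifted A u) - seriesOf A + PowerSeries.C (complexQ u)) := by
  ext1 k
  rw [PowerSeries.coeff_mul_C]
  cases k with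
  | zero =>
    rw [PowerSeries.coeff_zero_X_mul, seriesOf, PowerSeries.coeff_mk, complexQ, ← map_ofReal_mul,
      shifted_zero_mul hu]
    simp
  | succ k =>
    rw [PowerSeries.coeff_succ_X_mul, map_add, map_sub, seriesOf, seriesOf, PowerSeries.coeff_mk,
      PowerSeries.coeff_mk, PowerSeries.coeff_mk, complexQ, ← map_ofReal_mul,
      shifted_succ_mul hu, PowerSeries.coeff_C]
    ext i j
    split_ifs <;> simp

section Eval

variable {S T : MSeries M} {R : ℝ}

theorem evalAt_mul_C (hS : Summable fun k => ‖PowerSeries.coeff k S‖ * R ^ k) {z : ℂ}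
    (hz : ‖z‖ ≤ R) (a : Matrix (Fin M) (Fin M) ℂ) :
    evalAt (S * PowerSeries.C a) z = evalAt S z * a := by
  refine HasSum.tsum_eq (((hasSum_evalAt hS hz).mul_right a).congr_fun fun k => ?_)
  rw [PowerSeries.coeff_mul_C, smul_mul_assoc]

theorem evalAt_C (a : Matrix (Fin M) (Fin M) ℂ) (z : ℂ) : evalAt (PowerSeries.C a) z = a := by
  refine (tsum_eq_single 0 fun k hk => ?_).trans ?_
  · rw [PowerSeries.coeff_C, if_neg hk, smul_zero]
  · simp

theorem evalAt_X_mul (hS : Summable fun k => ‖PowerSeries.coeff k S‖ * R ^ k) {z : ℂ}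
    (hz : ‖z‖ ≤ R) : evalAt (PowerSeries.X * S) z = z • evalAt S z := by
  have h := (hasSum_evalAt hS hz).const_smul z
  refine HasSum.tsum_eq ?_
  rw [← hasSum_nat_add_iff' 1]
  simp only [Finset.sum_range_one, PowerSeries.coeff_zero_X_mul, smul_zero, sub_zero,
    PowerSeries.coeff_succ_X_mul]
  exact h.congr_fun fun k => by rw [smul_smul, pow_succ']

theorem evalAt_add (hS : Summable fun k => ‖PowerSeries.coeff k S‖ * R ^ k)
    (hT : Summable fun k => ‖PowerSeries.coeff k T‖ * R ^ k) {z : ℂ} (hz : ‖z‖ ≤ R) :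
    evalAt (S + T) z = evalAt S z + evalAt T z :=
  HasSum.tsum_eq (((hasSum_evalAt hS hz).add (hasSum_evalAt hT hz)).congr_fun
    fun k => by rw [map_add, smul_add])

theorem evalAt_sub (hS : Summable fun k => ‖PowerSeries.coeff k S‖ * R ^ k)
    (hT : Summable fun k => ‖PowerSeries.coeff k T‖ * R ^ k) {z : ℂ} (hz : ‖z‖ ≤ R) :
    evalAt (S - T) z = evalAt S z - evalAt T z :=
  HasSum.tsum_eq (((hasSum_evalAt hS hz).sub (hasSum_evalAt hT hz)).congr_fun
    fun k => by rw [map_sub, smul_sub])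

theorem summable_norm_C (a : Matrix (Fin M) (Fin M) ℂ) (R : ℝ) :
    Summable fun k => ‖PowerSeries.coeff k (PowerSeries.C a)‖ * R ^ k :=
  summable_of_ne_finset_zero (s := {0}) fun k hk => by
    rw [PowerSeries.coeff_C, if_neg (by simpa using hk), norm_zero, zero_mul]

theorem summable_norm_add (hR : 0 ≤ R) (hS : Summable fun k => ‖PowerSeries.coeff k S‖ * R ^ k)
    (hT : Summable fun k => ‖PowerSeries.coeff k T‖ * R ^ k) :
    Summable fun k => ‖PowerSeries.coeff k (S + T)‖ * R ^ k := by
  refine Summable.of_nonneg_of_le (fun k => by positivity) (fun k => ?_) (hS.add hT)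
  rw [← add_mul, map_add]
  exact mul_le_mul_of_nonneg_right (norm_add_le _ _) (by positivity)

theorem summable_norm_sub (hR : 0 ≤ R) (hS : Summable fun k => ‖PowerSeries.coeff k S‖ * R ^ k)
    (hT : Summable fun k => ‖PowerSeries.coeff k T‖ * R ^ k) :
    Summable fun k => ‖PowerSeries.coeff k (S - T)‖ * R ^ k := by
  refine Summable.of_nonneg_of_le (fun k => by positivity) (fun k => ?_) (hS.add hT)
  rw [← add_mul, map_sub]
  exact mul_le_mul_of_nonneg_right (norm_sub_le _ _) (by positivity)

/-- Summability of a matrix power series can be checked entry by entry. -/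
theorem summable_norm_seriesOf {C : ℕ → Matrix (Fin M) (Fin M) ℝ} (hR : 0 ≤ R)
    (h : ∀ i j, Summable fun k => |C k i j| * R ^ k) :
    Summable fun k => ‖PowerSeries.coeff k (seriesOf C)‖ * R ^ k := by
  refine Summable.of_nonneg_of_le (fun k => by positivity) (fun k => ?_)
    (summable_sum (s := Finset.univ) fun i _ => summable_sum (s := Finset.univ) fun j _ => h i j)
  simp only [← Finset.sum_mul]
  refine mul_le_mul_of_nonneg_right ?_ (by positivity)
  rw [seriesOf, PowerSeries.coeff_mk]
  refine (norm_matrix_le _).trans (le_of_eq ?_)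
  simp only [Matrix.map_apply, Complex.norm_real, Real.norm_eq_abs]

end Eval

/-- The tails of a sequence with a geometric moment are summable against a smaller moment. -/
theorem summable_tail_mul_pow {a : ℕ → ℝ} (ha : ∀ k, 0 ≤ a k) {s r R : ℝ} (hs : HasSum a s)
    (hr : 1 < r) (hR0 : 0 < R) (hRr : R < r) (hsum : Summable fun k => a k * r ^ k) :
    Summable fun k => |∑ j ∈ Finset.range (k + 1), a j - s| * R ^ k := by
  have hr0 : 0 < r := by linarith
  have hq : R / r < 1 := (div_lt_one hr0).mpr hRr
  refine Summable.of_nonneg_of_le (fun k => by positivity) (fun k => ?_)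
    ((summable_geometric_of_lt_one (by positivity) hq).mul_left (∑' k, a k * r ^ k))
  have e1 := hs.summable.sum_add_tsum_nat_add (k + 1)
  have e2 := hsum.sum_add_tsum_nat_add (k + 1)
  have h1 : s - ∑ j ∈ Finset.range (k + 1), a j = ∑' j, a (j + (k + 1)) := by
    rw [hs.tsum_eq] at e1
    linarith
  have h2 : (∑' j, a (j + (k + 1))) * r ^ k ≤ ∑' k, a k * r ^ k := by
    have h3 : ∑' j, a (j + (k + 1)) * r ^ k ≤ ∑' j, a (j + (k + 1)) * r ^ (j + (k + 1)) :=
      (((summable_nat_add_iff (k + 1)).mpr hs.summable).mul_right _).tsum_le_tsum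
        (fun j => mul_le_mul_of_nonneg_left (pow_le_pow_right₀ hr.le (by omega)) (ha _))
        ((summable_nat_add_iff (f := fun k => a k * r ^ k) (k + 1)).mpr hsum)
    have h4 : 0 ≤ ∑ i ∈ Finset.range (k + 1), a i * r ^ i :=
      Finset.sum_nonneg fun i _ => mul_nonneg (ha i) (by positivity)
    rw [← tsum_mul_right]
    linarith
  have h5 : 0 ≤ ∑' j, a (j + (k + 1)) := tsum_nonneg fun j => ha _
  rw [abs_sub_comm, h1, abs_of_nonneg h5, div_pow]
  rw [← le_div_iff₀ (by positivity)] at h2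
  calc _ ≤ (∑' k, a k * r ^ k) / r ^ k * R ^ k :=
        mul_le_mul_of_nonneg_right h2 (by positivity)
    _ = _ := by ring

/-- The shifted series converges, like the given one, in a disk of radius greater than one: its
additional terms are tails of the series `∑ A_k 𝟏 = 𝟏`. -/
theorem exists_radius {B : ℕ → Matrix (Fin M) (Fin M) ℝ} (hAB : IsErgodicMG1 A B)
    (hroot : HasSimpleUnitRoot A) :
    ∃ R : ℝ, 1 < R ∧ (Summable fun k => ‖PowerSeries.coeff k (seriesOf A)‖ * R ^ k) ∧
      Summable fun k => ‖PowerSeries.coeff k (seriesOf (shifted A u))‖ * R ^ k := by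
  obtain ⟨r, hr, hsum⟩ := hroot.analytic
  obtain ⟨R, h1R, hRr⟩ := exists_between hr
  have hR0 : 0 < R := by linarith
  have hA : ∀ i j, Summable fun k => |A k i j| * R ^ k := by
    intro i j
    refine Summable.of_nonneg_of_le (fun k => by positivity) (fun k => ?_) (hsum i j)
    rw [abs_of_nonneg (hAB.A_nonneg k i j)]
    exact mul_le_mul_of_nonneg_left (pow_le_pow_left₀ hR0.le hRr.le k) (hAB.A_nonneg k i j)
  refine ⟨R, h1R, summable_norm_seriesOf hR0.le hA, summable_norm_seriesOf hR0.le fun i j => ?_⟩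
  have htail := summable_tail_mul_pow (a := fun k => ∑ j, A k i j)
    (fun k => Finset.sum_nonneg fun j _ => hAB.A_nonneg k i j) (hAB.A_stochastic i) hr hR0 hRr (by
      simp only [Finset.sum_mul]
      exact summable_sum fun j _ => hsum i j)
  rw [← summable_nat_add_iff 1]
  refine Summable.of_nonneg_of_le (fun k => by positivity) (fun k => ?_)
    (((summable_nat_add_iff 1).mpr (hA i j)).add
      (((summable_nat_add_iff 1).mpr htail).mul_right |u j|))
  have hval : shifted A u (k + 1) i j =
      A (k + 1) i j - (∑ l ∈ Finset.range (k + 1 + 1), ∑ j, A l i j - 1) * u j := by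
    rw [shifted, Matrix.sub_apply, Matrix.mul_apply]
    simp only [shiftQ, Matrix.of_apply, ← Finset.sum_mul, Matrix.sub_apply, Matrix.sum_apply,
      Finset.sum_sub_distrib, Matrix.one_apply]
    rw [Finset.sum_comm]
    simp
  rw [hval]
  calc _ ≤ (|A (k + 1) i j| + |(∑ l ∈ Finset.range (k + 1 + 1), ∑ j, A l i j - 1) * u j|) *
        R ^ (k + 1) := mul_le_mul_of_nonneg_right (abs_sub _ _) (by positivity)
    _ = _ := by rw [abs_mul]; ring

theorem symbol_shifted_mul (hu : ∑ i, u i = 1) {R : ℝ} (hR : 1 < R)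
    (hA : Summable fun k => ‖PowerSeries.coeff k (seriesOf A)‖ * R ^ k)
    (hs : Summable fun k => ‖PowerSeries.coeff k (seriesOf (shifted A u))‖ * R ^ k)
    {z : ℂ} (hz : ‖z‖ ≤ R) :
    symbol (seriesOf (shifted A u)) z * (z • 1 - complexQ u) = z • symbol (seriesOf A) z := by
  have hR0 : 0 ≤ R := by linarith
  have h : evalAt _ z = evalAt _ z :=
    congrArg (fun S => evalAt S z) (seriesOf_shifted_mul (A := A) hu)
  rw [evalAt_mul_C hs hz, evalAt_X_mul (summable_norm_add hR0 (summable_norm_sub hR0 hs hA)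
    (summable_norm_C _ R)) hz, evalAt_add (summable_norm_sub hR0 hs hA) (summable_norm_C _ R) hz,
    evalAt_sub hs hA hz, evalAt_C] at h
  rw [symbol, symbol, mul_sub, sub_mul, sub_mul, h]
  simp only [smul_mul_assoc, mul_smul_comm, one_mul, mul_one, smul_sub, smul_add]
  abel

theorem charDet_eq {R : ℝ} (hA : Summable fun k => ‖PowerSeries.coeff k (seriesOf A)‖ * R ^ k)
    {z : ℂ} (hz : ‖z‖ ≤ R) : charDet A z = (symbol (seriesOf A) z).det := by
  have h : phiAt A z = evalAt (seriesOf A) z := by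
    have hsum := hasSum_evalAt hA hz
    ext i j
    have hij : HasSum (fun k : ℕ => (z ^ k • PowerSeries.coeff k (seriesOf A)) i j)
        (evalAt (seriesOf A) z i j) := Pi.hasSum.mp (Pi.hasSum.mp hsum i) j
    rw [← hij.tsum_eq, phiAt, Matrix.of_apply]
    simp [seriesOf]
  rw [charDet, symbol, h]

theorem differentiableAt_det {F : ℂ → Matrix (Fin M) (Fin M) ℂ} {z : ℂ}
    (hF : DifferentiableAt ℂ F z) : DifferentiableAt ℂ (fun z => (F z).det) z := by
  have hij : ∀ i j, DifferentiableAt ℂ (fun z => F z i j) z := fun i j =>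
    differentiableAt_pi.mp (differentiableAt_pi.mp hF i) j
  simp only [Matrix.det_apply]
  refine DifferentiableAt.fun_sum fun σ _ => DifferentiableAt.const_smul ?_ _
  exact DifferentiableAt.fun_finsetProd fun i _ => hij _ _

theorem det_one_sub_complexQ [NeZero M] (hu : ∑ i, u i = 1) :
    ((1 : ℂ) • (1 : Matrix (Fin M) (Fin M) ℂ) - complexQ u).det = 0 := by
  rw [← Matrix.exists_mulVec_eq_zero_iff]
  refine ⟨fun _ => 1, fun h => one_ne_zero (congrFun h 0), ?_⟩
  ext i
  have hu' : ∑ i, (u i : ℂ) = 1 := by exact_mod_cast congrArg Complex.ofReal hu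
  rw [one_smul, Matrix.sub_mulVec, Matrix.one_mulVec]
  simp [Matrix.mulVec, dotProduct, complexQ, shiftQ, hu']

/-- The shift moves the simple root `z = 1` to the origin, so that the symbol of the shifted
chain is invertible on the whole unit circle. -/
theorem isUnit_symbol_shifted (hu : ∑ i, u i = 1) (hroot : HasSimpleUnitRoot A) {R : ℝ}
    (hR : 1 < R) (hA : Summable fun k => ‖PowerSeries.coeff k (seriesOf A)‖ * R ^ k)
    (hs : Summable fun k => ‖PowerSeries.coeff k (seriesOf (shifted A u))‖ * R ^ k)
    {z : ℂ} (hz : ‖z‖ = 1) : IsUnit (symbol (seriesOf (shifted A u)) z) := by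
  have hM : NeZero M := ⟨by rintro rfl; simp at hu⟩
  have hdet : ∀ z : ℂ, ‖z‖ ≤ R → (symbol (seriesOf (shifted A u)) z).det *
      (z • 1 - complexQ u).det = z ^ M * charDet A z := by
    intro z hz
    have h := congrArg Matrix.det (symbol_shifted_mul hu hR hA hs hz)
    rwa [Matrix.det_mul, Matrix.det_smul, Fintype.card_fin, ← charDet_eq hA hz] at h
  rw [Matrix.isUnit_iff_isUnit_det, isUnit_iff_ne_zero]
  intro h0
  have hzR : ‖z‖ ≤ R := hz.trans_le hR.le
  have hz0 : z ≠ 0 := norm_pos_iff.mp (by rw [hz]; exact one_pos)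
  have hz1 : z = 1 := by
    refine hroot.unique_root z hz ?_
    have h := hdet z hzR
    rw [h0, zero_mul, eq_comm, mul_eq_zero] at h
    exact h.resolve_left (pow_ne_zero M hz0)
  subst hz1
  -- both factors of the left side of `hdet` vanish at `1`, so the right side has a double zero
  have hmem : (1 : ℂ) ∈ Metric.ball (0 : ℂ) R := by simpa using hR
  have hd1 : DifferentiableAt ℂ (fun z => (symbol (seriesOf (shifted A u)) z).det) 1 :=
    differentiableAt_det ((differentiableOn_symbol hs).differentiableAt
      (Metric.isOpen_ball.mem_nhds hmem))
  have hd2 : DifferentiableAt ℂ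
      (fun z : ℂ => (z • (1 : Matrix (Fin M) (Fin M) ℂ) - complexQ u).det) 1 :=
    differentiableAt_det ((differentiableAt_id.smul_const _).sub_const _)
  have hd3 : DifferentiableAt ℂ (charDet A) 1 := differentiableAt_of_deriv_ne_zero hroot.simple_root
  have h1 := hd1.hasDerivAt.mul hd2.hasDerivAt
  have h2 := (hasDerivAt_pow M (1 : ℂ)).mul hd3.hasDerivAt
  have heq : (fun z => (symbol (seriesOf (shifted A u)) z).det *
      (z • 1 - complexQ u).det) =ᶠ[nhds 1] fun z => z ^ M * charDet A z := by
    filter_upwards [Metric.isOpen_ball.mem_nhds hmem] with z hz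
    exact hdet z (by simpa using (mem_ball_zero_iff.mp hz).le)
  have h3 := h1.unique (h2.congr_of_eventuallyEq heq)
  have hc : charDet A 1 = 0 := by
    have h := hdet 1 hzR
    rw [h0, zero_mul, one_pow, one_mul] at h
    exact h.symm
  simp only [h0, det_one_sub_complexQ hu, hc] at h3
  exact hroot.simple_root (by simpa using h3.symm)

end Shift

/-! ### A Liouville theorem for the chain -/

section Liouville

open Filter Topology

/-- For a positive recurrent irreducible chain a bounded nonnegative subharmonic function is
harmonic (integrate against the invariant law), so that a single zero spreads to all states. -/
theorem eq_zero_of_subharmonic {S : Type*} {P : S → S → ℝ} (hP : ∀ x y, 0 ≤ P x y)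
    (hE : IsErgodicChain P) {f : S → ℝ≥0∞} {B : ℝ≥0∞} (hB : B ≠ ⊤) (hf : ∀ x, f x ≤ B)
    (hsub : ∀ x, f x ≤ ∑' y, ENNReal.ofReal (P x y) * f y) {x₀ : S} (h0 : f x₀ = 0) (y : S) :
    f y = 0 := by
  obtain ⟨p, hp0, hp1, hinv⟩ := hE.invariant
  have hppos : ∀ x, 0 < p x := by
    obtain ⟨x₁, hx₁⟩ : ∃ x, 0 < p x := by
      by_contra! hcon
      have hz : p = fun _ => 0 := funext fun x => le_antisymm (hcon x) (hp0 x)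
      rw [hz] at hp1
      exact one_ne_zero (hp1.unique hasSum_zero)
    have hreach : ∀ n x, Reaches P n x₁ x → 0 < p x := by
      intro n
      induction n with
      | zero =>
        intro x hx
        have : x₁ = x := hx
        exact this ▸ hx₁
      | succ n ih =>
        rintro x ⟨w, hw, hwx⟩
        refine lt_of_lt_of_le (mul_pos (ih w hw) hwx) ?_
        exact le_hasSum (hinv x) w fun v _ => mul_nonneg (hp0 v) (hP v x)
    intro x
    obtain ⟨n, hn⟩ := hE.irreducible x₁ x
    exact hreach n x hn
  let q : S → ℝ≥0∞ := fun x => ENNReal.ofReal (p x)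
  have hq1 : ∑' x, q x = 1 := by
    rw [← ENNReal.ofReal_tsum_of_nonneg hp0 hp1.summable, hp1.tsum_eq, ENNReal.ofReal_one]
  have hqinv : ∀ y, ∑' x, q x * ENNReal.ofReal (P x y) = q y := by
    intro y
    have h1 : ∀ x, q x * ENNReal.ofReal (P x y) = ENNReal.ofReal (p x * P x y) := fun x =>
      (ENNReal.ofReal_mul (hp0 x)).symm
    simp_rw [h1]
    rw [← ENNReal.ofReal_tsum_of_nonneg (fun x => mul_nonneg (hp0 x) (hP x y)) (hinv y).summable,
      (hinv y).tsum_eq]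
  have hT : ∑' x, q x * f x ≠ ⊤ := by
    refine ne_top_of_le_ne_top hB ?_
    calc ∑' x, q x * f x ≤ ∑' x, q x * B := ENNReal.tsum_le_tsum fun x => mul_le_mul_right (hf x) _
      _ = B := by rw [ENNReal.tsum_mul_right, hq1, one_mul]
  have heq : ∑' x, q x * ∑' y, ENNReal.ofReal (P x y) * f y = ∑' x, q x * f x := by
    simp_rw [← ENNReal.tsum_mul_left]
    rw [ENNReal.tsum_comm]
    refine tsum_congr fun y => ?_
    simp_rw [← mul_assoc]
    rw [ENNReal.tsum_mul_right, hqinv]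
  have hterm : ∀ x, q x * f x = q x * ∑' y, ENNReal.ofReal (P x y) * f y := by
    intro x
    by_contra hne
    have hlt := lt_of_le_of_ne (mul_le_mul_right (hsub x) (q x)) hne
    exact (ENNReal.tsum_lt_tsum hT (fun a => mul_le_mul_right (hsub a) (q a)) hlt).ne heq.symm
  have hstep : ∀ x y, f x = 0 → 0 < P x y → f y = 0 := by
    intro x y hx hxy
    have h1 := hterm x
    rw [hx, mul_zero, eq_comm, mul_eq_zero] at h1
    have h2 := h1.resolve_left (ENNReal.ofReal_pos.mpr (hppos x)).ne'
    rw [ENNReal.tsum_eq_zero] at h2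
    exact (mul_eq_zero.mp (h2 y)).resolve_left (ENNReal.ofReal_pos.mpr hxy).ne'
  have hreach : ∀ n x, Reaches P n x₀ x → f x = 0 := by
    intro n
    induction n with
    | zero =>
      intro x hx
      have : x₀ = x := hx
      exact this ▸ h0
    | succ n ih =>
      rintro x ⟨w, hw, hwx⟩
      exact hstep w x (ih w hw) hwx
  obtain ⟨n, hn⟩ := hE.irreducible x₀ y
  exact hreach n y hn

variable {M : ℕ} {A B : ℕ → Matrix (Fin M) (Fin M) ℝ}

theorem transition_nonneg (hAB : IsErgodicMG1 A B) (x y : ℕ × Fin M) :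
    0 ≤ transition A B x y := by
  obtain ⟨l, i⟩ := x
  obtain ⟨m, j⟩ := y
  cases l with
  | zero => exact hAB.B_nonneg m i j
  | succ l =>
    simp only [transition]
    split_ifs
    · exact hAB.A_nonneg _ _ _
    · exact le_rfl

theorem hasSum_mul_sub_const (hAB : IsErgodicMG1 A B) {g : ℤ → Fin M → ℝ} {l : ℤ} {i : Fin M}
    {s : ℝ} (h : HasSum (fun j : ℕ => ∑ p, A j i p * g (l - 1 + j) p) s) (c : ℝ) :
    HasSum (fun j : ℕ => ∑ p, A j i p * (g (l - 1 + j) p - c)) (s - c) := by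
  have h1 := h.sub ((hAB.A_stochastic i).mul_right c)
  rw [one_mul] at h1
  refine h1.congr_fun fun j => ?_
  simp only [mul_sub, Finset.sum_sub_distrib, Finset.sum_mul]

/-- A bounded function that is harmonic above level zero and constant on level zero is constant:
from every state the chain returns to level zero with probability one. -/
theorem eq_const_of_harmonic (hAB : IsErgodicMG1 A B) {g : ℤ → Fin M → ℝ} {b c : ℝ}
    (hb : ∀ l i, |g l i| ≤ b) (h0 : ∀ i, g 0 i = c)
    (hg : ∀ l : ℤ, 0 < l → ∀ i, HasSum (fun j : ℕ => ∑ p, A j i p * g (l - 1 + j) p) (g l i))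
    (l : ℕ) (i : Fin M) : g l i = c := by
  let f : ℕ × Fin M → ℝ≥0∞ := fun x => ‖g x.1 x.2 - c‖ₑ
  have hf0 : ∀ i, f (0, i) = 0 := fun i => by simp [f, h0]
  have hfB : ∀ x, f x ≤ ENNReal.ofReal (b + |c|) := by
    intro x
    simp only [f]
    rw [← ofReal_norm, Real.norm_eq_abs]
    exact ENNReal.ofReal_le_ofReal ((abs_sub _ _).trans (add_le_add (hb _ _) le_rfl))
  have hsub : ∀ x, f x ≤ ∑' y, ENNReal.ofReal (transition A B x y) * f y := by
    rintro ⟨l, i⟩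
    cases l with
    | zero => rw [hf0]; exact zero_le
    | succ l =>
      have h1 := hasSum_mul_sub_const hAB (hg ((l : ℤ) + 1) (by omega) i) c
      have h2 : ∀ j : ℕ, ‖∑ p, A j i p * (g ((l : ℤ) + 1 - 1 + j) p - c)‖ₑ ≤
          ∑' p, ENNReal.ofReal (transition A B (l + 1, i) (j + l, p)) * f (j + l, p) := by
        intro j
        rw [tsum_fintype]
        refine (enorm_sum_le _ _).trans (Finset.sum_le_sum fun p _ => ?_)
        have h3 : transition A B (l + 1, i) (j + l, p) = A j i p := by
          simp [transition]
        have h4 : (l : ℤ) + 1 - 1 + j = ((j + l : ℕ) : ℤ) := by push_cast; ring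
        rw [h3, enorm_mul, h4, Real.enorm_of_nonneg (hAB.A_nonneg j i p)]
      calc f (l + 1, i) = ‖g ((l : ℤ) + 1) i - c‖ₑ := by simp [f]
        _ = ‖∑' j : ℕ, ∑ p, A j i p * (g ((l : ℤ) + 1 - 1 + j) p - c)‖ₑ := by rw [h1.tsum_eq]
        _ ≤ ∑' j : ℕ, ‖∑ p, A j i p * (g ((l : ℤ) + 1 - 1 + j) p - c)‖ₑ :=
            enorm_tsum_le_tsum_enorm
        _ ≤ ∑' j : ℕ, ∑' p, ENNReal.ofReal (transition A B (l + 1, i) (j + l, p)) *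
              f (j + l, p) := ENNReal.tsum_le_tsum h2
        _ ≤ ∑' m : ℕ, ∑' p, ENNReal.ofReal (transition A B (l + 1, i) (m, p)) * f (m, p) :=
            ENNReal.tsum_comp_le_tsum_of_injective (add_left_injective l)
              fun m => ∑' p, ENNReal.ofReal (transition A B (l + 1, i) (m, p)) * f (m, p)
        _ = _ := (ENNReal.tsum_prod' (f := fun y =>
              ENNReal.ofReal (transition A B (l + 1, i) y) * f y)).symm
  have h := eq_zero_of_subharmonic (transition_nonneg hAB) hAB.ergodic ENNReal.ofReal_ne_top hfB
    hsub (hf0 i) (l, i)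
  simpa [f, sub_eq_zero] using h

/-- The maximum principle below level zero: a function harmonic there, vanishing at `-∞`, and
equal to `c ≥ 0` from level zero on does not exceed `c`. By irreducibility a larger maximum would
be attained at arbitrarily low levels. -/
theorem le_const_of_harmonic (hAB : IsErgodicMG1 A B) {g : ℤ → Fin M → ℝ} {c : ℝ} (hc : 0 ≤ c)
    (hlim : ∀ i, Tendsto (fun n : ℕ => g (-n) i) atTop (𝓝 0))
    (hpos : ∀ (l : ℕ) i, g l i = c)
    (hg : ∀ l : ℤ, l < 0 → ∀ i, HasSum (fun j : ℕ => ∑ p, A j i p * g (l - 1 + j) p) (g l i))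
    (l : ℤ) (i : Fin M) : g l i ≤ c := by
  by_contra! hcon
  have hsmall : ∀ s : ℝ, 0 < s → ∃ N : ℕ, ∀ n ≥ N, ∀ i, g (-(n : ℤ)) i < s := by
    intro s hs
    have h1 : ∀ᶠ n : ℕ in atTop, ∀ i, g (-(n : ℤ)) i < s :=
      eventually_all.mpr fun i => (hlim i).eventually_lt_const hs
    exact eventually_atTop.mp h1
  have hnonneg : ∀ m : ℤ, 0 ≤ m → ∀ i, g m i = c := by
    intro m hm i
    obtain ⟨n, rfl⟩ := Int.eq_ofNat_of_zero_le hm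
    exact hpos n i
  have hneg : ∀ m : ℤ, m < 0 → ∃ n : ℕ, m = -n := fun m hm => ⟨m.natAbs, by omega⟩
  have hl : l < 0 := by
    by_contra! h
    exact hcon.ne' (hnonneg l h i)
  -- a global maximum `s > c`
  obtain ⟨l₁, i₁, hl₁, hmax⟩ : ∃ l₁ i₁, c < g l₁ i₁ ∧ ∀ m q, g m q ≤ g l₁ i₁ := by
    obtain ⟨N, hN⟩ := hsmall (g l i) (hc.trans_lt hcon)
    obtain ⟨n, rfl⟩ := hneg l hl
    have hmem : (n, i) ∈ Finset.range N ×ˢ (Finset.univ : Finset (Fin M)) := by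
      rw [Finset.mem_product]
      refine ⟨Finset.mem_range.mpr ?_, Finset.mem_univ i⟩
      by_contra! h
      exact lt_irrefl _ (hN n h i)
    obtain ⟨⟨n₁, i₁⟩, -, h1⟩ := Finset.exists_max_image _
      (fun x : ℕ × Fin M => g (-(x.1 : ℤ)) x.2) ⟨_, hmem⟩
    have h2 := h1 _ hmem
    refine ⟨-n₁, i₁, hcon.trans_le h2, fun m q => ?_⟩
    rcases lt_or_ge m 0 with hm | hm
    · obtain ⟨k, rfl⟩ := hneg m hm
      rcases lt_or_ge k N with hk | hk
      · exact h1 (k, q) (Finset.mem_product.mpr ⟨Finset.mem_range.mpr hk, Finset.mem_univ q⟩)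
      · exact (hN k hk q).le.trans h2
    · rw [hnonneg m hm]
      exact hcon.le.trans h2
  have hneg₁ : ∀ m q, g m q = g l₁ i₁ → m < 0 := by
    intro m q hm
    by_contra! h
    rw [hnonneg m h] at hm
    exact hl₁.ne hm
  have hprop : ∀ m q, g m q = g l₁ i₁ → ∀ j p, 0 < A j q p → g (m - 1 + (j : ℕ)) p = g l₁ i₁ := by
    intro m q hm j p hA
    have h1 := (hasSum_mul_sub_const hAB (hg m (hneg₁ m q hm) q) (g l₁ i₁)).neg
    rw [hm, sub_self, neg_zero] at h1
    have hterm : ∀ j p, 0 ≤ A j q p * (g l₁ i₁ - g (m - 1 + (j : ℕ)) p) := fun j p =>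
      mul_nonneg (hAB.A_nonneg j q p) (sub_nonneg.mpr (hmax _ _))
    have h2 : HasSum (fun j : ℕ => ∑ p, A j q p * (g l₁ i₁ - g (m - 1 + j) p)) 0 := by
      refine h1.congr_fun fun j => ?_
      rw [← Finset.sum_neg_distrib]
      exact Finset.sum_congr rfl fun p _ => by ring
    rw [hasSum_zero_iff_of_nonneg fun j => Finset.sum_nonneg fun p _ => hterm j p] at h2
    have h3 := (Finset.sum_eq_zero_iff_of_nonneg fun p _ => hterm j p).mp (congrFun h2 j) p
      (Finset.mem_univ p)
    have h4 := (mul_eq_zero.mp h3).resolve_left hA.ne'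
    linarith
  -- level `m` of the chain is placed at the integer level `l₁ - L + m`
  have hpath : ∀ L : ℕ, ∃ q, g (l₁ - L) q = g l₁ i₁ := by
    intro L
    have hreach : ∀ n (y : ℕ × Fin M), Reaches (transition A B) n (L, i₁) y →
        (∃ q, g (l₁ - L) q = g l₁ i₁) ∨ g (l₁ - L + y.1) y.2 = g l₁ i₁ := by
      intro n
      induction n with
      | zero =>
        intro y hy
        have : (L, i₁) = y := hy
        subst this
        right
        simp
      | succ n ih =>
        rintro ⟨m', q'⟩ ⟨⟨m, q⟩, hw, hwy⟩
        rcases ih _ hw with h | h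
        · exact Or.inl h
        · cases m with
          | zero => exact Or.inl ⟨q, by simpa using h⟩
          | succ m =>
            simp only [transition] at hwy
            split_ifs at hwy with hmm
            · right
              have h1 := hprop _ q h (m' - m) q' hwy
              rw [← h1]
              congr 1
              simp only [Nat.cast_sub hmm]
              push_cast
              ring
            · exact absurd hwy (lt_irrefl 0)
    obtain ⟨n, hn⟩ := hAB.ergodic.irreducible (L, i₁) (0, i₁)
    rcases hreach n _ hn with h | h
    · exact h
    · exact ⟨i₁, by simpa using h⟩
  obtain ⟨N, hN⟩ := hsmall (g l₁ i₁) (hc.trans_lt hl₁)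
  obtain ⟨n₁, rfl⟩ := hneg l₁ (hneg₁ l₁ i₁ rfl)
  obtain ⟨q, hq⟩ := hpath N
  have h1 := hN (n₁ + N) (by omega) q
  have h2 : (-((n₁ + N : ℕ) : ℤ)) = -(n₁ : ℤ) - N := by push_cast; ring
  rw [h2, hq] at h1
  exact lt_irrefl _ h1

/-- A bounded function on `ℤ × {phases}`, harmonic off level zero, vanishing at `-∞`, and on
level zero constantly equal to its `u`-mean one level below, has no source on level zero. -/
theorem source_eq_zero (hAB : IsErgodicMG1 A B) {u : Fin M → ℝ} (hu : ∀ i, 0 < u i)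
    (hu1 : ∑ i, u i = 1) {g : ℤ → Fin M → ℝ} {x : Fin M → ℝ} {b : ℝ} (hb : ∀ l i, |g l i| ≤ b)
    (hlim : ∀ i, Tendsto (fun n : ℕ => g (-n) i) atTop (𝓝 0))
    (hg : ∀ (l : ℤ) i, HasSum (fun j : ℕ => ∑ p, A j i p * g (l - 1 + j) p)
      (g l i - if l = 0 then x i else 0))
    (h0 : ∀ i, g 0 i = ∑ p, u p * g (-1) p) : x = 0 := by
  wlog hc : 0 ≤ ∑ p, u p * g (-1) p generalizing g x
  · have h := this (g := fun l i => -g l i) (x := -x) (by simpa using hb)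
      (fun i => by simpa using (hlim i).neg) (fun l i => ?_) (fun i => by simp [h0]) (by
        simp only [mul_neg, Finset.sum_neg_distrib]
        linarith)
    · simpa using h
    · have e : (-g l i - if l = 0 then (-x) i else 0) = -(g l i - if l = 0 then x i else 0) := by
        split_ifs
        · simp only [Pi.neg_apply]
          ring
        · simp
      rw [e]
      exact (hg l i).neg.congr_fun fun j => by simp
  set c := ∑ p, u p * g (-1) p with hcdef
  have hoff : ∀ l : ℤ, l ≠ 0 → ∀ i,
      HasSum (fun j : ℕ => ∑ p, A j i p * g (l - 1 + j) p) (g l i) := by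
    intro l hl i
    have h := hg l i
    rwa [if_neg hl, sub_zero] at h
  have hconst := eq_const_of_harmonic hAB hb h0 fun l hl => hoff l hl.ne'
  have hle := le_const_of_harmonic hAB hc hlim hconst fun l hl => hoff l hl.ne
  -- on level `-1` the upper bound `c` is also the mean with positive weights
  have hm1 : ∀ i, g (-1) i = c := by
    intro i
    have h1 : ∑ p, u p * (c - g (-1) p) = 0 := by
      simp only [mul_sub, Finset.sum_sub_distrib, ← Finset.sum_mul, hu1, one_mul]
      rw [← hcdef, sub_self]
    have h2 := (Finset.sum_eq_zero_iff_of_nonneg fun p _ =>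
      mul_nonneg (hu p).le (sub_nonneg.mpr (hle (-1) p))).mp h1 i (Finset.mem_univ i)
    have h3 := (mul_eq_zero.mp h2).resolve_left (hu i).ne'
    linarith
  ext i
  have h1 := hasSum_mul_sub_const hAB (hg 0 i) c
  have h2 : (fun j : ℕ => ∑ p, A j i p * (g (0 - 1 + j) p - c)) = fun _ => 0 := by
    ext j
    refine Finset.sum_eq_zero fun p _ => ?_
    cases j with
    | zero => simp [hm1]
    | succ j =>
      have h3 : (0 : ℤ) - 1 + ((j + 1 : ℕ) : ℤ) = (j : ℕ) := by push_cast; ring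
      rw [h3, hconst, sub_self, mul_zero]
  rw [h2, h0 i] at h1
  have h4 := h1.unique hasSum_zero
  simp only [if_true] at h4
  rw [Pi.zero_apply]
  linarith

end Liouville

/-! ### The central coefficient of the inverse symbol is invertible -/

section Central

open Filter Topology
open scoped Matrix.Norms.Operator

variable {M : ℕ} {A B : ℕ → Matrix (Fin M) (Fin M) ℝ} {u : Fin M → ℝ}
  {H : ℤ → Matrix (Fin M) (Fin M) ℂ} {C q : ℝ}

theorem summable_pow_natAbs {q : ℝ} (hq0 : 0 ≤ q) (hq1 : q < 1) :
    Summable fun k : ℤ => q ^ k.natAbs := by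
  refine Summable.of_nat_of_neg ?_ ?_ <;>
  simpa using summable_geometric_of_lt_one hq0 hq1

theorem rnorm_one_ne_top_of_summable {S : MSeries M} {R : ℝ} (hR : 1 < R)
    (hS : Summable fun k => ‖PowerSeries.coeff k S‖ * R ^ k) : rnorm 1 S ≠ ⊤ := by
  rw [rnorm_one_eq]
  have h : Summable fun k => ‖PowerSeries.coeff k S‖ := by
    refine Summable.of_nonneg_of_le (fun _ => norm_nonneg _) (fun j => ?_) hS
    exact le_mul_of_one_le_right (norm_nonneg _) (one_le_pow₀ hR.le)
  exact ENNReal.tsum_coe_ne_top_iff_summable.mpr (NNReal.summable_coe.mp h)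

/-- The Green function of the unshifted chain in terms of that of the shifted chain,
`∑ w(k) zᵏ = (I - z⁻¹ Q)⁻¹ ∑ H(k) zᵏ`. -/
noncomputable def unshift (u : Fin M → ℝ) (H : ℤ → Matrix (Fin M) (Fin M) ℂ) (k : ℤ) :
    Matrix (Fin M) (Fin M) ℂ :=
  H k + complexQ u * ∑' j : ℕ, H (k + 1 + j)

theorem complexQ_mul_complexQ (hu : ∑ i, u i = 1) : complexQ u * complexQ u = complexQ u := by
  rw [complexQ, ← map_ofReal_mul, shiftQ_mul_shiftQ hu]

theorem summable_norm_of_decay (hq0 : 0 ≤ q) (hq1 : q < 1)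
    (hH : ∀ k, ‖H k‖ ≤ C * q ^ k.natAbs) : Summable fun k => ‖H k‖ :=
  Summable.of_nonneg_of_le (fun _ => norm_nonneg _) hH ((summable_pow_natAbs hq0 hq1).mul_left C)

theorem injective_add_natCast (k : ℤ) : Function.Injective fun j : ℕ => k + j := fun a b hab => by
  simpa using hab

theorem eq_unshift_sub (hu : ∑ i, u i = 1) (hs : Summable fun k => ‖H k‖) (k : ℤ) :
    H k = unshift u H k - complexQ u * unshift u H (k + 1) := by
  have h1 : Summable fun j : ℕ => H (k + 1 + j) :=
    (hs.comp_injective (injective_add_natCast (k + 1))).of_norm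
  rw [unshift, unshift, mul_add, ← mul_assoc, complexQ_mul_complexQ hu, ← mul_add,
    h1.tsum_eq_zero_add]
  have h2 : ∀ j : ℕ, k + 1 + ((j + 1 : ℕ) : ℤ) = k + 1 + 1 + j := fun j => by push_cast; ring
  simp only [h2, Nat.cast_zero, add_zero, add_sub_cancel_right]

theorem norm_unshift_le (hs : Summable fun k => ‖H k‖) (k : ℤ) :
    ‖unshift u H k‖ ≤ ‖H k‖ + ‖complexQ u‖ * ∑' j : ℕ, ‖H (k + 1 + j)‖ := by
  refine (norm_add_le _ _).trans (add_le_add le_rfl ((norm_mul_le _ _).trans ?_))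
  exact mul_le_mul_of_nonneg_left
    (norm_tsum_le_tsum_norm (hs.comp_injective (injective_add_natCast (k + 1)))) (norm_nonneg _)

theorem exists_unshift_bound (hs : Summable fun k => ‖H k‖) : ∃ b, ∀ k, ‖unshift u H k‖ ≤ b := by
  refine ⟨(∑' k, ‖H k‖) + ‖complexQ u‖ * ∑' k, ‖H k‖, fun k => (norm_unshift_le hs k).trans ?_⟩
  refine add_le_add (hs.le_tsum k fun _ _ => norm_nonneg _)
    (mul_le_mul_of_nonneg_left ?_ (norm_nonneg _))
  exact tsum_comp_le_tsum_of_inj hs (fun _ => norm_nonneg _) (injective_add_natCast (k + 1))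

theorem tendsto_unshift (hq0 : 0 ≤ q) (hq1 : q < 1) (hH : ∀ k, ‖H k‖ ≤ C * q ^ k.natAbs) :
    Tendsto (fun n : ℕ => ‖unshift u H n‖) atTop (𝓝 0) := by
  have hs := summable_norm_of_decay hq0 hq1 hH
  have htail : ∀ n : ℕ, ∑' j : ℕ, ‖H ((n : ℤ) + 1 + j)‖ ≤ q ^ n * (C * q * (1 - q)⁻¹) := by
    intro n
    have h1 : HasSum (fun j : ℕ => q ^ n * (C * q * q ^ j)) (q ^ n * (C * q * (1 - q)⁻¹)) :=
      ((hasSum_geometric_of_lt_one hq0 hq1).mul_left (C * q)).mul_left (q ^ n)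
    rw [← h1.tsum_eq]
    refine (hs.comp_injective (injective_add_natCast ((n : ℤ) + 1))).tsum_le_tsum
      (fun j => (hH _).trans (le_of_eq ?_)) h1.summable
    have h2 : ((n : ℤ) + 1 + j).natAbs = n + 1 + j := by omega
    rw [h2]
    ring
  have hlim : Tendsto (fun n : ℕ => C * q ^ n +
      ‖complexQ u‖ * (q ^ n * (C * q * (1 - q)⁻¹))) atTop (𝓝 0) := by
    have h1 := tendsto_pow_atTop_nhds_zero_of_lt_one hq0 hq1
    have h2 := (h1.const_mul C).add ((h1.mul_const (C * q * (1 - q)⁻¹)).const_mul ‖complexQ u‖)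
    simpa using h2
  refine squeeze_zero (fun _ => norm_nonneg _) (fun n => (norm_unshift_le hs n).trans ?_) hlim
  exact add_le_add (by simpa using hH n) (mul_le_mul_of_nonneg_left (htail n) (norm_nonneg _))

/-- The Green function of the unshifted chain inverts the symbol of the unshifted chain. -/
theorem act_unshift (hu : ∑ i, u i = 1) (hA : rnorm 1 (seriesOf A) ≠ ⊤)
    (hS : rnorm 1 (seriesOf (shifted A u)) ≠ ⊤) (hs : Summable fun k => ‖H k‖)
    (hact : ∀ k, act (seriesOf (shifted A u)) H k = H (k - 1) - if k = 1 then 1 else 0) (k : ℤ) :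
    act (seriesOf A) (unshift u H) k = unshift u H (k - 1) - if k = 1 then 1 else 0 := by
  obtain ⟨b, hb⟩ := exists_unshift_bound (u := u) hs
  have hb1 : ∀ k, ‖unshift u H (k + 1)‖ ≤ b := fun k => hb (k + 1)
  have hbQ : ∀ k, ‖complexQ u * unshift u H (k + 1)‖ ≤ ‖complexQ u‖ * b := fun k =>
    (norm_mul_le _ _).trans (mul_le_mul_of_nonneg_left (hb _) (norm_nonneg _))
  have hCQ : rnorm 1 (PowerSeries.C (complexQ u)) ≠ ⊤ := by rw [rnorm_C]; exact enorm_ne_top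
  have hd : rnorm 1 (seriesOf (shifted A u) - seriesOf A) ≠ ⊤ :=
    ne_top_of_le_ne_top (ENNReal.add_ne_top.mpr ⟨hS, hA⟩) (rnorm_sub_le _ _ _)
  have hd2 : rnorm 1 (seriesOf (shifted A u) - seriesOf A + PowerSeries.C (complexQ u)) ≠ ⊤ :=
    ne_top_of_le_ne_top (ENNReal.add_ne_top.mpr ⟨hd, hCQ⟩) (rnorm_add_le _ _ _)
  have h1 : act (seriesOf (shifted A u)) (fun k => complexQ u * unshift u H (k + 1)) k =
      act (seriesOf (shifted A u)) (unshift u H) k - act (seriesOf A) (unshift u H) k +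
        complexQ u * unshift u H k := by
    have h2 := act_mul hS hCQ hb1 k
    rw [seriesOf_shifted_mul hu, act_X_mul hd2 hb1, act_shift, sub_add_cancel,
      act_add_left hd hCQ hb, act_sub_left hS hA hb, act_C] at h2
    rw [h2]
    congr 1
    ext1 m
    rw [act_C]
  have h3 : act (seriesOf (shifted A u)) H k = act (seriesOf (shifted A u)) (unshift u H) k -
      act (seriesOf (shifted A u)) (fun k => complexQ u * unshift u H (k + 1)) k := by
    rw [← act_sub_right hS hb hbQ]
    congr 1
    ext1 m
    exact eq_unshift_sub hu hs m
  have h4 := eq_unshift_sub hu hs (k - 1)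
  rw [hact, h1, h4, sub_add_cancel] at h3
  have h5 : act (seriesOf A) (unshift u H) k = unshift u H (k - 1) - complexQ u * unshift u H k -
      (if k = 1 then 1 else 0) + complexQ u * unshift u H k := by
    rw [h3]
    abel
  rw [h5]
  abel

/-- If `H(0) x = 0`, then `(l, i) ↦ Re (w(-l) x)_i`, with `w` the Green function of the unshifted
chain, is a function as in `source_eq_zero` with the source `Re x`. The sign is reversed because the
convolution reads `w` at `k - j`, while the chain moves up by `j - 1` levels. -/
theorem re_eq_zero_of_mulVec_eq_zero (hAB : IsErgodicMG1 A B) (hu0 : ∀ i, 0 < u i)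
    (hu : ∑ i, u i = 1) (hA : rnorm 1 (seriesOf A) ≠ ⊤)
    (hS : rnorm 1 (seriesOf (shifted A u)) ≠ ⊤) (hq0 : 0 ≤ q) (hq1 : q < 1)
    (hH : ∀ k, ‖H k‖ ≤ C * q ^ k.natAbs)
    (hact : ∀ k, act (seriesOf (shifted A u)) H k = H (k - 1) - if k = 1 then 1 else 0)
    {x : Fin M → ℂ} (hx : (H 0).mulVec x = 0) (i : Fin M) : (x i).re = 0 := by
  have hs := summable_norm_of_decay hq0 hq1 hH
  obtain ⟨b, hb⟩ := exists_unshift_bound (u := u) hs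
  let w := unshift u H
  let g : ℤ → Fin M → ℝ := fun l i => ((w (-l)).mulVec x i).re
  have hgle : ∀ l i, |g l i| ≤ ‖w (-l)‖ * ‖x‖ := fun l i =>
    (Complex.abs_re_le_norm _).trans
      ((norm_le_pi_norm _ i).trans (Matrix.linfty_opNorm_mulVec _ _))
  have key := source_eq_zero hAB hu0 hu (g := g) (x := fun i => (x i).re) (b := b * ‖x‖)
    (fun l i => (hgle l i).trans (mul_le_mul_of_nonneg_right (hb _) (norm_nonneg _)))
    (fun i => ?_) (fun l i => ?_) (fun i => ?_)
  · exact congrFun key i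
  · refine squeeze_zero_norm (fun n => (hgle _ i)) ?_
    have h1 := (tendsto_unshift (u := u) hq0 hq1 hH).mul_const ‖x‖
    simpa [w] using h1
  · let L : Matrix (Fin M) (Fin M) ℂ →ₗ[ℂ] ℂ :=
      { toFun := fun N => N.mulVec x i
        map_add' := fun N N' => by simp [Matrix.add_mulVec]
        map_smul' := fun c N => by simp [Matrix.smul_mulVec] }
    have h1 := (summable_act hA hb (1 - l)).hasSum
    have h2 : HasSum (fun j : ℕ => PowerSeries.coeff j (seriesOf A) * w (1 - l - j))
        (w (1 - l - 1) - if 1 - l = 1 then 1 else 0) := by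
      rw [← act_unshift hu hA hS hs hact]
      exact h1
    have h3 := Complex.hasSum_re (h2.mapL L.toContinuousLinearMap)
    have e1 : (1 - l - 1 : ℤ) = -l := by ring
    have e2 : (1 - l = 1) ↔ l = 0 := by omega
    have e3 : ∀ j : ℕ, 1 - l - (j : ℤ) = -(l - 1 + j) := fun j => by ring
    simp only [e1, e2, e3] at h3
    convert h3 using 1
    · ext j
      change _ = (((PowerSeries.coeff j (seriesOf A) * w (-(l - 1 + j))).mulVec x) i).re
      rw [← Matrix.mulVec_mulVec, Matrix.mulVec, dotProduct, Complex.re_sum]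
      refine Finset.sum_congr rfl fun p _ => ?_
      rw [seriesOf, PowerSeries.coeff_mk, Matrix.map_apply, Complex.re_ofReal_mul]
    · change _ = (((w (-l) - if l = 0 then 1 else 0).mulVec x) i).re
      rw [Matrix.sub_mulVec]
      split_ifs <;> simp [g]
  · have h1 : H 0 = w 0 - complexQ u * w 1 := eq_unshift_sub hu hs 0
    have h2 : (w 0).mulVec x = (complexQ u).mulVec ((w 1).mulVec x) := by
      rw [h1, Matrix.sub_mulVec, sub_eq_zero] at hx
      rw [hx, Matrix.mulVec_mulVec]
    simp only [g, neg_zero, h2, neg_neg]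
    rw [Matrix.mulVec, dotProduct, Complex.re_sum]
    refine Finset.sum_congr rfl fun p _ => ?_
    rw [complexQ, Matrix.map_apply, Complex.re_ofReal_mul]
    rfl

/-- `H(0)` annihilates no vector `x ≠ 0`, since the real parts of `x` and of `-i x` vanish. -/
theorem isUnit_central (hAB : IsErgodicMG1 A B) (hu0 : ∀ i, 0 < u i)
    (hu : ∑ i, u i = 1) (hA : rnorm 1 (seriesOf A) ≠ ⊤)
    (hS : rnorm 1 (seriesOf (shifted A u)) ≠ ⊤) (hq0 : 0 ≤ q) (hq1 : q < 1)
    (hH : ∀ k, ‖H k‖ ≤ C * q ^ k.natAbs)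
    (hact : ∀ k, act (seriesOf (shifted A u)) H k = H (k - 1) - if k = 1 then 1 else 0) :
    IsUnit (H 0) := by
  have hre : ∀ {x : Fin M → ℂ}, (H 0).mulVec x = 0 → ∀ i, (x i).re = 0 := fun hx =>
    re_eq_zero_of_mulVec_eq_zero hAB hu0 hu hA hS hq0 hq1 hH hact hx
  rw [← Matrix.mulVec_injective_iff_isUnit]
  intro x y hxy
  have hd : (H 0).mulVec (x - y) = 0 := by
    rw [Matrix.mulVec_sub]
    exact sub_eq_zero.mpr hxy
  have hd' : (H 0).mulVec (-Complex.I • (x - y)) = 0 := by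
    rw [Matrix.mulVec_smul, hd, smul_zero]
  ext i
  have h1 := hre hd i
  have h2 := hre hd' i
  apply Complex.ext
  · simpa [sub_eq_zero] using h1
  · simpa [sub_eq_zero] using h2

end Central

/-! ### The iterates in disks of radius greater than one -/

section Radius

open Filter Topology

theorem pow_convexity {R t : ℝ} (hR : 1 ≤ R) (ht0 : 0 ≤ t) (ht1 : t ≤ 1) (k : ℕ) :
    ((1 - t) + t * R) ^ k ≤ (1 - t) + t * R ^ k := by
  have h := (convexOn_pow k).2 (show (1 : ℝ) ∈ Set.Ici 0 by simp)
    (show R ∈ Set.Ici 0 from (by linarith : (0 : ℝ) ≤ R)) (sub_nonneg.mpr ht1) ht0 (by ring)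
  simpa using h

variable {𝔸 : Type*} [NormedRing 𝔸]

theorem one_le_ofReal {r : ℝ} (hr : 1 ≤ r) : 1 ≤ ENNReal.ofReal r := by simpa using hr

/-- If `‖F‖ ≤ 1/4` in the unit disk and `F` is finite in a larger disk, then `‖F‖ ≤ 1/2` in some
disk of radius greater than one; the radius enters convexly. -/
theorem exists_radius_rnorm_le {F : PowerSeries 𝔸} {R : ℝ} (hR : 1 < R)
    (h1 : rnorm 1 F ≤ 1 / 4) (hF : rnorm (ENNReal.ofReal R) F ≠ ⊤) :
    ∃ r : ℝ, 1 < r ∧ r ≤ R ∧ rnorm (ENNReal.ofReal r) F ≤ 1 / 2 := by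
  obtain ⟨m, hm⟩ : ∃ m, m = (rnorm (ENNReal.ofReal R) F).toReal := ⟨_, rfl⟩
  have hm0 : 0 ≤ m := hm ▸ ENNReal.toReal_nonneg
  obtain ⟨t, ht⟩ : ∃ t, t = 1 / (4 * (m + 1)) := ⟨_, rfl⟩
  have ht0 : 0 < t := by rw [ht]; positivity
  have htm : t * m ≤ 1 / 4 := by
    rw [ht, div_mul_eq_mul_div, div_le_div_iff₀ (by positivity) (by norm_num)]
    linarith
  have ht1 : t ≤ 1 := by
    rw [ht, div_le_one (by positivity)]
    linarith
  refine ⟨(1 - t) + t * R, by nlinarith, by nlinarith, ?_⟩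
  have hle : rnorm (ENNReal.ofReal ((1 - t) + t * R)) F ≤
      rnorm 1 F + ENNReal.ofReal t * rnorm (ENNReal.ofReal R) F := by
    rw [rnorm, rnorm, rnorm, wnorm, wnorm, wnorm, ← ENNReal.tsum_mul_left, ← ENNReal.tsum_add]
    refine ENNReal.tsum_le_tsum fun k => ?_
    have h2 : ENNReal.ofReal ((1 - t) + t * R) ^ k ≤
        1 ^ k + ENNReal.ofReal t * ENNReal.ofReal R ^ k := by
      rw [← ENNReal.ofReal_pow (by nlinarith), one_pow, ← ENNReal.ofReal_pow (by linarith),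
        ← ENNReal.ofReal_mul ht0.le, ← ENNReal.ofReal_one, ← ENNReal.ofReal_add zero_le_one
          (mul_nonneg ht0.le (pow_nonneg (by linarith) k))]
      refine ENNReal.ofReal_le_ofReal ((pow_convexity hR.le ht0.le ht1 k).trans ?_)
      linarith
    refine (mul_le_mul_right h2 _).trans (le_of_eq ?_)
    ring
  have hfour : ENNReal.ofReal (1 / 4) = 1 / 4 := by
    rw [ENNReal.ofReal_div_of_pos (by norm_num)]
    simp
  refine hle.trans ?_
  have h3 : ENNReal.ofReal t * rnorm (ENNReal.ofReal R) F ≤ 1 / 4 := by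
    rw [← ENNReal.ofReal_toReal hF, ← hm, ← ENNReal.ofReal_mul ht0.le, ← hfour]
    exact ENNReal.ofReal_le_ofReal htm
  refine (add_le_add h1 h3).trans (le_of_eq ?_)
  have h4 : (1 : ℝ≥0∞) / 4 + 1 / 4 = ENNReal.ofReal (1 / 2) := by
    rw [← hfour, ← ENNReal.ofReal_add (by norm_num) (by norm_num)]
    norm_num
  rw [h4, ofReal_one_half]

theorem rnorm_X_mul (r : ℝ≥0∞) (S : PowerSeries 𝔸) :
    rnorm r (PowerSeries.X * S) = r * rnorm r S := by
  rw [rnorm, rnorm, wnorm, wnorm, tsum_eq_zero_add' ENNReal.summable, ← ENNReal.tsum_mul_left]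
  simp only [PowerSeries.coeff_zero_X_mul, enorm_zero, zero_mul, zero_add,
    PowerSeries.coeff_succ_X_mul]
  exact tsum_congr fun k => by rw [pow_succ]; ring

theorem rnorm_le_of_coeff_succ {r : ℝ≥0∞} (hr : 1 ≤ r) {S T : PowerSeries 𝔸}
    (h : ∀ k, PowerSeries.coeff k S = PowerSeries.coeff (k + 1) T) : rnorm r S ≤ rnorm r T := by
  refine le_trans (ENNReal.tsum_le_tsum fun k => ?_) (ENNReal.tsum_comp_le_tsum_of_injective
    (add_left_injective 1) fun k => ‖PowerSeries.coeff k T‖ₑ * r ^ k)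
  rw [h]
  exact mul_le_mul_right (pow_le_pow_right₀ hr k.le_succ) _

/-- The truncation of a power series to the coefficients of index less than `m`. -/
noncomputable def cutSeries (m : ℕ) (S : PowerSeries 𝔸) : PowerSeries 𝔸 :=
  PowerSeries.mk fun k => if k < m then PowerSeries.coeff k S else 0

theorem rnorm_cutSeries_ne_top {r : ℝ≥0∞} (hr : r ≠ ⊤) (m : ℕ) (S : PowerSeries 𝔸) :
    rnorm r (cutSeries m S) ≠ ⊤ := by
  refine ne_top_of_le_ne_top (wnorm_cutWeight_ne_top hr m S) (ENNReal.tsum_le_tsum fun k => ?_)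
  rw [cutSeries, PowerSeries.coeff_mk, cutWeight]
  split_ifs <;> simp

theorem exists_rnorm_sub_cutSeries_le {S : PowerSeries 𝔸} (hS : rnorm 1 S ≠ ⊤) {ε : ℝ≥0∞}
    (hε : 0 < ε) : ∃ m, rnorm 1 (S - cutSeries m S) ≤ ε := by
  rw [rnorm_one_eq] at hS
  have h := ENNReal.tendsto_sum_nat_add (fun k => ‖PowerSeries.coeff k S‖ₑ) hS
  obtain ⟨m, hm⟩ := (h.eventually_le_const hε).exists
  refine ⟨m, le_trans (le_of_eq ?_) hm⟩
  rw [rnorm_one_eq, ← ENNReal.summable.sum_add_tsum_nat_add' (k := m)]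
  have h0 : ∑ k ∈ Finset.range m, ‖PowerSeries.coeff k (S - cutSeries m S)‖ₑ = 0 := by
    refine Finset.sum_eq_zero fun k hk => ?_
    rw [map_sub, cutSeries, PowerSeries.coeff_mk, if_pos (Finset.mem_range.mp hk), sub_self,
      enorm_zero]
  rw [h0, zero_add]
  refine tsum_congr fun k => ?_
  rw [map_sub, cutSeries, PowerSeries.coeff_mk, if_neg (by omega), sub_zero]

/-- Inverses in the unit disk of series convergent in a larger disk converge in a larger disk. -/
theorem exists_radius_inverse {U K : PowerSeries 𝔸} {R : ℝ} (hR : 1 < R)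
    (hU : rnorm (ENNReal.ofReal R) U ≠ ⊤) (hK : rnorm 1 K ≠ ⊤) (hKU : K * U = 1)
    (hUK : U * K = 1) : ∃ r : ℝ, 1 < r ∧ r ≤ R ∧ rnorm (ENNReal.ofReal r) K ≠ ⊤ := by
  have hU1 : rnorm 1 U ≠ ⊤ := ne_top_of_le_ne_top hU (rnorm_mono (one_le_ofReal hR.le) U)
  -- a polynomial approximate inverse `T`, with `U T = 1 - F`
  obtain ⟨m, hm⟩ := exists_rnorm_sub_cutSeries_le hK
    (ε := 1 / 4 / (rnorm 1 U + 1)) (ENNReal.div_pos (by simp) (by simpa using hU1))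
  obtain ⟨T, hT⟩ : ∃ T, T = cutSeries m K := ⟨_, rfl⟩
  rw [← hT] at hm
  have hTfin : ∀ r : ℝ, rnorm (ENNReal.ofReal r) T ≠ ⊤ := fun r => by
    rw [hT]; exact rnorm_cutSeries_ne_top ENNReal.ofReal_ne_top m K
  have hF1 : rnorm 1 (U * (K - T)) ≤ 1 / 4 := by
    refine (rnorm_mul_le _ _ _).trans ((mul_le_mul' (le_self_add (b := 1)) hm).trans (le_of_eq ?_))
    rw [mul_comm]
    exact ENNReal.div_mul_cancel (by simp) (by simpa using hU1)
  have hF : U * (K - T) = 1 - U * T := by rw [mul_sub, hUK]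
  have hone : rnorm (ENNReal.ofReal R) (1 : PowerSeries 𝔸) ≠ ⊤ := by
    rw [← map_one (PowerSeries.C (R := 𝔸)), rnorm_C]
    exact enorm_ne_top
  have hFR : rnorm (ENNReal.ofReal R) (U * (K - T)) ≠ ⊤ := by
    rw [hF]
    exact ne_top_of_le_ne_top (ENNReal.add_ne_top.mpr ⟨hone, ne_top_of_le_ne_top
      (ENNReal.mul_ne_top hU (hTfin R)) (rnorm_mul_le _ _ _)⟩) (rnorm_sub_le _ _ _)
  obtain ⟨r, hr1, hrR, hr⟩ := exists_radius_rnorm_le hR hF1 hFR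
  refine ⟨r, hr1, hrR, ne_top_of_le_ne_top (ENNReal.mul_ne_top (by simp) (hTfin r))
    (rnorm_le_of_eq_add_mul' ENNReal.ofReal_ne_top hr ?_)⟩
  rw [← mul_assoc, hKU, one_mul, add_sub_cancel]

variable {M : ℕ}

open scoped Matrix.Norms.Operator

theorem rnorm_sq_evenPart_le (r : ℝ≥0∞) (S : MSeries M) :
    rnorm (r ^ 2) (evenPart S) ≤ rnorm r S := by
  rw [rnorm, rnorm, wnorm, wnorm,
    ← tsum_even_add_tsum_odd fun k => ‖PowerSeries.coeff k S‖ₑ * r ^ k]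
  refine le_trans (le_of_eq (tsum_congr fun k => ?_)) le_self_add
  rw [evenPart, PowerSeries.coeff_mk, pow_mul]

theorem mul_rnorm_sq_oddPart_le (r : ℝ≥0∞) (S : MSeries M) :
    r * rnorm (r ^ 2) (oddPart S) ≤ rnorm r S := by
  rw [rnorm, rnorm, wnorm, wnorm,
    ← tsum_even_add_tsum_odd fun k => ‖PowerSeries.coeff k S‖ₑ * r ^ k, ← ENNReal.tsum_mul_left]
  refine le_trans (le_of_eq (tsum_congr fun k => ?_)) le_add_self
  rw [oddPart, PowerSeries.coeff_mk, ← pow_mul, pow_succ r (2 * k)]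
  ring

theorem rnorm_sq_oddPart_le {r : ℝ≥0∞} (hr : 1 ≤ r) (S : MSeries M) :
    rnorm (r ^ 2) (oddPart S) ≤ rnorm r S :=
  (le_mul_of_one_le_left' hr).trans (mul_rnorm_sq_oddPart_le r S)

theorem rnorm_le_sq {r : ℝ≥0∞} (hr : 1 ≤ r) (S : MSeries M) : rnorm r S ≤ rnorm (r ^ 2) S :=
  rnorm_mono (by rw [pow_two]; exact le_mul_of_one_le_left' hr) S

theorem rnorm_evenPart_le {r : ℝ≥0∞} (hr : 1 ≤ r) (S : MSeries M) :
    rnorm r (evenPart S) ≤ rnorm r S := (rnorm_le_sq hr _).trans (rnorm_sq_evenPart_le r S)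

theorem rnorm_oddPart_le {r : ℝ≥0∞} (hr : 1 ≤ r) (S : MSeries M) :
    rnorm r (oddPart S) ≤ rnorm r S := (rnorm_le_sq hr _).trans (rnorm_sq_oddPart_le hr S)

theorem rnorm_add_ne_top {r : ℝ≥0∞} {S T : MSeries M} (hS : rnorm r S ≠ ⊤)
    (hT : rnorm r T ≠ ⊤) : rnorm r (S + T) ≠ ⊤ :=
  ne_top_of_le_ne_top (ENNReal.add_ne_top.mpr ⟨hS, hT⟩) (rnorm_add_le r S T)

theorem rnorm_mul_ne_top {r : ℝ≥0∞} {S T : MSeries M} (hS : rnorm r S ≠ ⊤)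
    (hT : rnorm r T ≠ ⊤) : rnorm r (S * T) ≠ ⊤ :=
  ne_top_of_le_ne_top (ENNReal.mul_ne_top hS hT) (rnorm_mul_le r S T)

variable {form : HatForm} {A : ℕ → Matrix (Fin M) (Fin M) ℝ} {u : Fin M → ℝ}

theorem exactSeq_zero_fst : (exactSeq form A u 0).1 = seriesOf (shifted A u) := rfl

/-- Every iterate converges in some disk of radius greater than one. -/
theorem exists_radius_exactSeq {R : ℝ} (hR : 1 < R)
    (hs : Summable fun k => ‖PowerSeries.coeff k (seriesOf (shifted A u))‖ * R ^ k)
    (hCR : NoBreakdown form A u) (n : ℕ) :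
    ∃ r : ℝ, 1 < r ∧ rnorm (ENNReal.ofReal r) (exactSeq form A u n).1 ≠ ⊤ ∧
      rnorm (ENNReal.ofReal r) (exactSeq form A u n).2 ≠ ⊤ := by
  induction n with
  | zero =>
    have h1 : rnorm (ENNReal.ofReal R) (exactSeq form A u 0).1 ≠ ⊤ := by
      rw [exactSeq_zero_fst, rnorm, wnorm]
      have h2 : ∀ k, ‖PowerSeries.coeff k (seriesOf (shifted A u))‖ₑ * ENNReal.ofReal R ^ k =
          ENNReal.ofReal (‖PowerSeries.coeff k (seriesOf (shifted A u))‖ * R ^ k) := fun k => by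
        rw [ENNReal.ofReal_mul (norm_nonneg _), ofReal_norm, ENNReal.ofReal_pow (by linarith)]
      simp_rw [h2]
      exact hs.tsum_ofReal_ne_top
    refine ⟨R, hR, h1, ne_top_of_le_ne_top h1
      (rnorm_le_of_coeff_succ (one_le_ofReal hR.le) fun k => ?_)⟩
    simp only [exactSeq, initialPair, PowerSeries.coeff_mk]
  | succ n ih =>
    obtain ⟨r, hr, h1, h2⟩ := ih
    obtain ⟨hunit, hK⟩ := hCR n
    set p := exactSeq form A u n with hp
    have hone : rnorm (ENNReal.ofReal r) (1 : MSeries M) ≠ ⊤ := by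
      rw [← map_one (PowerSeries.C (R := Matrix (Fin M) (Fin M) ℂ)), rnorm_C]
      exact enorm_ne_top
    have hr' := one_le_ofReal hr.le
    obtain ⟨s, hs1, hsr, hs⟩ := exists_radius_inverse hr
      (ne_top_of_le_ne_top (ENNReal.add_ne_top.mpr ⟨hone,
        ne_top_of_le_ne_top h1 (rnorm_oddPart_le hr' p.1)⟩) (rnorm_sub_le _ 1 (oddPart p.1)))
      ((starNorm_ne_top_iff _).mp hK) (kernelInv_mul hunit) (mul_kernelInv hunit)
    have hs' := one_le_ofReal hs1.le
    have h1' := ne_top_of_le_ne_top h1 (rnorm_mono (ENNReal.ofReal_le_ofReal hsr) p.1)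
    have h2' := ne_top_of_le_ne_top h2 (rnorm_mono (ENNReal.ofReal_le_ofReal hsr) p.2)
    have e1 := ne_top_of_le_ne_top h1' (rnorm_evenPart_le hs' p.1)
    have o1 := ne_top_of_le_ne_top h1' (rnorm_oddPart_le hs' p.1)
    have e2 := ne_top_of_le_ne_top h2' (rnorm_evenPart_le hs' p.2)
    have o2 := ne_top_of_le_ne_top h2' (rnorm_oddPart_le hs' p.2)
    refine ⟨s, hs1, ?_, ?_⟩
    · refine rnorm_add_ne_top ?_ (rnorm_mul_ne_top (rnorm_mul_ne_top e1 hs) e1)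
      rw [rnorm_X_mul]
      exact ENNReal.mul_ne_top ENNReal.ofReal_ne_top o1
    · cases form with
      | schur => exact rnorm_add_ne_top e2 (rnorm_mul_ne_top (rnorm_mul_ne_top o2 hs) e1)
      | mirrored => exact rnorm_add_ne_top o2 (rnorm_mul_ne_top (rnorm_mul_ne_top e1 hs) e2)

/-- Cyclic reduction samples the Laurent coefficients of the inverse symbol at the multiples
of `2ⁿ`. -/
theorem act_exactSeq (hCR : NoBreakdown form A u)
    (hfin : ∀ n, rnorm 1 (exactSeq form A u n).1 ≠ ⊤) {H : ℤ → Matrix (Fin M) (Fin M) ℂ} {b : ℝ}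
    (hH : ∀ k, ‖H k‖ ≤ b)
    (hact : ∀ k, act (seriesOf (shifted A u)) H k = H (k - 1) - if k = 1 then 1 else 0)
    (n : ℕ) (k : ℤ) :
    act (exactSeq form A u n).1 (fun k => H (2 ^ n * k)) k =
      H (2 ^ n * (k - 1)) - if k = 1 then 1 else 0 := by
  induction n generalizing k with
  | zero => simpa [exactSeq_zero_fst] using hact k
  | succ n ih =>
    have h := act_cyclicReduction (φ := (exactSeq form A u n).1)
      (a := evenPart (exactSeq form A u n).1) (b := oddPart (exactSeq form A u n).1)
      (K := kernelInv (exactSeq form A u n).1) (H := fun k => H (2 ^ n * k)) (B := b) (hfin n)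
      (ne_top_of_le_ne_top (hfin n) (rnorm_evenPart_le le_rfl _))
      (ne_top_of_le_ne_top (hfin n) (rnorm_oddPart_le le_rfl _))
      ((starNorm_ne_top_iff _).mp (hCR n).2) (fun k => by rw [evenPart, PowerSeries.coeff_mk])
      (fun k => by rw [oddPart, PowerSeries.coeff_mk]) (kernelInv_mul (hCR n).1)
      (fun k => hH _) ih k
    have e : ∀ k : ℤ, (2 : ℤ) ^ (n + 1) * k = 2 ^ n * (2 * k) := fun k => by ring
    simp only [e]
    exact h

end Radius

/-! ### The iterates as perturbations of a linear polynomial -/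

section Stage

variable {𝔸 : Type*} [NormedRing 𝔸]

theorem min_pow_le {r : ℝ≥0∞} (hr : 1 ≤ r) (L : ℝ≥0∞) (k j : ℕ) :
    min (r ^ k) L ≤ min (r ^ j) L * r ^ ((k : ℤ) - j).natAbs := by
  have h1 : r ^ k ≤ r ^ j * r ^ ((k : ℤ) - j).natAbs := by
    rw [← pow_add]
    exact pow_le_pow_right₀ hr (by omega)
  have h2 : L ≤ L * r ^ ((k : ℤ) - j).natAbs := le_mul_of_one_le_right' (one_le_pow₀ hr)
  rcases le_total (r ^ j) L with h | h
  · rw [min_eq_left h]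
    exact (min_le_left _ _).trans h1
  · rw [min_eq_right h]
    exact (min_le_right _ _).trans h2

theorem rnorm_le_of_min {r c : ℝ≥0∞} (hr1 : 1 ≤ r) (hr : r ≠ ⊤) {S : PowerSeries 𝔸}
    (h : ∀ L : ℝ≥0∞, L ≠ ⊤ → wnorm (fun k => min (r ^ k) L) S ≤ c) : rnorm r S ≤ c := by
  refine ENNReal.tsum_le_of_sum_range_le fun m => ?_
  refine le_trans (le_of_eq_of_le (Finset.sum_congr rfl fun k hk => ?_)
    (ENNReal.sum_le_tsum (Finset.range m))) (h (r ^ m) (ENNReal.pow_ne_top hr))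
  simp only
  rw [min_eq_left (pow_le_pow_right₀ hr1 (Finset.mem_range.mp hk).le)]

/-- The weighted `ℓ¹` norm of a two-sided sequence without its central entry. -/
noncomputable def offNorm (r : ℝ≥0∞) (h : ℤ → 𝔸) : ℝ≥0∞ :=
  ∑' m : ℤ, r ^ m.natAbs * ‖if m = 0 then 0 else h m‖ₑ

theorem coeff_X_mul_C (a : 𝔸) (k : ℕ) :
    PowerSeries.coeff k (PowerSeries.X * PowerSeries.C a) = if k = 1 then a else 0 := by
  cases k with
  | zero => simp
  | succ k => rw [PowerSeries.coeff_succ_X_mul, PowerSeries.coeff_C]; simp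

/-- The weighted norm of a sequence sampled from one that decays exponentially. -/
theorem mul_offNorm_le {h : ℤ → 𝔸} {C p x y : ℝ} (hC : 0 ≤ C) (hp1 : p < 1)
    (hx0 : 0 < x) (hxp : x ≤ p) (hy1 : 1 ≤ y) (hyx : y ≤ x⁻¹)
    (hh : ∀ m, ‖h m‖ ≤ C * (x ^ 4) ^ m.natAbs) :
    ENNReal.ofReal y * offNorm (ENNReal.ofReal y) h ≤
      ENNReal.ofReal ((C * ∑' m : ℤ, p ^ m.natAbs) * x) := by
  have hp0 : 0 < p := hx0.trans_le hxp
  have hs := summable_pow_natAbs hp0.le hp1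
  have hxy : x * y ≤ 1 := by
    have := mul_le_mul_of_nonneg_left hyx hx0.le
    rwa [mul_inv_cancel₀ hx0.ne'] at this
  have hx1 : x ≤ 1 := hxp.trans hp1.le
  have hy0 : 0 ≤ y := by linarith
  have hr : (C * ∑' m : ℤ, p ^ m.natAbs) * x = ∑' m : ℤ, C * x * p ^ m.natAbs := by
    rw [tsum_mul_left]
    ring
  rw [hr, ENNReal.ofReal_tsum_of_nonneg (fun m => by positivity) (hs.mul_left _), offNorm,
    ← ENNReal.tsum_mul_left]
  refine ENNReal.tsum_le_tsum fun m => ?_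
  split_ifs with hm
  · simp
  · obtain ⟨k, hk⟩ : ∃ k, m.natAbs = k + 1 := ⟨m.natAbs - 1, by omega⟩
    have h1 := hh m
    rw [hk] at h1 ⊢
    rw [← ofReal_norm, ← ENNReal.ofReal_pow hy0, ← ENNReal.ofReal_mul (by positivity),
      ← ENNReal.ofReal_mul hy0]
    refine ENNReal.ofReal_le_ofReal ?_
    calc y * (y ^ (k + 1) * ‖h m‖) ≤ y * (y ^ (k + 1) * (C * (x ^ 4) ^ (k + 1))) := by gcongr
      _ = C * x * x ^ (k + 1) * ((x * y) ^ (k + 2) * x ^ (2 * k)) := by ring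
      _ ≤ C * x * p ^ (k + 1) * (1 * 1) := by
          gcongr
          · exact pow_le_one₀ (by positivity) hxy
          · exact pow_le_one₀ hx0.le hx1
      _ = C * x * p ^ (k + 1) := by ring

variable [CompleteSpace 𝔸]

/-- If `∑ h(k) zᵏ` inverts `I - z⁻¹ φ(z)` and `h` is nearly concentrated at `0`, then `φ(z)` is
close to `z (1 - h(0)⁻¹)`, in the disk of radius `r`. The bootstrap runs in the weights
`min (rᵏ, L)`, for which finiteness in the unit disk is enough. -/
theorem rnorm_sub_le_of_act {φ : PowerSeries 𝔸} {h : ℤ → 𝔸} {G : 𝔸} {B : ℝ} {r : ℝ≥0∞}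
    (hr1 : 1 ≤ r) (hr : r ≠ ⊤) (hφ : rnorm 1 φ ≠ ⊤) (hh : ∀ k, ‖h k‖ ≤ B) (hG : h 0 * G = 1)
    (hact : ∀ k, act φ h k = h (k - 1) - if k = 1 then 1 else 0)
    (hd : ‖G‖ₑ * offNorm r h ≤ 1 / 2) :
    rnorm r (φ - PowerSeries.X * PowerSeries.C (1 - G)) ≤
      2 * (‖G‖ₑ * (1 + ‖1 - G‖ₑ) * (r * offNorm r h)) := by
  obtain ⟨D, hD⟩ : ∃ D : ℤ → 𝔸, D = fun m => if m = 0 then 0 else h m := ⟨_, rfl⟩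
  obtain ⟨d, hdd⟩ : ∃ d, d = offNorm r h := ⟨_, rfl⟩
  have hdD : d = ∑' m : ℤ, r ^ m.natAbs * ‖D m‖ₑ := by rw [hdd, hD, offNorm]
  rw [← hdd] at hd ⊢
  have hB : 0 ≤ B := (norm_nonneg _).trans (hh 0)
  have hDB : ∀ k, ‖D k‖ ≤ B := fun k => by
    rw [hD]
    simp only
    split_ifs
    · simpa using hB
    · exact hh k
  have hcoef : ∀ k : ℕ, PowerSeries.coeff k (φ - PowerSeries.X * PowerSeries.C (1 - G)) =
      (D ((k : ℤ) - 1) - act φ D k) * G := by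
    intro k
    have h1 : PowerSeries.coeff k φ * h 0 = act φ h k - act φ D k := by
      rw [← act_sub_right hφ hh hDB, act, tsum_eq_single k fun j hj => ?_]
      · simp [hD]
      · have : (k : ℤ) - j ≠ 0 := by omega
        simp [hD, this]
    have h2 : PowerSeries.coeff k φ = (act φ h k - act φ D k) * G := by
      rw [← h1, mul_assoc, hG, mul_one]
    rw [map_sub, coeff_X_mul_C, h2, hact]
    by_cases hk : k = 1
    · subst hk
      simp only [Nat.cast_one, sub_self, if_true, sub_mul, hG, one_mul, hD, zero_mul]
      abel
    · have h3 : ¬ (k : ℤ) = 1 := by omega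
      have h4 : ¬ (k : ℤ) - 1 = 0 := by omega
      simp [hk, h3, h4, hD]
  refine rnorm_le_of_min hr1 hr fun L hL => ?_
  set ω : ℕ → ℝ≥0∞ := fun k => min (r ^ k) L with hω
  set Δ := φ - PowerSeries.X * PowerSeries.C (1 - G) with hΔ
  have hsum1 : ∑' k : ℕ, ω k * ‖D ((k : ℤ) - 1)‖ₑ ≤ r * d := by
    rw [hdD, ← ENNReal.tsum_mul_left]
    refine le_trans (ENNReal.tsum_le_tsum fun k => ?_) (ENNReal.tsum_comp_le_tsum_of_injective
      (f := fun k : ℕ => (k : ℤ) - 1) (fun a b hab => by simpa using hab)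
      fun m => r * (r ^ m.natAbs * ‖D m‖ₑ))
    rw [← mul_assoc]
    refine mul_le_mul_left ?_ _
    have h1 := min_pow_le hr1 L k 1
    rw [pow_one, Nat.cast_one] at h1
    exact h1.trans (mul_le_mul_left (min_le_left _ _) _)
  have hsum2 : ∑' k : ℕ, ω k * ‖act φ D k‖ₑ ≤ wnorm ω φ * d := by
    calc ∑' k : ℕ, ω k * ‖act φ D k‖ₑ
        ≤ ∑' k : ℕ, ∑' j : ℕ, ‖PowerSeries.coeff j φ‖ₑ * ω j *
            (r ^ ((k : ℤ) - j).natAbs * ‖D ((k : ℤ) - j)‖ₑ) := by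
          refine ENNReal.tsum_le_tsum fun k => ?_
          refine (mul_le_mul_right enorm_tsum_le_tsum_enorm _).trans ?_
          rw [← ENNReal.tsum_mul_left]
          refine ENNReal.tsum_le_tsum fun j => ?_
          calc _ ≤ (ω j * r ^ ((k : ℤ) - j).natAbs) *
                (‖PowerSeries.coeff j φ‖ₑ * ‖D ((k : ℤ) - j)‖ₑ) :=
                mul_le_mul' (min_pow_le hr1 L k j) (enorm_mul_le_mul _ _)
            _ = _ := by ring
      _ = ∑' j : ℕ, ‖PowerSeries.coeff j φ‖ₑ * ω j *
            ∑' k : ℕ, r ^ ((k : ℤ) - j).natAbs * ‖D ((k : ℤ) - j)‖ₑ := by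
          rw [ENNReal.tsum_comm]
          exact tsum_congr fun j => ENNReal.tsum_mul_left
      _ ≤ ∑' j : ℕ, ‖PowerSeries.coeff j φ‖ₑ * ω j * d := by
          refine ENNReal.tsum_le_tsum fun j => mul_le_mul_right ?_ _
          rw [hdD]
          exact ENNReal.tsum_comp_le_tsum_of_injective (f := fun k : ℕ => (k : ℤ) - j)
            (fun a b hab => by simpa using hab) fun m => r ^ m.natAbs * ‖D m‖ₑ
      _ = wnorm ω φ * d := ENNReal.tsum_mul_right
  have hΔle : wnorm ω Δ ≤ ‖G‖ₑ * (r * d + wnorm ω φ * d) := by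
    refine le_trans ?_ (mul_le_mul_right (add_le_add hsum1 hsum2) _)
    rw [← ENNReal.tsum_add, ← ENNReal.tsum_mul_left]
    refine ENNReal.tsum_le_tsum fun k => ?_
    rw [hcoef]
    calc _ ≤ (‖D ((k : ℤ) - 1)‖ₑ + ‖act φ D k‖ₑ) * ‖G‖ₑ * ω k :=
          mul_le_mul_left ((enorm_mul_le_mul _ _).trans (mul_le_mul_left enorm_sub_le _)) _
      _ = _ := by ring
  have hXC : wnorm ω (PowerSeries.X * PowerSeries.C (1 - G)) ≤ r * ‖1 - G‖ₑ := by
    refine (wnorm_mono (fun k => min_le_left _ _) _).trans (le_of_eq ?_)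
    rw [← rnorm_C r, ← rnorm_X_mul, rnorm]
  have hφle : wnorm ω φ ≤ r * ‖1 - G‖ₑ + wnorm ω Δ := by
    have h1 : φ = PowerSeries.X * PowerSeries.C (1 - G) + Δ := by rw [hΔ]; abel
    calc wnorm ω φ = wnorm ω (PowerSeries.X * PowerSeries.C (1 - G) + Δ) := by rw [← h1]
      _ ≤ _ := (wnorm_add_le _ _ _).trans (add_le_add hXC le_rfl)
  have hφfin : wnorm ω φ ≠ ⊤ := by
    refine ne_top_of_le_ne_top (ENNReal.mul_ne_top hφ hL) ?_
    rw [rnorm_one_eq, ← ENNReal.tsum_mul_right]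
    exact ENNReal.tsum_le_tsum fun k => mul_le_mul_right (min_le_right _ _) _
  have hΔfin : wnorm ω Δ ≠ ⊤ := by
    rcases eq_or_ne ‖G‖ₑ 0 with h0 | h0
    · rw [h0, zero_mul] at hΔle
      exact ne_top_of_le_ne_top ENNReal.zero_ne_top hΔle
    · have hdfin : d ≠ ⊤ := by
        rintro rfl
        rw [ENNReal.mul_top h0] at hd
        simp at hd
      exact ne_top_of_le_ne_top (ENNReal.mul_ne_top enorm_ne_top (ENNReal.add_ne_top.mpr
        ⟨ENNReal.mul_ne_top hr hdfin, ENNReal.mul_ne_top hφfin hdfin⟩)) hΔle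
  refine le_two_mul_of_le_add_mul hΔfin hd (hΔle.trans ?_)
  calc ‖G‖ₑ * (r * d + wnorm ω φ * d)
      ≤ ‖G‖ₑ * (r * d + (r * ‖1 - G‖ₑ + wnorm ω Δ) * d) := by gcongr
    _ = _ := by ring

end Stage

section Factors

open scoped Matrix.Norms.Operator

variable {M : ℕ}

theorem evenPart_sub_linear (p : MSeries M) (a : Matrix (Fin M) (Fin M) ℂ) :
    evenPart (p - PowerSeries.X * PowerSeries.C a) = evenPart p := by
  ext1 k
  rw [evenPart, evenPart, PowerSeries.coeff_mk, PowerSeries.coeff_mk, map_sub, coeff_X_mul_C,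
    if_neg (by omega), sub_zero]

theorem oddPart_sub_linear (p : MSeries M) (a : Matrix (Fin M) (Fin M) ℂ) :
    oddPart (p - PowerSeries.X * PowerSeries.C a) = oddPart p - PowerSeries.C a := by
  ext1 k
  rw [oddPart, oddPart, PowerSeries.coeff_mk, map_sub, map_sub, coeff_X_mul_C,
    PowerSeries.coeff_mk, PowerSeries.coeff_C]
  cases k <;> simp

/-- If `φ` is within `η` of `z (I - G)`, then `φ_even` is of size `η` and `(I - φ_odd)⁻¹` is
bounded by twice `G⁻¹`, in the disk of radius `r²`. -/
theorem rnorm_factors_le {p : MSeries M} {G H₀ : Matrix (Fin M) (Fin M) ℂ} {r η : ℝ≥0∞}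
    (hr1 : 1 ≤ r) (hr : r ≠ ⊤) (hG : G * H₀ = 1) (hunit : IsUnit (1 - oddPart p))
    (hp : rnorm r (p - PowerSeries.X * PowerSeries.C (1 - G)) ≤ η) (hη : ‖H₀‖ₑ * η ≤ 1 / 2) :
    rnorm (r ^ 2) (evenPart p) ≤ η ∧ rnorm (r ^ 2) (kernelInv p) ≤ 2 * ‖H₀‖ₑ := by
  constructor
  · rw [← evenPart_sub_linear p (1 - G)]
    exact (rnorm_sq_evenPart_le r _).trans hp
  · obtain ⟨o, ho⟩ : ∃ o, o = oddPart (p - PowerSeries.X * PowerSeries.C (1 - G)) := ⟨_, rfl⟩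
    have hole : rnorm (r ^ 2) o ≤ η := by
      rw [ho]
      exact (rnorm_sq_oddPart_le hr1 _).trans hp
    have h1 : 1 - oddPart p = PowerSeries.C G - o := by
      rw [ho, oddPart_sub_linear, map_sub, map_one]
      abel
    have h2 : kernelInv p * PowerSeries.C G = 1 + kernelInv p * o := by
      have h := kernelInv_mul hunit
      rwa [h1, mul_sub, sub_eq_iff_eq_add] at h
    have h3 : kernelInv p = PowerSeries.C H₀ + kernelInv p * (o * PowerSeries.C H₀) := by
      have h := congrArg (· * PowerSeries.C H₀) h2
      simp only [mul_assoc, add_mul, one_mul] at h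
      rwa [← map_mul, hG, map_one, mul_one] at h
    rw [← rnorm_C (r ^ 2) H₀]
    refine rnorm_le_of_eq_add_mul' (ENNReal.pow_ne_top hr) ?_ h3
    refine (rnorm_mul_le _ _ _).trans ?_
    rw [rnorm_C, mul_comm]
    exact (mul_le_mul_right hole _).trans hη

end Factors

/-! ### Double exponential decay of the factors -/

section Rate

open Filter Topology
open scoped Matrix.Norms.Operator

variable {M : ℕ}

/-- The growth of `φ̂` in disks whose radius is squared at each step: the norm at most doubles. -/
theorem rnorm_hat_step (form : HatForm) {p : MSeries M × MSeries M} {r η κ m : ℝ≥0∞}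
    (hr1 : 1 ≤ r) (ha : rnorm (r ^ 2) (evenPart p.1) ≤ η)
    (hK : rnorm (r ^ 2) (kernelInv p.1) ≤ 2 * κ) (hη : κ * η ≤ 1 / 2)
    (hm : rnorm r p.2 ≤ m) : rnorm (r ^ 2) (crStep form p).2 ≤ 2 * m := by
  have hone : 2 * κ * η ≤ 1 := by
    calc 2 * κ * η = 2 * (κ * η) := by ring
      _ ≤ 2 * (1 / 2) := by gcongr
      _ = 1 := by simp [ENNReal.mul_inv_cancel]
  have he := (rnorm_sq_evenPart_le r p.2).trans hm
  have ho := (rnorm_sq_oddPart_le hr1 p.2).trans hm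
  cases form with
  | schur =>
    calc rnorm (r ^ 2) (evenPart p.2 + oddPart p.2 * kernelInv p.1 * evenPart p.1)
        ≤ m + m * (2 * κ) * η := (rnorm_add_le _ _ _).trans (add_le_add he
          ((rnorm_mul_le _ _ _).trans (mul_le_mul' ((rnorm_mul_le _ _ _).trans
            (mul_le_mul' ho hK)) ha)))
      _ = m + m * (2 * κ * η) := by ring
      _ ≤ m + m * 1 := by gcongr
      _ = _ := by ring
  | mirrored =>
    calc rnorm (r ^ 2) (oddPart p.2 + evenPart p.1 * kernelInv p.1 * evenPart p.2)
        ≤ m + η * (2 * κ) * m := (rnorm_add_le _ _ _).trans (add_le_add ho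
          ((rnorm_mul_le _ _ _).trans (mul_le_mul' ((rnorm_mul_le _ _ _).trans
            (mul_le_mul' ha hK)) he)))
      _ = m + 2 * κ * η * m := by ring
      _ ≤ m + 1 * m := by gcongr
      _ = _ := by ring

/-- The factor formed with `φ̂` after a step from `p` to `p' = 𝒯(p)`. In the Schur complement form
the odd part of `φ̂'` gains the inverse radius; in the mirrored form `φ̂'` itself is small. -/
theorem rnorm_seriesHat_crStep_le (form : HatForm) {p : MSeries M × MSeries M}
    {r η κ m : ℝ≥0∞} (hr1 : 1 ≤ r) (hr : r ≠ ⊤) (ha : rnorm (r ^ 2) (evenPart p.1) ≤ η)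
    (hK : rnorm (r ^ 2) (kernelInv p.1) ≤ 2 * κ) (hη : κ * η ≤ 1 / 2) (hm : rnorm r p.2 ≤ m)
    (hK' : rnorm (r ^ 2) (kernelInv (crStep form p).1) ≤ 2 * κ) :
    rnorm 1 (seriesHat form (crStep form p)) ≤ 4 * κ * (r⁻¹ + κ * η) * m := by
  have hr0 : r ≠ 0 := (zero_lt_one.trans_le hr1).ne'
  have hdiv : ∀ {a b : ℝ≥0∞}, r * a ≤ b → a ≤ r⁻¹ * b := fun {a b} h => by
    calc a = r⁻¹ * (r * a) := by rw [← mul_assoc, ENNReal.inv_mul_cancel hr0 hr, one_mul]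
      _ ≤ _ := by gcongr
  have h1r2 : (1 : ℝ≥0∞) ≤ r ^ 2 := one_le_pow₀ hr1
  have hstep := rnorm_hat_step form hr1 ha hK hη hm
  cases form with
  | schur =>
    -- the odd part is taken with respect to the radius `r`, of which `φ̂'` has the square
    have h1 : rnorm (r ^ 2) (oddPart (crStep .schur p).2) ≤ r⁻¹ * (2 * m) := by
      refine hdiv ((mul_rnorm_sq_oddPart_le r _).trans ((rnorm_le_sq hr1 _).trans hstep))
    calc rnorm 1 (oddPart (crStep .schur p).2 * kernelInv (crStep .schur p).1)
        ≤ rnorm (r ^ 2) (oddPart (crStep .schur p).2 * kernelInv (crStep .schur p).1) :=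
          rnorm_mono h1r2 _
      _ ≤ r⁻¹ * (2 * m) * (2 * κ) := (rnorm_mul_le _ _ _).trans (mul_le_mul' h1 hK')
      _ = 4 * κ * (r⁻¹ + 0) * m := by ring
      _ ≤ _ := by gcongr; exact zero_le
  | mirrored =>
    have ho : rnorm (r ^ 2) (oddPart p.2) ≤ r⁻¹ * m :=
      hdiv ((mul_rnorm_sq_oddPart_le r p.2).trans hm)
    have h1 : rnorm (r ^ 2) (crStep .mirrored p).2 ≤ r⁻¹ * m + η * (2 * κ) * m :=
      (rnorm_add_le _ _ _).trans (add_le_add ho ((rnorm_mul_le _ _ _).trans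
        (mul_le_mul' ((rnorm_mul_le _ _ _).trans (mul_le_mul' ha hK))
          ((rnorm_sq_evenPart_le r p.2).trans hm))))
    calc rnorm 1 (kernelInv (crStep .mirrored p).1 * evenPart (crStep .mirrored p).2)
        ≤ rnorm (r ^ 2) (kernelInv (crStep .mirrored p).1 * evenPart (crStep .mirrored p).2) :=
          rnorm_mono h1r2 _
      _ ≤ 2 * κ * (r⁻¹ * m + η * (2 * κ) * m) := (rnorm_mul_le _ _ _).trans
          (mul_le_mul' hK' ((rnorm_evenPart_le h1r2 _).trans h1))
      _ = 2 * κ * r⁻¹ * m + 4 * κ * (κ * η) * m := by ring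
      _ ≤ 4 * κ * r⁻¹ * m + 4 * κ * (κ * η) * m := by gcongr; norm_num
      _ = _ := by ring

/-- The factor `2ⁿ` is absorbed by a larger base, and the finitely many terms before `n₀` by a
larger constant. -/
theorem exists_double_exponential_bound {X : ℕ → ℝ≥0∞} (hX : ∀ n, X n ≠ ⊤) {c s : ℝ}
    (hc : 0 ≤ c) (hs0 : 0 < s) (hs1 : s < 1) {n₀ : ℕ}
    (h : ∀ n, n₀ ≤ n → X n ≤ ENNReal.ofReal (c * 2 ^ n * s ^ 2 ^ n)) :
    ∃ θ σ : ℝ, 0 < θ ∧ 0 < σ ∧ σ < 1 ∧ ∀ n, X n ≤ ENNReal.ofReal (θ * σ ^ 2 ^ n) := by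
  obtain ⟨σ, hσ⟩ : ∃ σ, σ = √s := ⟨_, rfl⟩
  have hσ0 : 0 < σ := hσ ▸ Real.sqrt_pos.mpr hs0
  have hσs : σ ^ 2 = s := by rw [hσ, Real.sq_sqrt hs0.le]
  have hσ1 : σ < 1 := by
    by_contra! hcon
    have := one_le_pow₀ hcon (n := 2)
    linarith
  have hlin : ∀ m : ℕ, m * σ ^ m ≤ (1 - σ)⁻¹ := by
    intro m
    calc (m : ℝ) * σ ^ m = ∑ _i ∈ Finset.range m, σ ^ m := by simp
      _ ≤ ∑ i ∈ Finset.range m, σ ^ i := Finset.sum_le_sum fun i hi =>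
          pow_le_pow_of_le_one hσ0.le hσ1.le (Finset.mem_range.mp hi).le
      _ ≤ ∑' i, σ ^ i := (summable_geometric_of_lt_one hσ0.le hσ1).sum_le_tsum _
          fun i _ => by positivity
      _ = _ := tsum_geometric_of_lt_one hσ0.le hσ1
  have hinv : 0 < (1 - σ)⁻¹ := inv_pos.mpr (by linarith)
  have hterm : ∀ k, 0 ≤ (X k).toReal / σ ^ 2 ^ k := fun k =>
    div_nonneg ENNReal.toReal_nonneg (by positivity)
  have hsum0 : 0 ≤ ∑ k ∈ Finset.range n₀, (X k).toReal / σ ^ 2 ^ k :=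
    Finset.sum_nonneg fun k _ => hterm k
  refine ⟨c * (1 - σ)⁻¹ + ∑ k ∈ Finset.range n₀, (X k).toReal / σ ^ 2 ^ k + 1, σ,
    by positivity, hσ0, hσ1, fun n => ?_⟩
  have hσn : 0 < σ ^ 2 ^ n := by positivity
  rcases lt_or_ge n n₀ with hn | hn
  · rw [ENNReal.le_ofReal_iff_toReal_le (hX n) (by positivity), ← div_le_iff₀ hσn]
    have h1 : (X n).toReal / σ ^ 2 ^ n ≤ ∑ k ∈ Finset.range n₀, (X k).toReal / σ ^ 2 ^ k :=
      Finset.single_le_sum (f := fun k => (X k).toReal / σ ^ 2 ^ k)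
        (fun k _ => hterm k) (Finset.mem_range.mpr hn)
    have h2 : 0 ≤ c * (1 - σ)⁻¹ := by positivity
    linarith
  · refine (h n hn).trans (ENNReal.ofReal_le_ofReal ?_)
    have h1 := hlin (2 ^ n)
    push_cast at h1
    calc c * 2 ^ n * s ^ 2 ^ n = c * (2 ^ n * σ ^ 2 ^ n) * σ ^ 2 ^ n := by
          rw [← hσs, ← pow_mul, mul_comm 2, pow_mul]
          ring
      _ ≤ c * (1 - σ)⁻¹ * σ ^ 2 ^ n := by gcongr
      _ ≤ _ := by
          refine mul_le_mul_of_nonneg_right ?_ hσn.le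
          linarith

theorem exists_near_one {p ρ : ℝ} (hp0 : 0 < p) (hp1 : p < 1) (hρ : 1 < ρ) (N : ℕ) :
    ∃ τ : ℝ, p ≤ τ ∧ τ < 1 ∧ (τ ^ N)⁻¹ ≤ ρ := by
  have hρi : ρ⁻¹ < 1 := inv_lt_one_of_one_lt₀ hρ
  have hρ0 : 0 < ρ⁻¹ := inv_pos.mpr (by linarith)
  obtain ⟨ε, hε⟩ : ∃ ε, ε = (1 - ρ⁻¹) / (N + 1) := ⟨_, rfl⟩
  have hε0 : 0 < ε := by rw [hε]; exact div_pos (by linarith) (by positivity)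
  have hε1 : ε * (N + 1) = 1 - ρ⁻¹ := by rw [hε]; field_simp
  have hεle : ε ≤ 1 - ρ⁻¹ := by
    have : 0 ≤ ε * N := by positivity
    linarith
  refine ⟨max p (1 - ε), le_max_left _ _, max_lt hp1 (by linarith), ?_⟩
  rw [inv_le_comm₀ (pow_pos (lt_max_of_lt_left hp0) N) (by linarith)]
  have h1 := one_add_mul_le_pow (a := -ε) (by linarith) N
  calc ρ⁻¹ ≤ 1 + N * -ε := by linarith
    _ ≤ (1 + -ε) ^ N := h1
    _ ≤ _ := pow_le_pow_left₀ (by linarith) (by rw [← sub_eq_add_neg]; exact le_max_right _ _) N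

variable {A B : ℕ → Matrix (Fin M) (Fin M) ℝ} {u : Fin M → ℝ} {form : HatForm}

/-- The data that make cyclic reduction converge: constants `c` and `κ` and a base `p < 1` such
that, from some iterate on, `φ_even` is of size `c p^(2ⁿ)` and `(I - φ_odd)⁻¹` of size `2 κ`, and
this in every disk whose radius is the square of a number in `[1, p^(-2ⁿ)]`. -/
theorem exists_stage_bounds (hAB : IsErgodicMG1 A B) (hroot : HasSimpleUnitRoot A)
    (hu0 : ∀ i, 0 < u i) (hu : ∑ i, u i = 1) (hCR : NoBreakdown form A u) :
    ∃ (p c κ : ℝ) (n₀ : ℕ), 0 < p ∧ p < 1 ∧ 0 ≤ c ∧ 0 ≤ κ ∧ ∀ n, n₀ ≤ n →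
      κ * (c * p ^ 2 ^ n) ≤ 1 / 2 ∧ ∀ y : ℝ, 1 ≤ y → y ≤ (p ^ 2 ^ n)⁻¹ →
        rnorm (ENNReal.ofReal y ^ 2) (evenPart (exactSeq form A u n).1) ≤
            ENNReal.ofReal (c * p ^ 2 ^ n) ∧
          rnorm (ENNReal.ofReal y ^ 2) (kernelInv (exactSeq form A u n).1) ≤
            2 * ENNReal.ofReal κ := by
  obtain ⟨R, hR, hA, hs⟩ := exists_radius (u := u) hAB hroot
  have hinv : ∀ z : ℂ, ‖z‖ = 1 → IsUnit (symbol (seriesOf (shifted A u)) z) := fun z hz =>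
    isUnit_symbol_shifted hu hroot hR hA hs hz
  obtain ⟨ρ, C, hρ, hdecay⟩ := greenCoeff_decay hR hs hinv
  have hact := act_greenCoeff hR hs hinv
  obtain ⟨H, hHdef⟩ : ∃ H, H = greenCoeff (seriesOf (shifted A u)) := ⟨_, rfl⟩
  rw [← hHdef] at hdecay hact
  have hρ0 : 0 < ρ⁻¹ := inv_pos.mpr (by linarith)
  have hρ1 : ρ⁻¹ < 1 := inv_lt_one_of_one_lt₀ hρ
  have hunit : IsUnit (H 0) := isUnit_central hAB hu0 hu (rnorm_one_ne_top_of_summable hR hA)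
    (rnorm_one_ne_top_of_summable hR hs) hρ0.le hρ1 hdecay hact
  obtain ⟨U, hU⟩ := hunit
  obtain ⟨G, hG⟩ : ∃ G : Matrix (Fin M) (Fin M) ℂ, G = ↑U⁻¹ := ⟨_, rfl⟩
  have hHG : H 0 * G = 1 := by rw [← hU, hG, Units.mul_inv]
  have hGH : G * H 0 = 1 := by rw [← hU, hG, Units.inv_mul]
  have hC : 0 ≤ C := by simpa using (norm_nonneg _).trans (hdecay 0)
  -- of the four powers of `p ^ 2 ^ n` gained by `h(±1)`, two are spent on the weight `y` and on
  -- the factor `y` in front, one makes the sum converge, and one remains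
  obtain ⟨p, hp⟩ : ∃ p, p = √(√ρ⁻¹) := ⟨_, rfl⟩
  have hp0 : 0 < p := hp ▸ Real.sqrt_pos.mpr (Real.sqrt_pos.mpr hρ0)
  have hp4 : p ^ 4 = ρ⁻¹ := by
    rw [hp, show (4 : ℕ) = 2 * 2 from rfl, pow_mul, Real.sq_sqrt (Real.sqrt_nonneg _),
      Real.sq_sqrt hρ0.le]
  have hp1 : p < 1 := by
    by_contra! hcon
    have := one_le_pow₀ hcon (n := 4)
    linarith
  have hHB : ∀ k, ‖H k‖ ≤ C := fun k =>
    (hdecay k).trans (mul_le_of_le_one_right hC (pow_le_one₀ hρ0.le hρ1.le))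
  have hfin : ∀ n, rnorm 1 (exactSeq form A u n).1 ≠ ⊤ := fun n => by
    obtain ⟨r, hr, h1, -⟩ := exists_radius_exactSeq hR hs hCR n
    exact ne_top_of_le_ne_top h1 (rnorm_mono (one_le_ofReal hr.le) _)
  obtain ⟨T, hT⟩ : ∃ T, T = C * ∑' m : ℤ, p ^ m.natAbs := ⟨_, rfl⟩
  have hT0 : 0 ≤ T := by
    rw [hT]
    exact mul_nonneg hC (tsum_nonneg fun m => by positivity)
  obtain ⟨c, hc⟩ : ∃ c, c = 2 * (‖G‖ * (1 + ‖1 - G‖) * T) := ⟨_, rfl⟩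
  have hc0 : 0 ≤ c := by rw [hc]; positivity
  have hlim : Tendsto (fun n : ℕ => (‖G‖ * T + ‖H 0‖ * c) * p ^ 2 ^ n) atTop (𝓝 0) := by
    have h1 := (tendsto_pow_atTop_nhds_zero_of_lt_one hp0.le hp1).comp
      (tendsto_pow_atTop_atTop_of_one_lt (one_lt_two (α := ℕ)))
    simpa using h1.const_mul (‖G‖ * T + ‖H 0‖ * c)
  obtain ⟨n₀, hn₀⟩ := eventually_atTop.mp
    (hlim.eventually_le_const (show (0 : ℝ) < 1 / 2 by norm_num))
  refine ⟨p, c, ‖H 0‖, n₀, hp0, hp1, hc0, norm_nonneg _, fun n hn => ?_⟩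
  obtain ⟨x, hx⟩ : ∃ x, x = p ^ 2 ^ n := ⟨_, rfl⟩
  have hx0 : 0 < x := by rw [hx]; positivity
  have hxp : x ≤ p := by
    rw [hx]
    exact pow_le_of_le_one hp0.le hp1.le (by positivity)
  have hsmall := hn₀ n hn
  rw [← hx] at hsmall ⊢
  have hGT : 0 ≤ ‖G‖ * T * x := by positivity
  have hHc : 0 ≤ ‖H 0‖ * c * x := by positivity
  have hκ : ‖H 0‖ * (c * x) ≤ 1 / 2 := by linarith
  refine ⟨hκ, fun y hy1 hyx => ?_⟩
  obtain ⟨h, hh⟩ : ∃ h : ℤ → Matrix (Fin M) (Fin M) ℂ, h = fun k => H (2 ^ n * k) := ⟨_, rfl⟩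
  have hhd : ∀ m, ‖h m‖ ≤ C * (x ^ 4) ^ m.natAbs := fun m => by
    rw [hh]
    refine (hdecay _).trans (le_of_eq ?_)
    rw [← hp4, hx, Int.natAbs_mul, Int.natAbs_pow, ← pow_mul, ← pow_mul, ← pow_mul]
    rw [show (2 : ℤ).natAbs = 2 from rfl]
    congr 2
    ring
  have hoff := mul_offNorm_le hC hp1 hx0 hxp hy1 hyx hhd
  rw [← hT] at hoff
  have hy1' := one_le_ofReal hy1
  have hoff1 : offNorm (ENNReal.ofReal y) h ≤ ENNReal.ofReal (T * x) :=
    (le_mul_of_one_le_left' hy1').trans hoff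
  have hh0 : h 0 = H 0 := by rw [hh]; simp
  have hGd : ‖G‖ₑ * offNorm (ENNReal.ofReal y) h ≤ 1 / 2 := by
    refine (mul_le_mul_right hoff1 _).trans ?_
    rw [← ofReal_norm, ← ENNReal.ofReal_mul (norm_nonneg _), ← ofReal_one_half]
    exact ENNReal.ofReal_le_ofReal (by linarith)
  have key := rnorm_sub_le_of_act (φ := (exactSeq form A u n).1) (h := h) (G := G) (B := C) hy1'
    ENNReal.ofReal_ne_top (hfin n) (fun k => by rw [hh]; exact hHB _) (by rw [hh0, hHG])
    (fun k => by
      rw [hh]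
      exact act_exactSeq hCR hfin hHB hact n k) hGd
  have hη : 2 * (‖G‖ₑ * (1 + ‖1 - G‖ₑ) * (ENNReal.ofReal y * offNorm (ENNReal.ofReal y) h)) ≤
      ENNReal.ofReal (c * x) := by
    refine (mul_le_mul_right (mul_le_mul_right hoff _) _).trans (le_of_eq ?_)
    obtain ⟨t, ht⟩ : ∃ t, t = T * x := ⟨_, rfl⟩
    have e : c * x = 2 * (‖G‖ * (1 + ‖1 - G‖) * t) := by rw [hc, ht]; ring
    rw [← ht, e, ← ofReal_norm, ← ofReal_norm, ENNReal.ofReal_mul zero_le_two,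
      ENNReal.ofReal_mul (by positivity), ENNReal.ofReal_mul (norm_nonneg _),
      ENNReal.ofReal_add zero_le_one (norm_nonneg _)]
    simp
  have hκ' : ‖H 0‖ₑ * ENNReal.ofReal (c * x) ≤ 1 / 2 := by
    rw [← ofReal_norm, ← ENNReal.ofReal_mul (norm_nonneg _), ← ofReal_one_half]
    exact ENNReal.ofReal_le_ofReal hκ
  have hres := rnorm_factors_le (H₀ := H 0) hy1' ENNReal.ofReal_ne_top hGH (hCR n).1
    (key.trans hη) hκ'
  rwa [← ofReal_norm] at hres

theorem starNorm_exactSeq_ne_top (hAB : IsErgodicMG1 A B) (hroot : HasSimpleUnitRoot A)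
    (hCR : NoBreakdown form A u) (n : ℕ) :
    starNorm (exactSeq form A u n).1 ≠ ⊤ ∧ starNorm (exactSeq form A u n).2 ≠ ⊤ := by
  obtain ⟨R, hR, -, hs⟩ := exists_radius (u := u) hAB hroot
  obtain ⟨r, hr, h1, h2⟩ := exists_radius_exactSeq hR hs hCR n
  have hr' := one_le_ofReal hr.le
  exact ⟨(starNorm_ne_top_iff _).mpr (ne_top_of_le_ne_top h1 (rnorm_mono hr' _)),
    (starNorm_ne_top_iff _).mpr (ne_top_of_le_ne_top h2 (rnorm_mono hr' _))⟩

/-- The factors of cyclic reduction decay double exponentially. -/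
theorem exists_isRate (hAB : IsErgodicMG1 A B) (hroot : HasSimpleUnitRoot A)
    (hu0 : ∀ i, 0 < u i) (hu : ∑ i, u i = 1) (hCR : NoBreakdown form A u) :
    ∃ θ σ : ℝ, IsRate form A u θ σ := by
  obtain ⟨R, hR, -, hsh⟩ := exists_radius (u := u) hAB hroot
  have hrad := exists_radius_exactSeq hR hsh hCR
  have hsn := starNorm_exactSeq_ne_top hAB hroot hCR
  obtain ⟨p, c, κ, n₀, hp0, hp1, hc, hκ, hstage⟩ :=
    exists_stage_bounds hAB hroot hu0 hu hCR
  obtain ⟨ρ, hρ, -, hρ2⟩ := hrad n₀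
  -- `τ` is so close to one that `φ̂` is finite in the disk of radius `τ ^ (-2 ^ n₀)` at step `n₀`
  obtain ⟨τ, hpτ, hτ1, hτρ⟩ := exists_near_one hp0 hp1 hρ (2 ^ n₀)
  have hτ0 : 0 < τ := hp0.trans_le hpτ
  -- the radii `τ ^ (-2ⁿ)`, squared at every step
  obtain ⟨y, hy⟩ : ∃ y : ℕ → ℝ, y = fun n => (τ ^ 2 ^ n)⁻¹ := ⟨_, rfl⟩
  have hτn : ∀ n, 0 < τ ^ 2 ^ n := fun n => by positivity
  have hy1 : ∀ n, 1 ≤ y n := fun n => by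
    rw [hy]
    exact (one_le_inv₀ (hτn n)).mpr (pow_le_one₀ hτ0.le hτ1.le)
  have hyp : ∀ n, y n ≤ (p ^ 2 ^ n)⁻¹ := fun n => by
    rw [hy]
    exact inv_anti₀ (by positivity) (pow_le_pow_left₀ hp0.le hpτ _)
  have hysq : ∀ n, ENNReal.ofReal (y n) ^ 2 = ENNReal.ofReal (y (n + 1)) := fun n => by
    rw [← ENNReal.ofReal_pow (by linarith [hy1 n]), hy]
    simp only
    rw [inv_pow, ← pow_mul, pow_succ]
  have hy1' : ∀ n, 1 ≤ ENNReal.ofReal (y n) := fun n => one_le_ofReal (hy1 n)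
  have hyinv : ∀ n, (ENNReal.ofReal (y n))⁻¹ = ENNReal.ofReal (τ ^ 2 ^ n) := fun n => by
    rw [hy, ENNReal.ofReal_inv_of_pos (hτn n), inv_inv]
  have hη : ∀ n, n₀ ≤ n → ENNReal.ofReal κ * ENNReal.ofReal (c * p ^ 2 ^ n) ≤ 1 / 2 := by
    intro n hn
    rw [← ENNReal.ofReal_mul hκ, ← ofReal_one_half]
    exact ENNReal.ofReal_le_ofReal (hstage n hn).1
  obtain ⟨m, hm⟩ : ∃ m, m = (rnorm (ENNReal.ofReal ρ) (exactSeq form A u n₀).2).toReal := ⟨_, rfl⟩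
  have hm0 : 0 ≤ m := hm ▸ ENNReal.toReal_nonneg
  have hhat : ∀ n, n₀ ≤ n → rnorm (ENNReal.ofReal (y n)) (exactSeq form A u n).2 ≤
      ENNReal.ofReal (m * 2 ^ n) := by
    intro n hn
    induction n, hn using Nat.le_induction with
    | base =>
      have hyρ : y n₀ ≤ ρ := by
        rw [hy]
        exact hτρ
      refine (rnorm_mono (ENNReal.ofReal_le_ofReal hyρ) _).trans ?_
      rw [← ENNReal.ofReal_toReal hρ2, ← hm]
      exact ENNReal.ofReal_le_ofReal (le_mul_of_one_le_right hm0 (one_le_pow₀ one_le_two))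
    | succ n hn ih =>
      obtain ⟨ha, hK⟩ := (hstage n hn).2 (y n) (hy1 n) (hyp n)
      rw [← hysq]
      refine (rnorm_hat_step form (hy1' n) ha hK (hη n hn) ih).trans (le_of_eq ?_)
      rw [← ENNReal.ofReal_ofNat 2, ← ENNReal.ofReal_mul (by norm_num)]
      congr 1
      ring
  -- the factor formed with `φ̂` at step `k + 1` is governed by the radius of step `k`
  obtain ⟨s, hs⟩ : ∃ s, s = √τ := ⟨_, rfl⟩
  have hs0 : 0 < s := hs ▸ Real.sqrt_pos.mpr hτ0
  have hsτ : s ^ 2 = τ := by rw [hs, Real.sq_sqrt hτ0.le]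
  have hs1 : s < 1 := by
    by_contra! hcon
    have := one_le_pow₀ hcon (n := 2)
    linarith
  have hps : p ≤ s := by
    refine hpτ.trans ?_
    rw [← hsτ]
    exact pow_le_of_le_one hs0.le hs1.le two_ne_zero
  obtain ⟨X, hX⟩ : ∃ X : ℕ → ℝ≥0∞, X = fun n => starNorm (seriesV (exactSeq form A u n)) +
    starNorm (seriesW (exactSeq form A u n)) +
    starNorm (seriesHat form (exactSeq form A u n)) := ⟨_, rfl⟩
  have hfin : ∀ n, X n ≠ ⊤ := by
    intro n
    obtain ⟨h1', h2'⟩ := hsn n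
    have hK := (hCR n).2
    have e1 := ne_top_of_le_ne_top h1' (starNorm_evenPart_le _)
    have e2 := ne_top_of_le_ne_top h2' (starNorm_evenPart_le _)
    have o2 := ne_top_of_le_ne_top h2' (starNorm_oddPart_le _)
    have hmul : ∀ {S T : MSeries M}, starNorm S ≠ ⊤ → starNorm T ≠ ⊤ → starNorm (S * T) ≠ ⊤ :=
      fun hS hT => ne_top_of_le_ne_top (ENNReal.mul_ne_top hS hT) (starNorm_mul_le _ _)
    rw [hX]
    refine ENNReal.add_ne_top.mpr ⟨ENNReal.add_ne_top.mpr ⟨hmul e1 hK, hmul hK e1⟩, ?_⟩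
    cases form with
    | schur => exact hmul o2 hK
    | mirrored => exact hmul hK e2
  have hXle : ∀ n, n₀ + 1 ≤ n → X n ≤ ENNReal.ofReal
      ((4 * κ * c + 4 * κ * (1 + κ * c) * m) * 2 ^ n * s ^ 2 ^ n) := by
    intro n hn
    obtain ⟨k, rfl⟩ : ∃ k, n = k + 1 := ⟨n - 1, by omega⟩
    have hk : n₀ ≤ k := by omega
    obtain ⟨ha, hK⟩ := (hstage k hk).2 (y k) (hy1 k) (hyp k)
    obtain ⟨ha', hK'⟩ := (hstage (k + 1) (by omega)).2 (y (k + 1)) (hy1 (k + 1)) (hyp (k + 1))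
    have h1y : 1 ≤ ENNReal.ofReal (y (k + 1)) ^ 2 := one_le_pow₀ (hy1' (k + 1))
    have hVW : ∀ S : MSeries M, rnorm (ENNReal.ofReal (y (k + 1)) ^ 2) S ≤
        ENNReal.ofReal (c * p ^ 2 ^ (k + 1)) * (2 * ENNReal.ofReal κ) →
        starNorm S ≤ ENNReal.ofReal (2 * κ * c * (2 ^ (k + 1) * s ^ 2 ^ (k + 1))) := by
      intro S hS
      refine (starNorm_le_rnorm_one S).trans ((rnorm_mono h1y S).trans (hS.trans ?_))
      rw [← ENNReal.ofReal_ofNat 2, ← ENNReal.ofReal_mul (by norm_num),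
        ← ENNReal.ofReal_mul (by positivity)]
      refine ENNReal.ofReal_le_ofReal ?_
      calc c * p ^ 2 ^ (k + 1) * (2 * κ) = 2 * κ * c * (1 * p ^ 2 ^ (k + 1)) := by ring
        _ ≤ _ := by
          gcongr
          exact one_le_pow₀ one_le_two
    have hV := hVW (seriesV (exactSeq form A u (k + 1)))
      ((rnorm_mul_le _ _ _).trans (mul_le_mul' ha' hK'))
    have hW := hVW (seriesW (exactSeq form A u (k + 1)))
      ((rnorm_mul_le _ _ _).trans (by rw [mul_comm]; exact mul_le_mul' ha' hK'))
    have hH : starNorm (seriesHat form (exactSeq form A u (k + 1))) ≤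
        ENNReal.ofReal (4 * κ * (1 + κ * c) * m * (2 ^ (k + 1) * s ^ 2 ^ (k + 1))) := by
      have hKr : rnorm (ENNReal.ofReal (y k) ^ 2)
          (kernelInv (crStep form (exactSeq form A u k)).1) ≤ 2 * ENNReal.ofReal κ := by
        rw [hysq]
        exact (rnorm_le_sq (hy1' (k + 1)) _).trans hK'
      have h1 := rnorm_seriesHat_crStep_le form (hy1' k) ENNReal.ofReal_ne_top ha hK (hη k hk)
        (hhat k hk) hKr
      refine (starNorm_le_rnorm_one _).trans (h1.trans ?_)
      rw [hyinv, ← ENNReal.ofReal_mul hκ, ← ENNReal.ofReal_add (by positivity) (by positivity),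
        ← ENNReal.ofReal_ofNat 4, ← ENNReal.ofReal_mul (by norm_num),
        ← ENNReal.ofReal_mul (by positivity), ← ENNReal.ofReal_mul (by positivity)]
      refine ENNReal.ofReal_le_ofReal ?_
      have e : s ^ 2 ^ (k + 1) = τ ^ 2 ^ k := by rw [pow_succ, mul_comm, pow_mul, hsτ]
      rw [e]
      calc 4 * κ * (τ ^ 2 ^ k + κ * (c * p ^ 2 ^ k)) * (m * 2 ^ k)
          ≤ 4 * κ * (τ ^ 2 ^ k + κ * (c * τ ^ 2 ^ k)) * (m * 2 ^ (k + 1)) := by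
            gcongr
            · exact one_le_two
            · omega
        _ = _ := by ring
    rw [hX]
    refine (add_le_add (add_le_add hV hW) hH).trans (le_of_eq ?_)
    rw [← ENNReal.ofReal_add (by positivity) (by positivity),
      ← ENNReal.ofReal_add (by positivity) (by positivity)]
    congr 1
    ring
  obtain ⟨θ, σ, hθ, hσ0, hσ1, hbound⟩ :=
    exists_double_exponential_bound hfin (by positivity) hs0 hs1 hXle
  have hle : ∀ n, starNorm (seriesV (exactSeq form A u n)) ≤ X n ∧
      starNorm (seriesW (exactSeq form A u n)) ≤ X n ∧
      starNorm (seriesHat form (exactSeq form A u n)) ≤ X n := fun n => by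
    rw [hX]
    exact ⟨le_self_add.trans le_self_add, le_add_self.trans le_self_add, le_add_self⟩
  exact ⟨θ, σ, hθ, hσ0, hσ1, fun n => (hle n).1.trans (hbound n),
    fun n => (hle n).2.1.trans (hbound n), fun n => (hle n).2.2.trans (hbound n)⟩

end Rate

end MG1

theorem theorem3 {M : ℕ} (A B : ℕ → Matrix (Fin M) (Fin M) ℝ)
    (hAB : IsErgodicMG1 A B) (hroot : HasSimpleUnitRoot A)
    (u : Fin M → ℝ) (hu_pos : ∀ i, 0 < u i) (hu_sum : ∑ i, u i = 1)
    (form : HatForm) (hCR : NoBreakdown form A u) :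
    (∃ θ σ : ℝ, IsRate form A u θ σ) ∧
    ∀ θ σ : ℝ, IsRate form A u θ σ → ∀ n : ℕ,
      (∃ C υ₀ : ℝ, 0 < C ∧ 0 < υ₀ ∧ ∀ υ : ℝ, 0 < υ → υ ≤ υ₀ →
        ∀ TF : ℕ → MSeries M × MSeries M → MSeries M × MSeries M,
          (∀ k ≤ n, starNorm (localError form A u TF k).1 ≤ ENNReal.ofReal υ ∧
            starNorm (localError form A u TF k).2 ≤ ENNReal.ofReal υ) →
          starNorm (globalError form A u TF (n + 1)).1 ≤
              ENNReal.ofReal (υ * gamSum θ σ n + C * υ ^ 2) ∧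
            starNorm (globalError form A u TF (n + 1)).2 ≤
              ENNReal.ofReal (υ * gamSum θ σ n + C * υ ^ 2)) ∧
      ∀ υ : ℝ, 0 < υ →
        υ * gamSum θ σ n ≤ υ * (1 + n * Real.exp (2 * θ * (σ ^ 2 / (1 - σ ^ 2)))) := by
  refine ⟨exists_isRate hAB hroot hu_pos hu_sum hCR, fun θ σ hrate n =>
    ⟨exists_error_bound hrate hCR (starNorm_exactSeq_ne_top hAB hroot hCR) n, fun υ hυ => ?_⟩⟩
  exact mul_le_mul_of_nonneg_left
    (gamSum_le hrate.theta_pos hrate.sigma_pos hrate.sigma_lt_one n) hυ.le
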